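/- Fix $\sigma_c>0$, let $\chi=\mathbf 1_{\mathbb R\setminus[-\sigma_c,\sigma_c]}$, let $\dot\gamma_\infty>0$ be a constant shear rate and put $\omega=\sigma_c/\dot\gamma_\infty$. Let $p_0\in L^1(\mathbb R)\cap L^\infty(\mathbb R)$ with $p_0\ge 0$ a.e., $\int p_0=1$ and $\int|\sigma|p_0\,d\sigma<\infty$. Let $p\in C^0([0,\infty);L^1(\mathbb R))$ with $p(0,\cdot)=p_0$ be the solution of $$\partial_t p+\dot\gamma_\infty\,\partial_\sigma p=-\chi p+\Big(\int\chi p\,d\sigma\Big)\delta_0\quad\text{in }\mathcal D'((0,\infty)\times\mathbb R),$$ let $f(t)=\int\chi(\sigma)p(t,\sigma)\,d\sigma$, and let $p_\infty\in L^1(\mathbb R)$, $p_\infty\ge0$ a.e., $\int p_\infty=1$, be the stationary solution, i.e. $\dot\gamma_\infty p_\infty'=-\chi p_\infty+(\int\chi p_\infty)\delta_0$ in $\mathcal D'(\mathbb R)$. Then, as $t\to\infty$, $p(t,\sigma)$ converges exponentially fast to $p_\infty(\sigma)$ for almost every $\sigma\in\mathbb R$ (for a jointly measurable version of $p$), and $f(t)$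 converges exponentially fast to $\int\chi p_\infty$. More precisely: 1. There is $b=b(\omega)>0$, and there is $C_1>0$, such that for all $t\ge0$ and almost all $\sigma\in\mathbb R$ $$|p(t,\sigma)-p_\infty(\sigma)|\le C_1\Big(e^{-t}+\big(e^{-bt}e^{b\sigma/\dot\gamma_\infty}+e^{-t}e^{\sigma/\dot\gamma_\infty}\big)\mathbf 1_{(0,\dot\gamma_\infty t)}(\sigma)\Big),\tag{a}$$ and there is a positive continuous function $C_2$ on $(0,\infty)$, depending on none of $\sigma_c,\dot\gamma_\infty,p_0$, such that for all $t\ge0$ $$\Big|f(t)-\int\chi p_\infty\Big|\le C_2(\omega)\big(e^{-bt}+e^{-t}\big).\tag{b}$$ 2. For every $\omega>0$ both maxima $$m_{\rm root}(\omega)=\max\{\operatorname{Re}\lambda:\ \lambda\in\mathbb C\setminus\{0\},\ \lambda+1-e^{-\omega\lambda}=0\},$$ $$m_{\rm real}(\omega)=\max\{x<0:\ x+1-e^{-\omega x}\cos(\omega\sqrt{e^{-2\omega x}-(x+1)^2})=0\}$$ exist and are negative. For every $\eta>0$ there is a positive continuous function $C_2$ on $(0,\infty)$, depending only on $\eta$,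 such that, whenever $m\in\{m_{\rm root}(\omega),m_{\rm real}(\omega)\}$ and $b=-m-\eta>0$, the estimate (b) holds with this $b$ and this $C_2$, and the estimate (a) holds with this $b$ and some $C_1>0$. -/

import Mathlib

open MeasureTheory Set Filter

noncomputable section

/-- The characteristic function `χ` of `ℝ \ [-σc, σc]`. -/
def chi (σc : ℝ) : ℝ → ℝ := (Icc (-σc) σc)ᶜ.indicator 1

/-- The fluidity `∫ χ p` of a density `p`. -/
def fluidity (σc : ℝ) (p : ℝ → ℝ) : ℝ := ∫ σ, chi σc σ * p σ

/-- Admissible initial data: bounded probability densities with a finite first moment. -/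
structure IsInitialDatum (p₀ : ℝ → ℝ) : Prop where
  integrable : Integrable p₀
  bounded : MemLp p₀ ⊤
  nonneg : 0 ≤ᵐ[volume] p₀
  integral_eq_one : ∫ σ, p₀ σ = 1
  moment : Integrable (fun σ => |σ| * p₀ σ)

/-- `p` satisfies `∂ₜ p + γdot(t) ∂_σ p = -χ p + (∫ χ p) δ₀` in `𝓓'((0, ∞) × ℝ)`. A test function is
a smooth function `ψ` of `(t, σ)` with compact support in `(0, ∞) × ℝ`. -/
def SolvesFokkerPlanck (σc : ℝ) (γdot : ℝ → ℝ) (p : ℝ → (ℝ →₁[volume] ℝ)) : Prop :=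
  ∀ ψ : ℝ × ℝ → ℝ, ContDiff ℝ (⊤ : ℕ∞) ψ → HasCompactSupport ψ →
    tsupport ψ ⊆ Ioi (0 : ℝ) ×ˢ (univ : Set ℝ) →
    -(∫ t in Ioi (0 : ℝ), ∫ σ, p t σ *
        (deriv (fun s => ψ (s, σ)) t + γdot t * deriv (fun s => ψ (t, s)) σ))
      = -(∫ t in Ioi (0 : ℝ), ∫ σ, chi σc σ * p t σ * ψ (t, σ))
        + ∫ t in Ioi (0 : ℝ), fluidity σc (p t) * ψ (t, 0)

/-- `p` is the solution in `C⁰([0, ∞); L¹(ℝ))` with initial condition `p₀`. The values of `p` at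
negative times are irrelevant. -/
structure IsSolution (σc : ℝ) (γdot : ℝ → ℝ) (p₀ : ℝ → ℝ) (p : ℝ → (ℝ →₁[volume] ℝ)) : Prop where
  continuousOn : ContinuousOn p (Ici 0)
  initial : p 0 =ᵐ[volume] p₀
  equation : SolvesFokkerPlanck σc γdot p

/-- `pinf` is a probability density with `γ pinf' = -χ pinf + (∫ χ pinf) δ₀` in `𝓓'(ℝ)`. -/
structure IsStationaryState (σc γ : ℝ) (pinf : ℝ → ℝ) : Prop where
  integrable : Integrable pinf
  nonneg : 0 ≤ᵐ[volume] pinf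
  integral_eq_one : ∫ σ, pinf σ = 1
  equation : ∀ φ : ℝ → ℝ, ContDiff ℝ (⊤ : ℕ∞) φ → HasCompactSupport φ →
    -(γ * ∫ σ, pinf σ * deriv φ σ)
      = -(∫ σ, chi σc σ * pinf σ * φ σ) + fluidity σc pinf * φ 0

/-- The real parts of the nonzero roots of `λ + 1 - exp (-ω λ)`. -/
def rootReals (ω : ℝ) : Set ℝ :=
  {x | ∃ z : ℂ, z ≠ 0 ∧ z + 1 - Complex.exp (-ω * z) = 0 ∧ z.re = x}

/-- The negative solutions `x` of `x + 1 - exp (-ω x) cos (ω √(exp (-2 ω x) - (x + 1)²)) = 0`.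
For `ω > 0` and `x < 0` with a negative radicand one has `x < -2`, so that Lean's value `0` of the
square root creates no solution. -/
def rateReals (ω : ℝ) : Set ℝ :=
  {x | x < 0 ∧ x + 1 - Real.exp (-ω * x) *
    Real.cos (ω * Real.sqrt (Real.exp (-2 * ω * x) - (x + 1) ^ 2)) = 0}

/-- The right-hand side
`exp(-t) + (exp(-b t) exp(b σ / γ) + exp(-t) exp(σ / γ)) 1_{(0, γ t)}(σ)`. -/
def densityBound (γ b t σ : ℝ) : ℝ :=
  Real.exp (-t) + (Ioo 0 (γ * t)).indicator
    (fun s => Real.exp (-b * t) * Real.exp (b * (s / γ)) + Real.exp (-t) * Real.exp (s / γ)) σ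

/-- The density estimate with rate `b`, for some prefactor. -/
def DensityEstimate (γ b : ℝ) (p : ℝ → (ℝ →₁[volume] ℝ)) (pinf : ℝ → ℝ) : Prop :=
  ∃ C₁ > 0, ∀ t ≥ 0, ∀ᵐ σ, |p t σ - pinf σ| ≤ C₁ * densityBound γ b t σ

/-- The fluidity estimate with rate `b` and prefactor `C`. -/
def FluidityEstimate (σc b C : ℝ) (p : ℝ → (ℝ →₁[volume] ℝ)) (pinf : ℝ → ℝ) : Prop :=
  ∀ t ≥ 0, |fluidity σc (p t) - fluidity σc pinf| ≤ C * (Real.exp (-b * t) + Real.exp (-t))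

/-- A jointly measurable version of `p` converges to `pinf` exponentially fast as `t → ∞`, for
almost every fixed `σ`. -/
def PointwiseExpConvergence (p : ℝ → (ℝ →₁[volume] ℝ)) (pinf : ℝ → ℝ) : Prop :=
  ∃ P : ℝ → ℝ → ℝ, Measurable (Function.uncurry P) ∧ (∀ t ≥ 0, P t =ᵐ[volume] p t) ∧
    ∃ a > 0, ∀ᵐ σ, ∃ C, ∀ t ≥ 0, |P t σ - pinf σ| ≤ C * Real.exp (-a * t)

end

/-! Along the lines `σ - γ t = const` the equation is an ordinary differential equation with
integrating factor `w = exp (γ⁻¹ ∫₀ χ)` (`expWeight`): the product `p w` is freely transported, with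
source `f(t) δ₀` (`transport_expWeight`). So `p(T)` is the sum of two parts
(`ae_eq_transported_add_emitted`). One is the shifted initial datum, damped by `w(σ - γ T) / w(σ) ≤
exp (2 ω - T)`. The other lives on `(0, γ T)` and equals `γ⁻¹ f(T - σ / γ) / w(σ)` there. Everything
is thereby reduced to the scalar function `f`.

Put `J(t) = ∫₀ᵗ exp (-(t - s)) f(s) ds`, so that `J' = f - J`. Integrating the formula against `χ`
gives `f(t) = J(t - ω) + O(exp (-t))`. Integrating it against `1` and using conservation of mass
gives `J(t - ω) + ∫ f = 1 + O(exp (-t))`, with the integral over `[t - ω, t]`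
(`renewalSystem_fluidity`). Hence `J'(t) = J(t - ω) - J(t)` up to an exponentially small error. The
characteristic function of this delay equation is `z + 1 - exp (-ω z)`. Its nonzero roots lie in the
open left half plane. The root `0` corresponds to the constants, and the mass fixes the constant to
be `1 / (1 + ω)`.

In the time unit `ω`, translation by one delay is a bounded operator on `C([0, 1])` that preserves a
mass functional. Subtracting the projection onto the constants leaves an operator whose nonzero
spectral values have the form `exp (ω z)` with `z` a nonzero root
(`norm_lt_of_mem_spectrum_reducedStep`). Gelfand's formula then makes some power of it small, and a
discrete Duhamel argument absorbs the error (`eventually_renewal_estimate`).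

Smallness of one fixed power is an open condition in `ω`, so the constants are locally uniform. A
partition of unity glues them into continuous functions of `ω`
(`exists_continuousOn_forall_mem_convex`). For the rate `-m - η` with `m` the root maximum it also
matters that `m` cannot drop suddenly: roots persist under small changes of `ω`
(`eventually_exists_delaySymbol_root`). The maximum of the real equation is at least the root
maximum, because real parts of roots solve the real equation; so it asks for no faster rate.

The stationary state is a solution constant in time. The same formulas give its fluidity `1 / (1 +
ω)` and, as `T → ∞`, its explicit density; comparing the two representations yields (a). -/

/-! ### Roots of the characteristic function -/

/-- The characteristic function `z + 1 - exp (-ω z)` of the delay equation. -/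
noncomputable def delaySymbol (ω : ℝ) (z : ℂ) : ℂ := z + 1 - Complex.exp (-ω * z)

theorem delaySymbol_eq_zero_iff {ω : ℝ} {z : ℂ} :
    delaySymbol ω z = 0 ↔ z.re + 1 = Real.exp (-ω * z.re) * Real.cos (ω * z.im) ∧
      z.im = -(Real.exp (-ω * z.re) * Real.sin (ω * z.im)) := by
  rw [delaySymbol, Complex.ext_iff]
  simp only [Complex.sub_re, Complex.add_re, Complex.one_re, Complex.exp_re, Complex.mul_re,
    Complex.neg_re, Complex.ofReal_re, Complex.neg_im, Complex.ofReal_im, Complex.mul_im,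
    Complex.sub_im, Complex.add_im, Complex.one_im, Complex.exp_im, Complex.zero_re,
    Complex.zero_im, zero_mul, sub_zero, add_zero, neg_mul, Real.cos_neg, Real.sin_neg]
  constructor <;> rintro ⟨h1, h2⟩ <;> constructor <;> linarith

theorem delaySymbol_root_normSq {ω : ℝ} {z : ℂ} (h : delaySymbol ω z = 0) :
    (z.re + 1) ^ 2 + z.im ^ 2 = Real.exp (-2 * ω * z.re) := by
  obtain ⟨h1, h2⟩ := delaySymbol_eq_zero_iff.1 h
  have e : Real.exp (-2 * ω * z.re) = Real.exp (-ω * z.re) ^ 2 := by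
    rw [← Real.exp_nat_mul]; congr 1; push_cast; ring
  have h3 := Real.sin_sq_add_cos_sq (ω * z.im)
  calc (z.re + 1) ^ 2 + z.im ^ 2
      = (Real.exp (-ω * z.re) * Real.cos (ω * z.im)) ^ 2 +
        (-(Real.exp (-ω * z.re) * Real.sin (ω * z.im))) ^ 2 := by rw [← h1, ← h2]
    _ = Real.exp (-ω * z.re) ^ 2 * (Real.sin (ω * z.im) ^ 2 + Real.cos (ω * z.im) ^ 2) := by ring
    _ = _ := by rw [h3, e, mul_one]

/-- If `Re z ≥ 0`, the modulus identity has left side at least `1` and right side at most `1`.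
Equality forces `z = 0`. -/
theorem delaySymbol_root_re_neg {ω : ℝ} (hω : 0 < ω) {z : ℂ} (hz : z ≠ 0) (h : delaySymbol ω z = 0) :
    z.re < 0 := by
  by_contra! hre
  have h1 := delaySymbol_root_normSq h
  have h2 : Real.exp (-2 * ω * z.re) ≤ 1 := Real.exp_le_one_iff.2 (by nlinarith)
  have h3 : z.re = 0 := by nlinarith [sq_nonneg z.im]
  have h4 : z.im = 0 := by
    have : z.im ^ 2 ≤ 0 := by nlinarith
    nlinarith [sq_nonneg z.im]
  exact hz (Complex.ext h3 h4)

theorem hasDerivAt_delaySymbol (ω : ℝ) (z : ℂ) :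
    HasDerivAt (delaySymbol ω) (1 + ω * Complex.exp (-ω * z)) z := by
  have h1 : HasDerivAt (fun z : ℂ => -(ω : ℂ) * z) (-(ω : ℂ)) z := by
    simpa using (hasDerivAt_id z).const_mul (-(ω : ℂ))
  have := ((hasDerivAt_id z).add_const (1 : ℂ)).sub h1.cexp
  refine this.congr_deriv ?_
  ring

theorem continuous_delaySymbol (ω : ℝ) : Continuous (delaySymbol ω) := by
  unfold delaySymbol
  fun_prop

/-- Write `z = x + i θ / ω` with `θ ∈ (π, 2π)`, where the sine is negative. The imaginary part of
the equation then determines `x` from `θ`, and the real part becomes `H θ = 0`. The intermediate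
value theorem applies since `H π = -π` and `H (2π) = 2π`. -/
theorem exists_delaySymbol_root {ω : ℝ} (hω : 0 < ω) : ∃ z : ℂ, z ≠ 0 ∧ delaySymbol ω z = 0 := by
  let H : ℝ → ℝ := fun θ => (ω - Real.log θ + Real.log ω) * Real.sin θ
    + Real.sin θ * Real.log (Real.sin θ) + θ * Real.cos θ
  have hπ := Real.pi_pos
  have hc : ContinuousOn H (Icc Real.pi (2 * Real.pi)) := by
    have h1 : ContinuousOn Real.log (Icc Real.pi (2 * Real.pi)) :=
      Real.continuousOn_log.mono fun x hx => by
        simp only [mem_compl_iff, mem_singleton_iff]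
        linarith [hx.1]
    -- `s log s` extends continuously by `0`, which makes `H` continuous up to the endpoints, where
    -- the sine vanishes. As `Real.log` is even, `log (sin θ)` stands for `log (-sin θ)`.
    have h2 : Continuous fun θ => Real.sin θ * Real.log (Real.sin θ) :=
      Real.continuous_mul_log.comp Real.continuous_sin
    have h3 := h2.continuousOn (s := Icc Real.pi (2 * Real.pi))
    exact ((((continuousOn_const.sub h1).add continuousOn_const).mul
      Real.continuous_sin.continuousOn).add h3).add
      (continuousOn_id.mul Real.continuous_cos.continuousOn)
  have h0 : (0 : ℝ) ∈ Icc (H Real.pi) (H (2 * Real.pi)) := by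
    simp only [H, Real.sin_pi, Real.cos_pi, Real.sin_two_pi, Real.cos_two_pi]
    constructor <;> simp <;> positivity
  obtain ⟨θ, hθ, hH⟩ := intermediate_value_Icc (by linarith) hc h0
  have hne1 : θ ≠ Real.pi := by
    rintro rfl
    simp only [H, Real.sin_pi, Real.cos_pi] at hH
    simp at hH
  have hne2 : θ ≠ 2 * Real.pi := by
    rintro rfl
    simp only [H, Real.sin_two_pi, Real.cos_two_pi] at hH
    simp at hH
  have hlt1 : Real.pi < θ := lt_of_le_of_ne hθ.1 hne1.symm
  have hlt2 : θ < 2 * Real.pi := lt_of_le_of_ne hθ.2 hne2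
  have hs : Real.sin θ < 0 := by
    have : 0 < Real.sin (θ - Real.pi) := Real.sin_pos_of_pos_of_lt_pi (by linarith) (by linarith)
    rw [Real.sin_sub_pi] at this
    linarith
  have hθ0 : 0 < θ := by linarith
  set x := (Real.log (-Real.sin θ) + Real.log ω - Real.log θ) / ω with hx
  have hωx : ω * x = Real.log (-Real.sin θ) + Real.log ω - Real.log θ := by
    rw [hx]; field_simp
  have hexp : Real.exp (-ω * x) = θ / (ω * -Real.sin θ) := by
    have : -ω * x = Real.log (θ / (ω * -Real.sin θ)) := by
      rw [Real.log_div hθ0.ne' (by nlinarith), Real.log_mul hω.ne' (by linarith)]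
      linarith
    rw [this, Real.exp_log]
    have : 0 < -Real.sin θ := by linarith
    positivity
  have hHx : (ω + ω * x) * Real.sin θ + θ * Real.cos θ = 0 := by
    rw [hωx, Real.log_neg_eq_log]
    simp only [H] at hH
    linarith
  refine ⟨⟨x, θ / ω⟩, ?_, ?_⟩
  · intro h
    have := congrArg Complex.im h
    simp only [Complex.zero_im] at this
    have h' : 0 < θ / ω := by positivity
    linarith
  · rw [delaySymbol_eq_zero_iff]
    simp only
    have e : ω * (θ / ω) = θ := by field_simp
    rw [e, hexp]
    have hs' := hs.ne
    constructor
    · field_simp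
      linarith
    · field_simp

/-- The root `0` is simple, with derivative `1 + ω`, hence isolated. This keeps the other roots from
approaching it when their real parts are maximized. -/
theorem eventually_delaySymbol_ne_zero {ω : ℝ} (hω : 0 < ω) :
    ∃ δ > 0, ∀ z : ℂ, z ≠ 0 → delaySymbol ω z = 0 → δ ≤ ‖z‖ := by
  have h := hasDerivAt_delaySymbol ω 0
  have h1 : ∀ᶠ z in nhdsWithin (0 : ℂ) {0}ᶜ, delaySymbol ω z ≠ 0 := by
    refine h.eventually_ne ?_
    simp only [mul_zero, Complex.exp_zero, mul_one]
    exact_mod_cast (by positivity : (1 + ω : ℝ) ≠ 0)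
  rw [eventually_nhdsWithin_iff, Metric.eventually_nhds_iff] at h1
  obtain ⟨δ, hδ, H⟩ := h1
  refine ⟨δ, hδ, fun z hz hz0 => ?_⟩
  by_contra! hlt
  exact H (by simpa using hlt) hz hz0

theorem mem_rootReals {ω x : ℝ} : x ∈ rootReals ω ↔ ∃ z : ℂ, z ≠ 0 ∧ delaySymbol ω z = 0 ∧ z.re = x :=
  Iff.rfl

theorem exists_isGreatest_rootReals {ω : ℝ} (hω : 0 < ω) : ∃ m < 0, IsGreatest (rootReals ω) m := by
  obtain ⟨z₀, hz₀, hr₀⟩ := exists_delaySymbol_root hω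
  obtain ⟨δ, hδ, hiso⟩ := eventually_delaySymbol_ne_zero hω
  set S : Set ℂ := {z | δ ≤ ‖z‖ ∧ delaySymbol ω z = 0 ∧ z₀.re ≤ z.re} with hS
  have hclosed : IsClosed S :=
    (isClosed_le continuous_const continuous_norm).inter
      ((isClosed_eq (continuous_delaySymbol ω) continuous_const).inter
        (isClosed_le continuous_const Complex.continuous_re))
  -- A root satisfies `z = exp (-ω z) - 1`, so a lower bound for the real part bounds the modulus.
  have hbdd : S ⊆ Metric.closedBall 0 (1 + Real.exp (-ω * z₀.re)) := by
    rintro z ⟨-, hz, hre⟩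
    rw [mem_closedBall_zero_iff]
    have e : z = Complex.exp (-ω * z) - 1 := by
      unfold delaySymbol at hz
      linear_combination hz
    calc ‖z‖ = ‖Complex.exp (-ω * z) - 1‖ := by rw [← e]
      _ ≤ ‖Complex.exp (-ω * z)‖ + ‖(1 : ℂ)‖ := norm_sub_le _ _
      _ = Real.exp (-ω * z.re) + 1 := by rw [Complex.norm_exp]; simp
      _ ≤ 1 + Real.exp (-ω * z₀.re) := by
        rw [add_comm]
        gcongr 1 + Real.exp ?_
        nlinarith
  have hcomp : IsCompact S := (isCompact_closedBall _ _).of_isClosed_subset hclosed hbdd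
  obtain ⟨z, hz, hmax⟩ := hcomp.exists_isMaxOn ⟨z₀, hiso z₀ hz₀ hr₀, hr₀, le_rfl⟩
    Complex.continuous_re.continuousOn
  have hz0 : z ≠ 0 := by
    rintro rfl
    have := hz.1
    simp at this
    linarith
  refine ⟨z.re, delaySymbol_root_re_neg hω hz0 hz.2.1, ⟨z, hz0, hz.2.1, rfl⟩, ?_⟩
  rintro _ ⟨w, hw0, hw, rfl⟩
  rcases le_total z₀.re w.re with h | h
  · exact hmax ⟨hiso w hw0 hw, hw, h⟩
  · exact h.trans hz.2.2

/-! ### The real equation for the rate -/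

/-- At a root the radicand is `(Im z)²` by the modulus identity, and the cosine is even, so the real
equation is the real part of the characteristic equation. -/
theorem rootReals_subset_rateReals {ω : ℝ} (hω : 0 < ω) : rootReals ω ⊆ rateReals ω := by
  rintro _ ⟨z, hz0, hz, rfl⟩
  refine ⟨delaySymbol_root_re_neg hω hz0 hz, ?_⟩
  have h1 := delaySymbol_root_normSq hz
  have h2 : Real.sqrt (Real.exp (-2 * ω * z.re) - (z.re + 1) ^ 2) = |z.im| := by
    rw [← h1, add_sub_cancel_left, Real.sqrt_sq_eq_abs]
  have h3 : Real.cos (ω * |z.im|) = Real.cos (ω * z.im) := by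
    rcases abs_choice z.im with h | h <;> rw [h]
    rw [mul_neg, Real.cos_neg]
  rw [h2, h3]
  linarith [(delaySymbol_eq_zero_iff.1 hz).1]

/-- The derivative is `θ / sin² θ - 1 / θ`, positive because `sin θ < θ`. The function arises by
eliminating `x` from the two real equations in terms of the phase `θ`. -/
theorem strictMonoOn_log_sin_sub :
    StrictMonoOn (fun θ => -(θ * Real.cos θ / Real.sin θ) + Real.log (Real.sin θ) - Real.log θ)
      (Ioo 0 Real.pi) := by
  have hd : ∀ θ ∈ Ioo 0 Real.pi, HasDerivAt
      (fun θ => -(θ * Real.cos θ / Real.sin θ) + Real.log (Real.sin θ) - Real.log θ)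
      (θ / Real.sin θ ^ 2 - 1 / θ) θ := by
    intro θ hθ
    have hs : 0 < Real.sin θ := Real.sin_pos_of_pos_of_lt_pi hθ.1 hθ.2
    have h1 := ((hasDerivAt_id θ).mul (Real.hasDerivAt_cos θ)).div (Real.hasDerivAt_sin θ) hs.ne'
    have h2 := (Real.hasDerivAt_sin θ).log hs.ne'
    have h3 := Real.hasDerivAt_log hθ.1.ne'
    refine ((h1.neg.add h2).sub h3).congr_deriv ?_
    have h4 := Real.sin_sq_add_cos_sq θ
    have h5 := hθ.1.ne'
    simp only [id, Pi.mul_apply]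
    field_simp
    linear_combination θ ^ 2 * h4
  refine strictMonoOn_of_deriv_pos (convex_Ioo _ _)
    (fun θ hθ => (hd θ hθ).continuousAt.continuousWithinAt) fun θ hθ => ?_
  rw [interior_Ioo] at hθ
  rw [(hd θ hθ).deriv]
  have hs : 0 < Real.sin θ := Real.sin_pos_of_pos_of_lt_pi hθ.1 hθ.2
  have hlt : Real.sin θ < θ := Real.sin_lt hθ.1
  have h0 := hθ.1
  rw [sub_pos, div_lt_div_iff₀ h0 (by positivity)]
  nlinarith

/-- With `y` the square root, a phase `ω y < π` makes the sine positive, so the signs agree in `y =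
exp (-ω x) sin (ω y)`. Its logarithm, combined with the real equation, eliminates `x`. By strict
monotonicity, at most one such `x` exists for given `ω`. -/
theorem rateReals_phase {ω x : ℝ} (hω : 0 < ω) (hx : x ∈ rateReals ω) (hx1 : -1 < x)
    (hπ : ω * Real.sqrt (Real.exp (-2 * ω * x) - (x + 1) ^ 2) < Real.pi) :
    ∃ θ ∈ Ioo 0 Real.pi, -(θ * Real.cos θ / Real.sin θ) + Real.log (Real.sin θ) - Real.log θ
        = -ω - Real.log ω ∧ ω * (x + 1) = θ * Real.cos θ / Real.sin θ := by
  obtain ⟨hx0, hx⟩ := hx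
  have hs : 0 < Real.exp (-2 * ω * x) - (x + 1) ^ 2 := by
    have : 1 < Real.exp (-2 * ω * x) := Real.one_lt_exp_iff.2 (by nlinarith)
    nlinarith
  set y := Real.sqrt (Real.exp (-2 * ω * x) - (x + 1) ^ 2) with hy
  have hy0 : 0 < y := Real.sqrt_pos.2 hs
  have hysq : y ^ 2 = Real.exp (-2 * ω * x) - (x + 1) ^ 2 := Real.sq_sqrt hs.le
  have e : Real.exp (-2 * ω * x) = Real.exp (-ω * x) ^ 2 := by
    rw [← Real.exp_nat_mul]; congr 1; push_cast; ring
  have hsin : 0 < Real.sin (ω * y) := Real.sin_pos_of_pos_of_lt_pi (by positivity) hπ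
  have hE := Real.exp_pos (-ω * x)
  have h1 : x + 1 = Real.exp (-ω * x) * Real.cos (ω * y) := by linarith
  have h2 : y = Real.exp (-ω * x) * Real.sin (ω * y) := by
    have h3 := Real.sin_sq_add_cos_sq (ω * y)
    have : y ^ 2 = (Real.exp (-ω * x) * Real.sin (ω * y)) ^ 2 := by
      rw [hysq, e, h1]
      linear_combination -(Real.exp (-ω * x) ^ 2) * h3
    exact (pow_left_inj₀ hy0.le (by positivity) two_ne_zero).1 this
  have h3 : ω * (x + 1) = ω * y * Real.cos (ω * y) / Real.sin (ω * y) := by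
    rw [eq_div_iff hsin.ne']
    calc ω * (x + 1) * Real.sin (ω * y)
        = ω * (Real.exp (-ω * x) * Real.cos (ω * y)) * Real.sin (ω * y) := by rw [← h1]
      _ = ω * (Real.exp (-ω * x) * Real.sin (ω * y)) * Real.cos (ω * y) := by ring
      _ = _ := by rw [← h2]
  have h4 : Real.log y = -ω * x + Real.log (Real.sin (ω * y)) := by
    conv_lhs => rw [h2]
    rw [Real.log_mul hE.ne' hsin.ne', Real.log_exp]
  refine ⟨ω * y, ⟨by positivity, hπ⟩, ?_, h3⟩
  rw [← h3, Real.log_mul hω.ne' hy0.ne', h4]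
  ring

theorem exists_isGreatest_rateReals {ω : ℝ} (hω : 0 < ω) :
    ∃ m < 0, IsGreatest (rateReals ω) m := by
  obtain ⟨m₀, -, hm₀⟩ := exists_isGreatest_rootReals hω
  have hx₁ := rootReals_subset_rateReals hω hm₀.1
  have hcont : Continuous fun x : ℝ =>
      ω * Real.sqrt (Real.exp (-2 * ω * x) - (x + 1) ^ 2) := by fun_prop
  -- The value `x = 0` solves the real equation, so accumulation of negative solutions at `0` must
  -- be excluded. Near `0` the phase is below `π`, which leaves at most one solution in `(-δ, 0)`.
  -- If there is none, the maximum is attained on the compact interval `[m₀, -δ]`.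
  have hev : ∀ᶠ x in nhds (0 : ℝ),
      ω * Real.sqrt (Real.exp (-2 * ω * x) - (x + 1) ^ 2) < Real.pi ∧ -1 < x := by
    refine (hcont.continuousAt.eventually_lt continuousAt_const ?_).and
      (lt_mem_nhds (by norm_num))
    simpa using Real.pi_pos
  obtain ⟨δ, hδ, H⟩ := Metric.eventually_nhds_iff.1 hev
  have H' : ∀ x, -δ < x → x < 0 →
      ω * Real.sqrt (Real.exp (-2 * ω * x) - (x + 1) ^ 2) < Real.pi ∧ -1 < x := fun x h1 h2 =>
    H (by rw [Real.dist_eq, sub_zero, abs_lt]; constructor <;> linarith)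
  have huniq : ∀ x ∈ rateReals ω, ∀ x' ∈ rateReals ω, -δ < x → -δ < x' → x = x' := by
    intro x hx x' hx' h h'
    obtain ⟨a1, a2⟩ := H' x h hx.1
    obtain ⟨b1, b2⟩ := H' x' h' hx'.1
    obtain ⟨θ, hθ, e1, e2⟩ := rateReals_phase hω hx a2 a1
    obtain ⟨θ', hθ', e1', e2'⟩ := rateReals_phase hω hx' b2 b1
    have : θ = θ' := strictMonoOn_log_sin_sub.injOn hθ hθ' (e1.trans e1'.symm)
    rw [this, ← e2'] at e2
    have := mul_left_cancel₀ hω.ne' e2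
    linarith
  by_cases hex : ∃ x ∈ rateReals ω, -δ < x
  · obtain ⟨x, hx, hxδ⟩ := hex
    refine ⟨x, hx.1, hx, fun x' hx' => ?_⟩
    rcases lt_or_ge (-δ) x' with h | h
    · exact (huniq x' hx' x hx h hxδ).le
    · linarith
  · push Not at hex
    set S : Set ℝ := {x | x + 1 - Real.exp (-ω * x) *
      Real.cos (ω * Real.sqrt (Real.exp (-2 * ω * x) - (x + 1) ^ 2)) = 0} with hS
    have hSc : IsClosed S := isClosed_eq (by fun_prop) continuous_const
    have hcomp : IsCompact (Icc m₀ (-δ) ∩ S) := isCompact_Icc.inter_right hSc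
    obtain ⟨x, hx, hmax⟩ := hcomp.exists_isMaxOn
      ⟨m₀, ⟨le_rfl, hex m₀ hx₁⟩, hx₁.2⟩ continuousOn_id
    have hx0 : x < 0 := by linarith [hx.1.2]
    refine ⟨x, hx0, ⟨hx0, hx.2⟩, fun x' hx' => ?_⟩
    rcases le_total m₀ x' with h | h
    · exact hmax ⟨⟨h, hex x' hx'⟩, hx'.2⟩
    · exact h.trans hx.1.1

/-! ### Persistence of roots when the delay varies -/

/-- At a double root `z + 1 = exp (-ω z) = -1 / ω`. Then `z` is real and a positive exponential
equals a negative number. -/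
theorem deriv_delaySymbol_root_ne_zero {ω : ℝ} (hω : 0 < ω) (z : ℂ)
    (h : delaySymbol ω z = 0) : (1 + ω * Complex.exp (-ω * z) : ℂ) ≠ 0 := by
  intro h0
  have hω' : (ω : ℂ) ≠ 0 := by exact_mod_cast hω.ne'
  have e1 : Complex.exp (-ω * z) = z + 1 := by
    unfold delaySymbol at h
    linear_combination -h
  rw [e1] at h0
  have hz : z = ((-1 / ω - 1 : ℝ) : ℂ) := by
    push_cast
    field_simp
    linear_combination h0
  have hre : z.re = -1 / ω - 1 := by rw [hz, Complex.ofReal_re]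
  have him : z.im = 0 := by rw [hz, Complex.ofReal_im]
  have h1 := (delaySymbol_eq_zero_iff.1 h).1
  rw [him, mul_zero, Real.cos_zero, mul_one, hre] at h1
  have h2 := Real.exp_pos (-ω * (-1 / ω - 1))
  have h3 : -1 / ω < 0 := div_neg_of_neg_of_pos (by norm_num) hω
  linarith

/-- A nonzero root of the characteristic function persists under perturbations of the delay. -/
theorem eventually_exists_delaySymbol_root {ω₀ : ℝ} (hω₀ : 0 < ω₀) {z₀ : ℂ} (hz₀ : z₀ ≠ 0)
    (h : delaySymbol ω₀ z₀ = 0) {ε : ℝ} (hε : 0 < ε) :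
    ∀ᶠ ω in nhds ω₀, ∃ z : ℂ, z ≠ 0 ∧ delaySymbol ω z = 0 ∧ z₀.re - ε ≤ z.re := by
  have hd := deriv_delaySymbol_root_ne_zero hω₀ z₀ h
  have h1 := (hasDerivAt_delaySymbol ω₀ z₀).eventually_ne (c := 0) hd
  rw [eventually_nhdsWithin_iff, Metric.eventually_nhds_iff] at h1
  obtain ⟨δ, hδ, H⟩ := h1
  have hz₀' : 0 < ‖z₀‖ := norm_pos_iff.2 hz₀
  -- The radius keeps other roots for `ω₀` out of the closed disc, keeps the real part within `ε`,
  -- and leaves `0` outside the disc.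
  set r := min (δ / 2) (min ε (‖z₀‖ / 2)) with hr
  have hr0 : 0 < r := by positivity
  have hrδ : r < δ := (min_le_left _ _).trans_lt (by linarith)
  have hrε : r ≤ ε := (min_le_right _ _).trans (min_le_left _ _)
  have hrz : r < ‖z₀‖ := ((min_le_right _ _).trans (min_le_right _ _)).trans_lt (by linarith)
  have hS : IsCompact (Metric.sphere z₀ r) := isCompact_sphere _ _
  have hne : (Metric.sphere z₀ r).Nonempty := NormedSpace.sphere_nonempty.2 hr0.le
  obtain ⟨z₁, hz₁, hmin⟩ := hS.exists_isMinOn hne (continuous_delaySymbol ω₀).norm.continuousOn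
  set c := ‖delaySymbol ω₀ z₁‖ with hc
  have hc0 : 0 < c := by
    rw [hc, norm_pos_iff]
    refine H (by rw [mem_sphere_iff_norm] at hz₁; rw [dist_eq_norm, hz₁]; exact hrδ) ?_
    rintro rfl
    simp at hz₁
    linarith
  have E1 : ∀ᶠ ω in nhds ω₀, ∀ z ∈ Metric.sphere z₀ r, c / 2 < ‖delaySymbol ω z - delaySymbol ω z₀‖ := by
    refine hS.eventually_forall_of_forall_eventually
      (P := fun ω z => c / 2 < ‖delaySymbol ω z - delaySymbol ω z₀‖) fun z hz => ?_
    have hcont : Continuous fun q : ℝ × ℂ => ‖delaySymbol q.1 q.2 - delaySymbol q.1 z₀‖ := by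
      unfold delaySymbol
      fun_prop
    refine continuousAt_const.eventually_lt hcont.continuousAt ?_
    simp only [h, sub_zero]
    have : c ≤ ‖delaySymbol ω₀ z‖ := hmin hz
    linarith
  have E2 : ∀ᶠ ω in nhds ω₀, ‖delaySymbol ω z₀‖ < c / 4 := by
    have hcont : Continuous fun ω : ℝ => ‖delaySymbol ω z₀‖ := by
      unfold delaySymbol
      fun_prop
    refine hcont.continuousAt.eventually_lt continuousAt_const ?_
    simp only [h, norm_zero]
    positivity
  have E3 : ∀ᶠ ω : ℝ in nhds ω₀, (1 + ω * Complex.exp (-ω * z₀) : ℂ) ≠ 0 := by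
    have hcont : Continuous fun ω : ℝ => (1 + ω * Complex.exp (-ω * z₀) : ℂ) := by fun_prop
    exact hcont.continuousAt.eventually_ne hd
  filter_upwards [E1, E2, E3] with ω e1 e2 e3
  have hdiff : Differentiable ℂ (delaySymbol ω) := fun z => (hasDerivAt_delaySymbol ω z).differentiableAt
  have hfreq : ∃ᶠ z in nhds z₀, delaySymbol ω z ≠ delaySymbol ω z₀ :=
    (((hasDerivAt_delaySymbol ω z₀).eventually_ne e3).frequently).filter_mono nhdsWithin_le_nhds
  -- A quantitative open mapping theorem replaces Rouché's: values on the circle are at distance at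
  -- least `c / 2` from the value at `z₀`, so the image of the disc contains the ball of radius `c /
  -- 4` about that value, and this ball contains `0`.
  have hsub := DiffContOnCl.ball_subset_image_closedBall (hdiff.diffContOnCl (s := Metric.ball z₀ r))
    hr0 (fun z hz => (e1 z hz).le) hfreq
  have h0 : (0 : ℂ) ∈ Metric.ball (delaySymbol ω z₀) (c / 2 / 2) := by
    rw [Metric.mem_ball, dist_zero_left]
    linarith
  obtain ⟨z, hz, hz0⟩ := hsub h0
  rw [mem_closedBall_iff_norm] at hz
  refine ⟨z, ?_, hz0, ?_⟩
  · rintro rfl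
    rw [zero_sub, norm_neg] at hz
    linarith
  · have := (Complex.abs_re_le_norm (z - z₀)).trans hz
    rw [Complex.sub_re, abs_le] at this
    linarith

/-! ### The delay equation as an operator on continuous functions -/

/-- The solution on `[0, 1]` of `ψ' = ω (φ - ψ)`, `ψ 0 = φ 1`. -/
noncomputable def delayFlow (ω : ℝ) (φ : C(Icc (0 : ℝ) 1, ℂ)) (s : ℝ) : ℂ :=
  Real.exp (-(ω * s)) • (φ 1 + ∫ r in (0 : ℝ)..s, (ω * Real.exp (ω * r)) •
    IccExtend zero_le_one φ r)

theorem continuous_IccExtend_coe (φ : C(Icc (0 : ℝ) 1, ℂ)) :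
    Continuous (IccExtend (zero_le_one (α := ℝ)) φ) := φ.continuous.Icc_extend'

theorem norm_IccExtend_le (φ : C(Icc (0 : ℝ) 1, ℂ)) (r : ℝ) :
    ‖IccExtend (zero_le_one (α := ℝ)) φ r‖ ≤ ‖φ‖ := φ.norm_coe_le_norm _

theorem hasDerivAt_delayFlow (ω : ℝ) (φ : C(Icc (0 : ℝ) 1, ℂ)) (s : ℝ) :
    HasDerivAt (delayFlow ω φ) (ω • (IccExtend zero_le_one φ s - delayFlow ω φ s)) s := by
  have hc : Continuous fun r : ℝ => (ω * Real.exp (ω * r)) • IccExtend zero_le_one φ r := by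
    have := continuous_IccExtend_coe φ
    fun_prop
  have h1 := intervalIntegral.integral_hasDerivAt_right (hc.intervalIntegrable 0 s)
    (hc.stronglyMeasurableAtFilter _ _) hc.continuousAt
  have h2 : HasDerivAt (fun s : ℝ => Real.exp (-(ω * s))) (Real.exp (-(ω * s)) * -(ω * 1)) s :=
    (((hasDerivAt_id s).const_mul ω).neg).exp
  refine (h2.smul (h1.const_add (φ 1))).congr_deriv ?_
  rw [delayFlow, smul_smul, smul_sub, smul_smul]
  have : Real.exp (-(ω * s)) * (ω * Real.exp (ω * s)) = ω := by
    rw [mul_left_comm, ← Real.exp_add]; simp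
  rw [this, mul_neg, neg_smul, mul_one, mul_comm (Real.exp (-(ω * s))) ω]
  exact (sub_eq_add_neg _ _).symm

theorem continuous_delayFlow (ω : ℝ) (φ : C(Icc (0 : ℝ) 1, ℂ)) : Continuous (delayFlow ω φ) :=
  continuous_iff_continuousAt.2 fun s => (hasDerivAt_delayFlow ω φ s).continuousAt

theorem delayFlow_zero (ω : ℝ) (φ : C(Icc (0 : ℝ) 1, ℂ)) : delayFlow ω φ 0 = φ 1 := by
  simp [delayFlow]

theorem delayFlow_eq (ω : ℝ) (φ : C(Icc (0 : ℝ) 1, ℂ)) (s : ℝ) :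
    delayFlow ω φ s = Real.exp (-(ω * s)) • φ 1 + ∫ r in (0 : ℝ)..s,
      (ω * Real.exp (-(ω * (s - r)))) • IccExtend zero_le_one φ r := by
  rw [delayFlow, smul_add, ← intervalIntegral.integral_smul]
  congr 1
  refine intervalIntegral.integral_congr fun r _ => ?_
  simp only [smul_smul]
  rw [mul_left_comm, ← Real.exp_add]
  congr 3
  ring

theorem norm_delayFlow_le {ω : ℝ} (hω : 0 ≤ ω) (φ : C(Icc (0 : ℝ) 1, ℂ)) {s : ℝ}
    (hs : s ∈ Icc (0 : ℝ) 1) : ‖delayFlow ω φ s‖ ≤ (1 + ω) * ‖φ‖ := by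
  rw [delayFlow_eq]
  have h1 : ‖Real.exp (-(ω * s)) • φ 1‖ ≤ 1 * ‖φ‖ := by
    rw [norm_smul, Real.norm_eq_abs, abs_of_pos (Real.exp_pos _)]
    gcongr
    · exact Real.exp_le_one_iff.2 (by nlinarith [hs.1])
    · exact φ.norm_coe_le_norm _
  have h2 : ‖∫ r in (0 : ℝ)..s, (ω * Real.exp (-(ω * (s - r)))) • IccExtend zero_le_one φ r‖
      ≤ (ω * ‖φ‖) * |s - 0| := by
    refine intervalIntegral.norm_integral_le_of_norm_le_const fun r hr => ?_
    rw [uIoc_of_le hs.1] at hr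
    rw [norm_smul, Real.norm_eq_abs, abs_of_nonneg (by positivity)]
    gcongr
    · have : Real.exp (-(ω * (s - r))) ≤ 1 := Real.exp_le_one_iff.2 (by nlinarith [hr.2])
      nlinarith
    · exact norm_IccExtend_le φ r
  rw [sub_zero, abs_of_nonneg hs.1] at h2
  have h3 : ω * ‖φ‖ * s ≤ ω * ‖φ‖ * 1 := by
    gcongr
    exact hs.2
  linarith [norm_add_le (Real.exp (-(ω * s)) • φ 1)
    (∫ r in (0 : ℝ)..s, (ω * Real.exp (-(ω * (s - r)))) • IccExtend zero_le_one φ r)]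

theorem abs_exp_neg_sub_exp_neg_le {a b : ℝ} (ha : 0 ≤ a) (hb : 0 ≤ b) :
    |Real.exp (-a) - Real.exp (-b)| ≤ |a - b| := by
  wlog h : a ≤ b generalizing a b
  · rw [abs_sub_comm, abs_sub_comm a]
    exact this hb ha (le_of_not_ge h)
  have h1 : Real.exp (-b) ≤ Real.exp (-a) := Real.exp_le_exp.2 (by linarith)
  rw [abs_of_nonneg (by linarith), abs_sub_comm, abs_of_nonneg (by linarith)]
  have h2 : Real.exp (-b) = Real.exp (-a) * Real.exp (-(b - a)) := by
    rw [← Real.exp_add]; congr 1; ring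
  have h3 := Real.add_one_le_exp (-(b - a))
  have h4 : Real.exp (-a) ≤ 1 := Real.exp_le_one_iff.2 (by linarith)
  have h5 := Real.exp_pos (-a)
  nlinarith

/-- Lipschitz dependence on the delay makes the step operator continuous in `ω` for the operator
norm, which is what later gives locally uniform constants. -/
theorem norm_delayFlow_sub_le {ω ω' : ℝ} (hω : 0 ≤ ω) (hω' : 0 ≤ ω') (φ : C(Icc (0 : ℝ) 1, ℂ))
    {s : ℝ} (hs : s ∈ Icc (0 : ℝ) 1) :
    ‖delayFlow ω φ s - delayFlow ω' φ s‖ ≤ (2 + ω') * |ω - ω'| * ‖φ‖ := by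
  have hc := continuous_IccExtend_coe φ
  have key : ∀ u ∈ Icc (0 : ℝ) 1, |Real.exp (-(ω * u)) - Real.exp (-(ω' * u))| ≤ |ω - ω'| := by
    intro u hu
    refine (abs_exp_neg_sub_exp_neg_le (mul_nonneg hω hu.1) (mul_nonneg hω' hu.1)).trans ?_
    rw [← sub_mul, abs_mul, abs_of_nonneg hu.1]
    exact mul_le_of_le_one_right (abs_nonneg _) hu.2
  rw [delayFlow_eq, delayFlow_eq, add_sub_add_comm, ← sub_smul, ← intervalIntegral.integral_sub]
  rotate_left
  · exact (by fun_prop : Continuous fun r : ℝ => (ω * Real.exp (-(ω * (s - r)))) •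
      IccExtend zero_le_one φ r).intervalIntegrable _ _
  · exact (by fun_prop : Continuous fun r : ℝ => (ω' * Real.exp (-(ω' * (s - r)))) •
      IccExtend zero_le_one φ r).intervalIntegrable _ _
  have h1 : ‖(Real.exp (-(ω * s)) - Real.exp (-(ω' * s))) • φ 1‖ ≤ |ω - ω'| * ‖φ‖ := by
    rw [norm_smul, Real.norm_eq_abs]
    exact mul_le_mul (key s hs) (φ.norm_coe_le_norm _) (norm_nonneg _) (abs_nonneg _)
  have h2 : ‖∫ r in (0 : ℝ)..s, ((ω * Real.exp (-(ω * (s - r)))) • IccExtend zero_le_one φ r -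
      (ω' * Real.exp (-(ω' * (s - r)))) • IccExtend zero_le_one φ r)‖
      ≤ ((1 + ω') * |ω - ω'| * ‖φ‖) * |s - 0| := by
    refine intervalIntegral.norm_integral_le_of_norm_le_const fun r hr => ?_
    rw [uIoc_of_le hs.1] at hr
    rw [← sub_smul, norm_smul, Real.norm_eq_abs]
    gcongr
    · have hk := key (s - r) ⟨by linarith [hr.2], by linarith [hs.2, hr.1]⟩
      have h3 : Real.exp (-(ω * (s - r))) ≤ 1 := Real.exp_le_one_iff.2 (by nlinarith [hr.2])
      calc |ω * Real.exp (-(ω * (s - r))) - ω' * Real.exp (-(ω' * (s - r)))|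
          = |(ω - ω') * Real.exp (-(ω * (s - r))) +
            ω' * (Real.exp (-(ω * (s - r))) - Real.exp (-(ω' * (s - r))))| := by
            congr 1; ring
        _ ≤ |(ω - ω') * Real.exp (-(ω * (s - r)))| +
            |ω' * (Real.exp (-(ω * (s - r))) - Real.exp (-(ω' * (s - r))))| := abs_add_le _ _
        _ ≤ |ω - ω'| * 1 + ω' * |ω - ω'| := by
            rw [abs_mul, abs_mul, abs_of_pos (Real.exp_pos _), abs_of_nonneg hω']
            gcongr
        _ = _ := by ring
    · exact norm_IccExtend_le φ r
  rw [sub_zero, abs_of_nonneg hs.1] at h2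
  have h3 : (1 + ω') * |ω - ω'| * ‖φ‖ * s ≤ (1 + ω') * |ω - ω'| * ‖φ‖ * 1 := by
    gcongr
    exact hs.2
  refine (norm_add_le _ _).trans ?_
  linarith

theorem delayFlow_add (ω : ℝ) (φ ψ : C(Icc (0 : ℝ) 1, ℂ)) (s : ℝ) :
    delayFlow ω (φ + ψ) s = delayFlow ω φ s + delayFlow ω ψ s := by
  have h1 := continuous_IccExtend_coe φ
  have h2 := continuous_IccExtend_coe ψ
  have e : ∀ r : ℝ, IccExtend (zero_le_one (α := ℝ)) (φ + ψ) r
      = IccExtend zero_le_one φ r + IccExtend zero_le_one ψ r := fun r => rfl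
  simp only [delayFlow, e, smul_add]
  rw [intervalIntegral.integral_add]
  · simp only [ContinuousMap.add_apply, smul_add]
    abel
  · exact (by fun_prop : Continuous fun r : ℝ => (ω * Real.exp (ω * r)) •
      IccExtend zero_le_one φ r).intervalIntegrable _ _
  · exact (by fun_prop : Continuous fun r : ℝ => (ω * Real.exp (ω * r)) •
      IccExtend zero_le_one ψ r).intervalIntegrable _ _

theorem delayFlow_smul (ω : ℝ) (c : ℂ) (φ : C(Icc (0 : ℝ) 1, ℂ)) (s : ℝ) :
    delayFlow ω (c • φ) s = c • delayFlow ω φ s := by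
  have e : ∀ r : ℝ, IccExtend (zero_le_one (α := ℝ)) (c • φ) r
      = c • IccExtend zero_le_one φ r := fun r => rfl
  simp only [delayFlow, e]
  rw [smul_comm c, smul_add c, ← intervalIntegral.integral_smul]
  simp only [ContinuousMap.smul_apply, smul_comm c]

/-- The translation of solutions of `y' = ω (y(· - 1) - y)` by one unit of time. -/
noncomputable def delayStep (ω : ℝ) (hω : 0 ≤ ω) :
    C(Icc (0 : ℝ) 1, ℂ) →L[ℂ] C(Icc (0 : ℝ) 1, ℂ) :=
  LinearMap.mkContinuous
    { toFun := fun φ => ⟨fun s => delayFlow ω φ s, (continuous_delayFlow ω φ).comp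
        continuous_subtype_val⟩
      map_add' := fun φ ψ => ContinuousMap.ext fun s => delayFlow_add ω φ ψ s
      map_smul' := fun c φ => ContinuousMap.ext fun s => delayFlow_smul ω c φ s }
    (1 + ω) fun φ => (ContinuousMap.norm_le _ (by positivity)).2 fun s =>
      norm_delayFlow_le hω φ s.2

theorem delayStep_apply (ω : ℝ) (hω : 0 ≤ ω) (φ : C(Icc (0 : ℝ) 1, ℂ)) (s : Icc (0 : ℝ) 1) :
    delayStep ω hω φ s = delayFlow ω φ s := rfl

/-- The conserved quantity `φ 1 + ω ∫ φ` of the delay equation. -/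
noncomputable def delayMass (ω : ℝ) (hω : 0 ≤ ω) : C(Icc (0 : ℝ) 1, ℂ) →L[ℂ] ℂ :=
  LinearMap.mkContinuous
    { toFun := fun φ => φ 1 + ω • ∫ r in (0 : ℝ)..1, IccExtend zero_le_one φ r
      map_add' := fun φ ψ => by
        have e : ∀ r : ℝ, IccExtend (zero_le_one (α := ℝ)) (φ + ψ) r
          = IccExtend zero_le_one φ r + IccExtend zero_le_one ψ r := fun r => rfl
        simp only [e]
        rw [intervalIntegral.integral_add
          ((continuous_IccExtend_coe φ).intervalIntegrable _ _)
          ((continuous_IccExtend_coe ψ).intervalIntegrable _ _)]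
        simp only [ContinuousMap.add_apply, smul_add]
        abel
      map_smul' := fun c φ => by
        have e : ∀ r : ℝ, IccExtend (zero_le_one (α := ℝ)) (c • φ) r
          = c • IccExtend zero_le_one φ r := fun r => rfl
        simp only [e]
        rw [intervalIntegral.integral_smul, RingHom.id_apply, smul_add, smul_comm c ω]
        rfl }
    (1 + ω) fun φ => by
      have h1 : ‖φ 1‖ ≤ ‖φ‖ := φ.norm_coe_le_norm _
      have h2 : ‖∫ r in (0 : ℝ)..1, IccExtend zero_le_one φ r‖ ≤ ‖φ‖ * |1 - 0| :=
        intervalIntegral.norm_integral_le_of_norm_le_const fun r _ => norm_IccExtend_le φ r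
      have h3 : ‖ω • ∫ r in (0 : ℝ)..1, IccExtend zero_le_one φ r‖ ≤ ω * ‖φ‖ := by
        rw [norm_smul, Real.norm_eq_abs, abs_of_nonneg hω]
        gcongr
        simpa using h2
      refine (norm_add_le _ _).trans ?_
      linarith

theorem delayMass_apply (ω : ℝ) (hω : 0 ≤ ω) (φ : C(Icc (0 : ℝ) 1, ℂ)) :
    delayMass ω hω φ = φ 1 + ω • ∫ r in (0 : ℝ)..1, IccExtend zero_le_one φ r := rfl

theorem delayMass_one (ω : ℝ) (hω : 0 ≤ ω) : delayMass ω hω 1 = 1 + ω := by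
  have e : ∀ r : ℝ, IccExtend (zero_le_one (α := ℝ)) (1 : C(Icc (0 : ℝ) 1, ℂ)) r = 1 :=
    fun r => rfl
  have e1 : (1 : C(Icc (0 : ℝ) 1, ℂ)) 1 = 1 := rfl
  rw [delayMass_apply, intervalIntegral.integral_congr (g := fun _ => 1) fun r _ => e r, e1]
  simp

theorem IccExtend_delayStep (ω : ℝ) (hω : 0 ≤ ω) (φ : C(Icc (0 : ℝ) 1, ℂ)) {s : ℝ}
    (hs : s ∈ Icc (0 : ℝ) 1) :
    IccExtend (zero_le_one (α := ℝ)) (delayStep ω hω φ) s = delayFlow ω φ s := by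
  rw [IccExtend_of_mem _ _ hs]
  rfl

/-- Integrating `ψ' = ω (φ - ψ)` over `[0, 1]` with `ψ 0 = φ 1` gives `ψ 1 + ω ∫ ψ = φ 1 + ω ∫ φ`.
-/
theorem delayMass_delayStep (ω : ℝ) (hω : 0 ≤ ω) (φ : C(Icc (0 : ℝ) 1, ℂ)) :
    delayMass ω hω (delayStep ω hω φ) = delayMass ω hω φ := by
  have h1 := continuous_IccExtend_coe φ
  have h2 := continuous_delayFlow ω φ
  have h := intervalIntegral.integral_eq_sub_of_hasDerivAt
    (fun s _ => hasDerivAt_delayFlow ω φ s)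
    ((by fun_prop : Continuous fun s => ω • (IccExtend (zero_le_one (α := ℝ)) φ s
      - delayFlow ω φ s)).intervalIntegrable 0 1)
  rw [intervalIntegral.integral_smul, intervalIntegral.integral_sub (h1.intervalIntegrable _ _)
    (h2.intervalIntegrable _ _), delayFlow_zero, smul_sub] at h
  have e : ∫ r in (0 : ℝ)..1, IccExtend zero_le_one (delayStep ω hω φ) r
      = ∫ r in (0 : ℝ)..1, delayFlow ω φ r := by
    refine intervalIntegral.integral_congr fun r hr => ?_
    rw [uIcc_of_le zero_le_one] at hr
    exact IccExtend_delayStep ω hω φ hr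
  have e1 : delayStep ω hω φ 1 = delayFlow ω φ 1 := rfl
  rw [delayMass_apply, delayMass_apply, e, e1]
  linear_combination -h

/-! ### The spectrum off the constants -/

/-- The delay step minus the spectral projection onto the constants. -/
noncomputable def reducedStep (ω : ℝ) (hω : 0 ≤ ω) :
    C(Icc (0 : ℝ) 1, ℂ) →L[ℂ] C(Icc (0 : ℝ) 1, ℂ) :=
  delayStep ω hω - (1 + ω : ℂ)⁻¹ • (delayMass ω hω).smulRight (1 : C(Icc (0 : ℝ) 1, ℂ))

theorem reducedStep_apply (ω : ℝ) (hω : 0 ≤ ω) (φ : C(Icc (0 : ℝ) 1, ℂ)) :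
    reducedStep ω hω φ = delayStep ω hω φ - ((1 + ω : ℂ)⁻¹ * delayMass ω hω φ) • 1 := by
  simp [reducedStep, smul_smul]

theorem eq_exp_mul_of_hasDerivAt {a : ℂ} {u : ℝ → ℂ}
    (h : ∀ s ∈ Icc (0 : ℝ) 1, HasDerivAt u (a * u s) s) :
    ∀ s ∈ Icc (0 : ℝ) 1, u s = Complex.exp (a * s) * u 0 := by
  have hd : ∀ s ∈ Icc (0 : ℝ) 1, HasDerivAt (fun s : ℝ => Complex.exp (-a * s) * u s) 0 s := by
    intro s hs
    have h1 : HasDerivAt (fun s : ℝ => -a * (s : ℂ)) (-a) s := by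
      simpa using (Complex.ofRealCLM.hasDerivAt (x := s)).const_mul (-a)
    refine (h1.cexp.mul (h s hs)).congr_deriv ?_
    ring
  intro s hs
  have := constant_of_has_deriv_right_zero
    (fun s hs => (hd s hs).continuousAt.continuousWithinAt)
    (fun s hs => (hd s (Ico_subset_Icc_self hs)).hasDerivWithinAt) s hs
  simp only [Complex.ofReal_zero, mul_zero, Complex.exp_zero, one_mul] at this
  rw [← this, ← mul_assoc, ← Complex.exp_add]
  simp

theorem delayFlow_eqOn_of_hasDerivAt {ω : ℝ} {φ : C(Icc (0 : ℝ) 1, ℂ)} {ψ : ℝ → ℂ}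
    (h : ∀ s ∈ Icc (0 : ℝ) 1, HasDerivAt ψ (ω • (IccExtend zero_le_one φ s - ψ s)) s)
    (h0 : ψ 0 = φ 1) : ∀ s ∈ Icc (0 : ℝ) 1, delayFlow ω φ s = ψ s := by
  intro s hs
  have := eq_exp_mul_of_hasDerivAt (a := -ω) (u := fun s => delayFlow ω φ s - ψ s)
    (fun s hs => ((hasDerivAt_delayFlow ω φ s).sub (h s hs)).congr_deriv (by
      simp only [Complex.real_smul]; ring)) s hs
  simp only [delayFlow_zero, h0, sub_self, mul_zero] at this
  exact sub_eq_zero.1 this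

/-- In the resolvent equation substitute `φ = μ⁻¹ (φ₁ + ψ)` with `ψ` the image of `φ` under the
step. It becomes the linear equation `ψ' = κ ψ + (ω / μ) φ₁`, solved by variation of constants with
`ψ 0 = c`. The hypothesis on `c` is the matching condition `ψ 0 = φ 1`. -/
theorem exists_smul_sub_delayStep_eq {ω : ℝ} (hω : 0 ≤ ω) {μ κ c : ℂ} (hμ : μ ≠ 0)
    (hκ : κ = ω * (1 / μ - 1)) (φ₁ : C(Icc (0 : ℝ) 1, ℂ))
    (hc : c * μ = φ₁ 1 + Complex.exp κ * (c + ∫ r in (0 : ℝ)..1,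
      (ω / μ * Complex.exp (-κ * r)) * IccExtend zero_le_one φ₁ r)) :
    ∃ φ, μ • φ - delayStep ω hω φ = φ₁ := by
  set ψ : ℝ → ℂ := fun s => Complex.exp (κ * s) * (c + ∫ r in (0 : ℝ)..s,
      (ω / μ * Complex.exp (-κ * r)) * IccExtend zero_le_one φ₁ r) with hψ
  have hcont : Continuous fun r : ℝ => (ω / μ * Complex.exp (-κ * r)) *
      IccExtend zero_le_one φ₁ r := by
    have := continuous_IccExtend_coe φ₁
    fun_prop
  have hψd : ∀ s, HasDerivAt ψ (κ * ψ s + ω / μ * IccExtend zero_le_one φ₁ s) s := by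
    intro s
    have h1 := intervalIntegral.integral_hasDerivAt_right (hcont.intervalIntegrable 0 s)
      (hcont.stronglyMeasurableAtFilter _ _) hcont.continuousAt
    have h2 : HasDerivAt (fun s : ℝ => κ * (s : ℂ)) κ s := by
      simpa using (Complex.ofRealCLM.hasDerivAt (x := s)).const_mul κ
    refine (h2.cexp.mul (h1.const_add c)).congr_deriv ?_
    have e : Complex.exp (κ * s) * Complex.exp (-κ * s) = 1 := by
      rw [← Complex.exp_add]; simp
    simp only [hψ]
    linear_combination (ω / μ * IccExtend zero_le_one φ₁ s) * e
  have hψc : Continuous ψ := continuous_iff_continuousAt.2 fun s => (hψd s).continuousAt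
  set φ : C(Icc (0 : ℝ) 1, ℂ) := μ⁻¹ • (φ₁ + ⟨fun s => ψ s, hψc.comp continuous_subtype_val⟩)
    with hφ
  have hφv : ∀ s : Icc (0 : ℝ) 1, φ s = μ⁻¹ * (φ₁ s + ψ s) := fun s => rfl
  have hψ0 : ψ 0 = φ 1 := by
    rw [hφv, eq_inv_mul_iff_mul_eq₀ hμ]
    simp only [hψ, Icc.coe_one]
    simp only [Complex.ofReal_zero, mul_zero, Complex.exp_zero, one_mul,
      intervalIntegral.integral_same, add_zero, Complex.ofReal_one, mul_one]
    linear_combination hc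
  have hflow := delayFlow_eqOn_of_hasDerivAt (ω := ω) (φ := φ) (ψ := ψ) (fun s hs => by
    refine (hψd s).congr_deriv ?_
    rw [IccExtend_of_mem _ _ hs, IccExtend_of_mem _ _ hs, hφv, Complex.real_smul, hκ]
    field_simp
    ring) hψ0
  refine ⟨φ, ContinuousMap.ext fun s => ?_⟩
  rw [ContinuousMap.sub_apply, delayStep_apply, hflow s s.2, ContinuousMap.smul_apply, hφv,
    smul_eq_mul, mul_inv_cancel_left₀ hμ, add_sub_cancel_right]

theorem delayStep_one (ω : ℝ) (hω : 0 ≤ ω) : delayStep ω hω 1 = 1 := by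
  refine ContinuousMap.ext fun s => ?_
  rw [delayStep_apply, delayFlow_eqOn_of_hasDerivAt (ψ := fun _ => 1) (fun s hs => ?_) rfl s s.2]
  · rfl
  · have e : IccExtend (zero_le_one (α := ℝ)) (1 : C(Icc (0 : ℝ) 1, ℂ)) s = 1 := rfl
    rw [e, sub_self, smul_zero]
    exact hasDerivAt_const _ _

theorem one_add_ofReal_ne_zero {ω : ℝ} (hω : 0 ≤ ω) : (1 + ω : ℂ) ≠ 0 := by
  exact_mod_cast (by positivity : (1 + ω : ℝ) ≠ 0)

/-- The mass of a kernel element vanishes, so the element is an eigenvector of the full step and its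
image is a multiple of an exponential. Matching at the endpoint forces `μ = exp (ω (1 / μ - 1))`,
hence `μ = 1`, unless `φ` is zero. For `μ = 1` it is constant, and a constant of zero mass is zero.
-/
theorem injective_sub_reducedStep {ω : ℝ} (hω : 0 ≤ ω) {μ : ℂ} (hμ : μ ≠ 0)
    (h : Complex.exp (ω * (1 / μ - 1)) = μ → μ = 1) :
    Function.Injective (algebraMap ℂ (C(Icc (0 : ℝ) 1, ℂ) →L[ℂ] C(Icc (0 : ℝ) 1, ℂ)) μ
      - reducedStep ω hω) := by
  rw [injective_iff_map_eq_zero]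
  intro φ hφ
  have hω1 := one_add_ofReal_ne_zero hω
  rw [sub_apply, ContinuousLinearMap.algebraMap_apply, reducedStep_apply]
    at hφ
  have hQ : delayMass ω hω φ = 0 := by
    have := congrArg (delayMass ω hω) hφ
    rw [map_sub, map_sub, map_smul, map_smul, delayMass_delayStep, delayMass_one, map_zero,
      smul_eq_mul, smul_eq_mul] at this
    field_simp at this
    have h2 : μ * delayMass ω hω φ = 0 := by linear_combination this
    exact (mul_eq_zero.1 h2).resolve_left hμ
  have h0 : (0 : ℂ) • (1 : C(Icc (0 : ℝ) 1, ℂ)) = 0 := zero_smul ℂ (1 : C(Icc (0 : ℝ) 1, ℂ))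
  rw [hQ, mul_zero, h0, sub_zero, sub_eq_zero] at hφ
  have hv : ∀ s : Icc (0 : ℝ) 1, μ * φ s = delayFlow ω φ s := fun s => by
    have := congrArg (fun f : C(Icc (0 : ℝ) 1, ℂ) => f s) hφ
    exact this
  have hE := eq_exp_mul_of_hasDerivAt (a := ω * (1 / μ - 1)) (u := delayFlow ω φ) fun s hs => by
    refine (hasDerivAt_delayFlow ω φ s).congr_deriv ?_
    have e := hv ⟨s, hs⟩
    rw [IccExtend_of_mem _ _ hs, Complex.real_smul, ← e]
    field_simp
  rw [delayFlow_zero] at hE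
  have h1 : μ * φ 1 = Complex.exp (ω * (1 / μ - 1)) * φ 1 := by
    have := hE 1 ⟨zero_le_one, le_rfl⟩
    rw [Complex.ofReal_one, mul_one] at this
    rw [← this]
    exact hv 1
  have hφ1 : φ 1 = 0 := by
    by_contra hne
    have hμ1 := h (mul_right_cancel₀ hne h1).symm
    subst hμ1
    have hconst : φ = φ 1 • (1 : C(Icc (0 : ℝ) 1, ℂ)) := by
      refine ContinuousMap.ext fun s => ?_
      have := hv s
      rw [hE s s.2, one_mul] at this
      simpa using this
    rw [hconst, map_smul, delayMass_one, smul_eq_mul] at hQ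
    exact (mul_ne_zero hne hω1) hQ
  refine ContinuousMap.ext fun s => ?_
  have := hv s
  rw [hE s s.2, hφ1, mul_zero] at this
  exact (mul_eq_zero.1 this).resolve_left hμ

theorem surjective_sub_reducedStep {ω : ℝ} (hω : 0 ≤ ω) {μ : ℂ} (hμ : μ ≠ 0)
    (h : Complex.exp (ω * (1 / μ - 1)) = μ → μ = 1) :
    Function.Surjective (algebraMap ℂ (C(Icc (0 : ℝ) 1, ℂ) →L[ℂ] C(Icc (0 : ℝ) 1, ℂ)) μ
      - reducedStep ω hω) := by
  intro φ₀
  have hω1 := one_add_ofReal_ne_zero hω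
  -- Applying the mass functional to the equation forces the mass of `φ` to be that of `φ₀` divided
  -- by `μ`. The rank-one term is thus known and can be moved to the right-hand side.
  set q : ℂ := delayMass ω hω φ₀ / (μ * (1 + ω)) with hq
  suffices hs : ∃ φ, μ • φ - delayStep ω hω φ = φ₀ - q • (1 : C(Icc (0 : ℝ) 1, ℂ)) ∧
      delayMass ω hω φ = delayMass ω hω φ₀ / μ by
    obtain ⟨φ, h1, h2⟩ := hs
    refine ⟨φ, ?_⟩
    rw [sub_apply, ContinuousLinearMap.algebraMap_apply, reducedStep_apply,
      ← sub_add, h1, h2]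
    have : (1 + ω : ℂ)⁻¹ * (delayMass ω hω φ₀ / μ) = q := by rw [hq]; field_simp
    rw [this, sub_add_cancel]
  have hQ₁ : delayMass ω hω (φ₀ - q • (1 : C(Icc (0 : ℝ) 1, ℂ)))
      = delayMass ω hω φ₀ * (1 - 1 / μ) := by
    rw [map_sub, map_smul, delayMass_one, smul_eq_mul, hq]
    field_simp
  set φ₁ := φ₀ - q • (1 : C(Icc (0 : ℝ) 1, ℂ)) with hφ₁
  by_cases hμ1 : μ = 1
  · subst hμ1
    have hQ₀ : delayMass ω hω φ₁ = 0 := by rw [hQ₁]; simp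
    -- For `μ = 1` the matching condition does not involve `c`; it says that the right-hand side has
    -- zero mass. The solution is free up to a constant, which is then used to correct the mass.
    obtain ⟨φ, hφ⟩ := exists_smul_sub_delayStep_eq hω (c := 0) hμ (κ := 0) (by simp) φ₁ (by
      rw [delayMass_apply, Complex.real_smul] at hQ₀
      simp only [neg_zero, zero_mul, Complex.exp_zero, div_one, mul_one,
        intervalIntegral.integral_const_mul, one_mul, zero_add]
      exact hQ₀.symm)
    refine ⟨φ + ((delayMass ω hω φ₀ - delayMass ω hω φ) / (1 + ω)) • 1, ?_, ?_⟩
    · rw [map_add, map_smul, delayStep_one, ← hφ]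
      simp
    · rw [map_add, map_smul, delayMass_one, smul_eq_mul]
      field_simp
      ring
  -- For `μ ≠ 1` the matching condition determines `c`, and the mass of the solution is
  -- automatically the required one.
  · have hne : μ - Complex.exp (ω * (1 / μ - 1)) ≠ 0 := fun h0 =>
      hμ1 (h (sub_eq_zero.1 h0).symm)
    set κ : ℂ := ω * (1 / μ - 1) with hκ
    set I : ℂ := ∫ r in (0 : ℝ)..1, (ω / μ * Complex.exp (-κ * r)) * IccExtend zero_le_one φ₁ r
      with hI
    obtain ⟨φ, hφ⟩ := exists_smul_sub_delayStep_eq hω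
      (c := (φ₁ 1 + Complex.exp κ * I) / (μ - Complex.exp κ)) hμ hκ φ₁ (by
        rw [← hI]
        field_simp
        ring)
    refine ⟨φ, hφ, ?_⟩
    have := congrArg (delayMass ω hω) hφ
    rw [map_sub, map_smul, delayMass_delayStep, hQ₁, smul_eq_mul] at this
    have hμ1' : μ - 1 ≠ 0 := sub_ne_zero.2 hμ1
    rw [eq_div_iff hμ]
    refine mul_left_cancel₀ hμ1' ?_
    have e : delayMass ω hω φ₀ * (1 - 1 / μ) * μ = delayMass ω hω φ₀ * (μ - 1) := by
      field_simp
    linear_combination μ * this + e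

/-- If `exp (ω (1 / μ - 1)) = μ` and `μ ≠ 1`, then `z = 1 / μ - 1` is a nonzero root and `|μ| = exp
(ω Re z)`. For every other nonzero `μ` the resolvent is a continuous bijection, hence invertible. -/
theorem norm_lt_of_mem_spectrum_reducedStep {ω β : ℝ} (hω : 0 < ω)
    (hroot : ∀ z : ℂ, z ≠ 0 → delaySymbol ω z = 0 → z.re < -β) {μ : ℂ}
    (hμ : μ ∈ spectrum ℂ (reducedStep ω hω.le)) : ‖μ‖ < Real.exp (-β * ω) := by
  by_contra! hle
  have hμ0 : μ ≠ 0 := by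
    rintro rfl
    rw [norm_zero] at hle
    exact absurd hle (not_le.2 (Real.exp_pos _))
  refine hμ (ContinuousLinearMap.isUnit_iff_bijective.2 ?_)
  have h : Complex.exp (ω * (1 / μ - 1)) = μ → μ = 1 := by
    intro he
    by_contra hμ1
    have h1 : (1 / μ - 1 : ℂ) ≠ 0 := by
      intro h0
      field_simp at h0
      rw [mul_zero] at h0
      exact hμ1 (sub_eq_zero.1 h0).symm
    have h2 : delaySymbol ω (1 / μ - 1) = 0 := by
      rw [delaySymbol, neg_mul, Complex.exp_neg, he]
      simp
    have h3 := hroot _ h1 h2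
    have h4 : ‖μ‖ = Real.exp (ω * (1 / μ - 1 : ℂ).re) := by
      conv_lhs => rw [← he]
      rw [Complex.norm_exp, Complex.re_ofReal_mul]
    rw [h4, Real.exp_le_exp] at hle
    nlinarith
  exact ⟨injective_sub_reducedStep hω.le hμ0 h, surjective_sub_reducedStep hω.le hμ0 h⟩

theorem exists_norm_reducedStep_pow_lt {ω β ρ : ℝ} (hω : 0 < ω)
    (hroot : ∀ z : ℂ, z ≠ 0 → delaySymbol ω z = 0 → z.re < -β) (hρ : Real.exp (-β * ω) < ρ) :
    ∃ n : ℕ, 0 < n ∧ ‖reducedStep ω hω.le ^ n‖ < ρ ^ n := by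
  have hρ0 : 0 < ρ := (Real.exp_pos _).trans hρ
  have h1 : spectralRadius ℂ (reducedStep ω hω.le) < ENNReal.ofReal ρ := by
    refine lt_of_le_of_lt ?_ ((ENNReal.ofReal_lt_ofReal_iff hρ0).2 hρ)
    refine iSup₂_le fun μ hμ => ?_
    rw [← enorm_eq_nnnorm, ← ofReal_norm μ]
    exact ENNReal.ofReal_le_ofReal (norm_lt_of_mem_spectrum_reducedStep hω hroot hμ).le
  have h2 := spectrum.pow_nnnorm_pow_one_div_tendsto_nhds_spectralRadius (reducedStep ω hω.le)
  obtain ⟨n, hn, hn0⟩ := ((h2.eventually_lt_const h1).and (eventually_gt_atTop 0)).exists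
  refine ⟨n, hn0, ?_⟩
  have hn' : (0 : ℝ) < n := by exact_mod_cast hn0
  have h3 := (ENNReal.rpow_lt_rpow_iff hn').2 hn
  rw [← ENNReal.rpow_mul, one_div, inv_mul_cancel₀ hn'.ne', ENNReal.rpow_one,
    ENNReal.rpow_natCast, ← ENNReal.ofReal_pow hρ0.le] at h3
  rw [← enorm_eq_nnnorm, ← ofReal_norm] at h3
  exact (ENNReal.ofReal_lt_ofReal_iff (by positivity)).1 h3

/-! ### Power bounds locally uniform in the delay -/

theorem norm_delayStep_sub_le {ω ω' : ℝ} (hω : 0 ≤ ω) (hω' : 0 ≤ ω') :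
    ‖delayStep ω hω - delayStep ω' hω'‖ ≤ (2 + ω') * |ω - ω'| :=
  ContinuousLinearMap.opNorm_le_bound _ (by positivity) fun φ =>
    (ContinuousMap.norm_le _ (by positivity)).2 fun s => norm_delayFlow_sub_le hω hω' φ s.2

theorem norm_delayMass_sub_le {ω ω' : ℝ} (hω : 0 ≤ ω) (hω' : 0 ≤ ω') :
    ‖delayMass ω hω - delayMass ω' hω'‖ ≤ |ω - ω'| := by
  refine ContinuousLinearMap.opNorm_le_bound _ (by positivity) fun φ => ?_
  rw [sub_apply, delayMass_apply, delayMass_apply, add_sub_add_left_eq_sub,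
    ← sub_smul, norm_smul, Real.norm_eq_abs]
  gcongr
  simpa using intervalIntegral.norm_integral_le_of_norm_le_const (a := (0 : ℝ)) (b := 1)
    fun r _ => norm_IccExtend_le φ r

theorem continuous_of_norm_sub_le {E : Type*} [SeminormedAddCommGroup E] {S : Ici (0 : ℝ) → E}
    (h : ∀ ω ω' : Ici (0 : ℝ), ‖S ω - S ω'‖ ≤ (2 + ω') * |(ω : ℝ) - ω'|) : Continuous S := by
  rw [continuous_iff_continuousAt]
  intro ω'
  refine tendsto_iff_norm_sub_tendsto_zero.2 ?_
  refine squeeze_zero (fun _ => norm_nonneg _) (fun ω => h ω ω') ?_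
  have : Continuous fun ω : Ici (0 : ℝ) => (2 + (ω' : ℝ)) * |(ω : ℝ) - ω'| := by fun_prop
  simpa using this.tendsto ω'

theorem continuous_sub_smul_smulRight {X E : Type*} [TopologicalSpace X] [NormedAddCommGroup E]
    [NormedSpace ℂ E] {S : X → E →L[ℂ] E} {c : X → ℂ} {Q : X → E →L[ℂ] ℂ} (e : E)
    (hS : Continuous S) (hc : Continuous c) (hQ : Continuous Q) :
    Continuous fun x => S x - c x • (Q x).smulRight e :=
  hS.sub (hc.smul (((ContinuousLinearMap.smulRightL ℂ E E).flip e).continuous.comp hQ))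

theorem continuous_reducedStep :
    Continuous fun ω : Ici (0 : ℝ) => reducedStep ω ω.2 := by
  refine continuous_sub_smul_smulRight 1 (continuous_of_norm_sub_le fun ω ω' =>
    norm_delayStep_sub_le ω.2 ω'.2) (Continuous.inv₀ (by fun_prop) fun ω =>
    one_add_ofReal_ne_zero ω.2) (continuous_of_norm_sub_le fun ω ω' =>
    (norm_delayMass_sub_le ω.2 ω'.2).trans ?_)
  have : (0 : ℝ) ≤ ω' := ω'.2
  nlinarith [abs_nonneg ((ω : ℝ) - ω')]

/-- Division of `j` by `n` with remainder. The bound for all powers uses only two strict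
inequalities on one power and on the norm, which survive a small change of the operator. -/
theorem norm_pow_le_of_norm_pow_le {E : Type*} [NormedAddCommGroup E] [NormedSpace ℂ E]
    {D : E →L[ℂ] E} {n : ℕ} (hn : 0 < n) {ρ M : ℝ} (hρ : 0 < ρ) (hD : ‖D ^ n‖ ≤ ρ ^ n)
    (hM : ‖D‖ ≤ M) (j : ℕ) : ‖D ^ j‖ ≤ (1 + M / ρ) ^ n * ρ ^ j := by
  have hM0 : 0 ≤ M := (norm_nonneg _).trans hM
  have hp : ∀ (S : E →L[ℂ] E) (k : ℕ), ‖S ^ k‖ ≤ ‖S‖ ^ k := by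
    intro S k
    induction k with
    | zero => simpa [ContinuousLinearMap.one_def] using ContinuousLinearMap.norm_id_le (E := E)
    | succ k ih =>
      rw [pow_succ, pow_succ]
      exact (ContinuousLinearMap.opNorm_comp_le _ _).trans (by gcongr)
  have hq : ‖(D ^ n) ^ (j / n)‖ ≤ ρ ^ (n * (j / n)) := by
    rw [pow_mul]
    exact (hp _ _).trans (by gcongr)
  have hr : ‖D ^ (j % n)‖ ≤ (1 + M / ρ) ^ n * ρ ^ (j % n) := by
    calc ‖D ^ (j % n)‖ ≤ ‖D‖ ^ (j % n) := hp _ _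
      _ ≤ M ^ (j % n) := by gcongr
      _ = (M / ρ) ^ (j % n) * ρ ^ (j % n) := by rw [← mul_pow, div_mul_cancel₀ _ hρ.ne']
      _ ≤ (1 + M / ρ) ^ (j % n) * ρ ^ (j % n) := by
        gcongr
        linarith
      _ ≤ (1 + M / ρ) ^ n * ρ ^ (j % n) := by
        gcongr
        · have : 0 ≤ M / ρ := by positivity
          linarith
        · exact (Nat.mod_lt j hn).le
  calc ‖D ^ j‖ = ‖(D ^ n) ^ (j / n) * D ^ (j % n)‖ := by
        rw [← pow_mul, ← pow_add, Nat.div_add_mod]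
    _ ≤ ‖(D ^ n) ^ (j / n)‖ * ‖D ^ (j % n)‖ := ContinuousLinearMap.opNorm_comp_le _ _
    _ ≤ ρ ^ (n * (j / n)) * ((1 + M / ρ) ^ n * ρ ^ (j % n)) := by gcongr
    _ = (1 + M / ρ) ^ n * (ρ ^ (n * (j / n)) * ρ ^ (j % n)) := by ring
    _ = _ := by rw [← pow_add, Nat.div_add_mod]

/-- Discrete Duhamel principle: errors of size `τ ^ n` with `τ > ρ` sum to a geometric series,
whence the factor `1 / (τ - ρ)`. -/
theorem norm_le_of_affine_recurrence {E : Type*} [NormedAddCommGroup E] [NormedSpace ℂ E]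
    {D : E →L[ℂ] E} {z e : ℕ → E} {K ρ τ A : ℝ} (hK : 0 ≤ K) (hρ : 0 < ρ) (hτ : ρ < τ) (hA : 0 ≤ A)
    (hD : ∀ j : ℕ, ‖D ^ j‖ ≤ K * ρ ^ j) (hz : ∀ n, z (n + 1) = D (z n) + e n)
    (he : ∀ n, ‖e n‖ ≤ A * τ ^ n) (n : ℕ) :
    ‖z n‖ ≤ K * τ ^ n * (‖z 0‖ + A / (τ - ρ)) := by
  have hpos : 0 < τ - ρ := by linarith
  have hτ0 : 0 < τ := by linarith
  -- All `D ^ j (z n)` are estimated at once, since the norm of `D` itself may exceed `ρ` and only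
  -- its powers are controlled.
  have key : ∀ n j : ℕ, ‖(D ^ j) (z n)‖ ≤ K * ρ ^ j * τ ^ n * (‖z 0‖ + A / (τ - ρ)) := by
    intro n
    induction n with
    | zero =>
      intro j
      calc ‖(D ^ j) (z 0)‖ ≤ ‖D ^ j‖ * ‖z 0‖ := ContinuousLinearMap.le_opNorm _ _
        _ ≤ K * ρ ^ j * ‖z 0‖ := by gcongr; exact hD j
        _ ≤ K * ρ ^ j * τ ^ 0 * (‖z 0‖ + A / (τ - ρ)) := by
          rw [pow_zero, mul_one]
          gcongr
          have : 0 ≤ A / (τ - ρ) := by positivity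
          linarith
    | succ n ih =>
      intro j
      have h1 : (D ^ j) (z (n + 1)) = (D ^ (j + 1)) (z n) + (D ^ j) (e n) := by
        rw [hz, map_add, pow_succ]
        rfl
      have h2 := ih (j + 1)
      have h3 : ‖(D ^ j) (e n)‖ ≤ K * ρ ^ j * (A * τ ^ n) := by
        refine (ContinuousLinearMap.le_opNorm _ _).trans ?_
        gcongr
        · exact hD j
        · exact he n
      rw [h1]
      refine (norm_add_le _ _).trans ((add_le_add h2 h3).trans ?_)
      have e1 : A = (A / (τ - ρ)) * (τ - ρ) := by field_simp
      have h4 : ρ * ‖z 0‖ ≤ τ * ‖z 0‖ := by gcongr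
      calc K * ρ ^ (j + 1) * τ ^ n * (‖z 0‖ + A / (τ - ρ)) + K * ρ ^ j * (A * τ ^ n)
          = K * ρ ^ j * τ ^ n * (ρ * ‖z 0‖ + ρ * (A / (τ - ρ)) + A) := by ring
        _ ≤ K * ρ ^ j * τ ^ n * (τ * ‖z 0‖ + τ * (A / (τ - ρ))) := by
          gcongr K * ρ ^ j * τ ^ n * ?_
          linarith
        _ = _ := by ring
  simpa using key n 0

theorem continuous_norm_clm_pow {X E : Type*} [TopologicalSpace X] [NormedAddCommGroup E]
    [NormedSpace ℂ E] {S : X → E →L[ℂ] E} (hS : Continuous S) (n : ℕ) :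
    Continuous fun x => ‖S x ^ n‖ := (hS.pow n).norm

theorem continuous_norm_clm {X E : Type*} [TopologicalSpace X] [NormedAddCommGroup E]
    [NormedSpace ℂ E] {S : X → E →L[ℂ] E} (hS : Continuous S) :
    Continuous fun x => ‖S x‖ := hS.norm

theorem eventually_delay_recurrence_bound {ω₀ β b : ℝ} (hω₀ : 0 < ω₀)
    (hroot : ∀ z : ℂ, z ≠ 0 → delaySymbol ω₀ z = 0 → z.re < -β) (hb : b < β) :
    ∃ K > 0, ∀ᶠ ω in nhds ω₀, ∀ (hω : 0 ≤ ω) (z e : ℕ → C(Icc (0 : ℝ) 1, ℂ)) (A : ℝ), 0 ≤ A →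
      (∀ n, z (n + 1) = reducedStep ω hω (z n) + e n) →
      (∀ n, ‖e n‖ ≤ A * Real.exp (-b * ω) ^ n) →
      ∀ n, ‖z n‖ ≤ K * Real.exp (-b * ω) ^ n * (‖z 0‖ + A) := by
  -- A value strictly between `exp (-β ω₀)`, which bounds the spectrum, and the target `exp (-b
  -- ω₀)`. Half of the remaining gap, `c`, is kept for `ω` near `ω₀`.
  set ρ := Real.exp (-((b + β) / 2) * ω₀) with hρ
  have hρ0 : 0 < ρ := Real.exp_pos _
  obtain ⟨n, hn, hlt⟩ := exists_norm_reducedStep_pow_lt hω₀ hroot (ρ := ρ)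
    (Real.exp_lt_exp.2 (by nlinarith))
  have hgap : ρ < Real.exp (-b * ω₀) := Real.exp_lt_exp.2 (by nlinarith)
  set c := (Real.exp (-b * ω₀) - ρ) / 2 with hc
  have hc0 : 0 < c := by rw [hc]; linarith
  set M := ‖reducedStep ω₀ hω₀.le‖ + 1 with hM
  have hM0 : 0 < M := by positivity
  have E1 : ∀ᶠ ω : Ici (0 : ℝ) in nhds ⟨ω₀, hω₀.le⟩, ‖reducedStep ω ω.2 ^ n‖ < ρ ^ n :=
    (continuous_norm_clm_pow continuous_reducedStep n).continuousAt.eventually_lt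
      continuousAt_const hlt
  have E2 : ∀ᶠ ω : Ici (0 : ℝ) in nhds ⟨ω₀, hω₀.le⟩, ‖reducedStep ω ω.2‖ < M :=
    (continuous_norm_clm continuous_reducedStep).continuousAt.eventually_lt continuousAt_const
      (lt_add_one _)
  have E3 : ∀ᶠ ω : ℝ in nhds ω₀, ρ + c < Real.exp (-b * ω) :=
    continuousAt_const.eventually_lt (by fun_prop) (by rw [hc]; linarith)
  have E12 := E1.and E2
  rw [nhds_induced, eventually_comap] at E12
  set K₀ := (1 + M / ρ) ^ n with hK₀
  have hK₀0 : 0 < K₀ := by positivity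
  refine ⟨K₀ * (1 + 1 / c), by positivity, ?_⟩
  filter_upwards [E12, E3] with ω e12 e3 hω z e A hA hz he m
  obtain ⟨h1, h2⟩ := e12 ⟨ω, hω⟩ rfl
  have h := norm_le_of_affine_recurrence (D := reducedStep ω hω) hK₀0.le hρ0 (by linarith) hA
    (norm_pow_le_of_norm_pow_le hn hρ0 h1.le h2.le) hz he m
  refine h.trans ?_
  have h3 : A / (Real.exp (-b * ω) - ρ) ≤ A / c := by
    gcongr
    linarith
  have h4 : ‖z 0‖ + A / (Real.exp (-b * ω) - ρ) ≤ (1 + 1 / c) * (‖z 0‖ + A) := by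
    have : (1 + 1 / c) * (‖z 0‖ + A) = ‖z 0‖ + A / c + (‖z 0‖ / c + A) := by ring
    have : 0 ≤ ‖z 0‖ / c + A := by positivity
    linarith
  calc K₀ * Real.exp (-b * ω) ^ m * (‖z 0‖ + A / (Real.exp (-b * ω) - ρ))
      ≤ K₀ * Real.exp (-b * ω) ^ m * ((1 + 1 / c) * (‖z 0‖ + A)) := by gcongr
    _ = _ := by ring

/-! ### The renewal system -/

/-- The convolution `∫₀ᵗ exp (-(t - s)) f s ds`. -/
noncomputable def expConv (f : ℝ → ℝ) (t : ℝ) : ℝ :=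
  ∫ s in (0 : ℝ)..t, Real.exp (-(t - s)) * f s

theorem hasDerivAt_expConv {f : ℝ → ℝ} (hf : Continuous f) (t : ℝ) :
    HasDerivAt (expConv f) (f t - expConv f t) t := by
  have e : expConv f = fun t => Real.exp (-t) * ∫ s in (0 : ℝ)..t, Real.exp s * f s := by
    funext t
    rw [expConv, ← intervalIntegral.integral_const_mul]
    congr 1
    funext s
    rw [← mul_assoc, ← Real.exp_add]
    congr 2
    ring
  have hc : Continuous fun s => Real.exp s * f s := by fun_prop
  have h1 := intervalIntegral.integral_hasDerivAt_right (hc.intervalIntegrable 0 t)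
    (hc.stronglyMeasurableAtFilter _ _) hc.continuousAt
  have h2 : HasDerivAt (fun s : ℝ => Real.exp (-s)) (Real.exp (-t) * -1) t :=
    (hasDerivAt_id t).neg.exp
  rw [e]
  refine (h2.mul h1).congr_deriv ?_
  have : Real.exp (-t) * Real.exp t = 1 := by rw [← Real.exp_add]; simp
  linear_combination (f t) * this

theorem continuous_expConv {f : ℝ → ℝ} (hf : Continuous f) : Continuous (expConv f) :=
  continuous_iff_continuousAt.2 fun t => (hasDerivAt_expConv hf t).continuousAt

/-- The renewal equation with delay `ω` and the conservation of mass, up to remainders of size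
`exp (2 ω - t)`. -/
structure RenewalSystem (ω : ℝ) (f : ℝ → ℝ) : Prop where
  continuous : Continuous f
  renewal : ∀ t ≥ 0, |f t - expConv f (max (t - ω) 0)| ≤ Real.exp (2 * ω) * Real.exp (-t)
  mass : ∀ t ≥ 0, |1 - expConv f (max (t - ω) 0) - ∫ s in (max (t - ω) 0)..t, f s|
    ≤ Real.exp (2 * ω) * Real.exp (-t)

/-- The restriction of `J` to `[ω n, ω (n + 1)]`, rescaled to `[0, 1]`. -/
noncomputable def delayState (ω : ℝ) {J : ℝ → ℝ} (hJ : Continuous J) (n : ℕ) :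
    C(Icc (0 : ℝ) 1, ℂ) :=
  ⟨fun s => ((J (ω * (n + s)) : ℝ) : ℂ), by fun_prop⟩

theorem delayState_apply (ω : ℝ) {J : ℝ → ℝ} (hJ : Continuous J) (n : ℕ) (s : Icc (0 : ℝ) 1) :
    delayState ω hJ n s = (J (ω * (n + s)) : ℝ) := rfl

theorem norm_delayMass_delayState_sub_one_le {ω : ℝ} (hω : 0 < ω) {f : ℝ → ℝ}
    (h : RenewalSystem ω f) (n : ℕ) :
    ‖delayMass ω hω.le (delayState ω (continuous_expConv h.continuous) n) - 1‖ ≤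
      Real.exp (2 * ω) * Real.exp (-(ω * n)) := by
  have hf := h.continuous
  have hJ := continuous_expConv hf
  set t := ω * (n + 1) with ht
  have ht0 : 0 ≤ t := by positivity
  have htω : t - ω = ω * n := by rw [ht]; ring
  have hmax : max (t - ω) 0 = ω * n := by rw [htω, max_eq_left (by positivity)]
  have h1 := h.mass t ht0
  rw [hmax] at h1
  have h2 := intervalIntegral.integral_eq_sub_of_hasDerivAt
    (fun s _ => hasDerivAt_expConv hf s)
    ((hf.sub hJ).intervalIntegrable (ω * n) t)
  rw [intervalIntegral.integral_sub (hf.intervalIntegrable _ _) (hJ.intervalIntegrable _ _)] at h2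
  have h3 : ω * ∫ s in (0 : ℝ)..1, expConv f (ω * (n + s)) = ∫ s in (ω * n)..t, expConv f s := by
    have := intervalIntegral.smul_integral_comp_mul_add (expConv f) ω (ω * n) (a := 0) (b := 1)
    rw [smul_eq_mul, mul_zero, zero_add, mul_one, ← mul_one_add, add_comm 1] at this
    rw [← this]
    congr 2
    funext s
    congr 1
    ring
  have h4 : delayMass ω hω.le (delayState ω hJ n)
      = ((expConv f t + ∫ s in (ω * n)..t, expConv f s : ℝ) : ℂ) := by
    have e1 : ∫ r in (0 : ℝ)..1, IccExtend zero_le_one (delayState ω hJ n) r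
        = ((∫ s in (0 : ℝ)..1, expConv f (ω * (n + s)) : ℝ) : ℂ) := by
      rw [← intervalIntegral.integral_ofReal]
      refine intervalIntegral.integral_congr fun r hr => ?_
      rw [uIcc_of_le zero_le_one] at hr
      rw [IccExtend_of_mem _ _ hr, delayState_apply]
    rw [delayMass_apply, e1, ← h3, delayState_apply, Icc.coe_one, Complex.real_smul]
    push_cast
    rfl
  -- From `J' = f - J`, integrated over one delay interval, `J(t) + ∫ J = J(ω n) + ∫ f`. So the mass
  -- of the state is the conserved quantity of the renewal system.
  have h5 : expConv f t + (∫ s in (ω * n)..t, expConv f s) - 1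
      = -(1 - expConv f (ω * n) - ∫ s in (ω * n)..t, f s) := by linarith
  rw [h4, ← Complex.ofReal_one, ← Complex.ofReal_sub, Complex.norm_real, h5, norm_neg]
  refine h1.trans ?_
  gcongr
  rw [ht]
  linarith

/-- Both functions start from `J(ω (n + 1))`, and their equations differ only by the renewal
remainder. With the integrating factor `exp (ω s)` the difference has a derivative bounded
independently of `s`. -/
theorem norm_delayState_succ_sub_le {ω : ℝ} (hω : 0 < ω) {f : ℝ → ℝ} (h : RenewalSystem ω f)
    (n : ℕ) :
    ‖delayState ω (continuous_expConv h.continuous) (n + 1) -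
      delayStep ω hω.le (delayState ω (continuous_expConv h.continuous) n)‖ ≤
      ω * Real.exp (2 * ω) * Real.exp (-(ω * n)) := by
  have hf := h.continuous
  have hJ := continuous_expConv hf
  refine (ContinuousMap.norm_le _ (by positivity)).2 fun s => ?_
  set φ := delayState ω hJ n with hφ
  set v : ℝ → ℂ := fun s => ((expConv f (ω * (n + 1 + s)) : ℝ) : ℂ) - delayFlow ω φ s with hv
  have hvd : ∀ s, HasDerivAt v (ω • (((f (ω * (n + 1 + s)) - expConv f (ω * (n + 1 + s)) : ℝ) : ℂ)
      - (IccExtend zero_le_one φ s - delayFlow ω φ s))) s := by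
    intro s
    have h1 : HasDerivAt (fun s : ℝ => ω * (n + 1 + s)) ω s := by
      simpa using ((hasDerivAt_id s).const_add ((n : ℝ) + 1)).const_mul ω
    have h2 := ((hasDerivAt_expConv hf (ω * (n + 1 + s))).comp s h1).ofReal_comp
    refine (h2.sub (hasDerivAt_delayFlow ω φ s)).congr_deriv ?_
    simp only [Complex.real_smul]
    push_cast
    ring
  have hwd : ∀ s, HasDerivAt (fun s : ℝ => Real.exp (ω * s) • v s)
      ((ω * Real.exp (ω * s)) • (((f (ω * (n + 1 + s)) : ℝ) : ℂ) - IccExtend zero_le_one φ s))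
      s := by
    intro s
    have h1 : HasDerivAt (fun s : ℝ => Real.exp (ω * s)) (Real.exp (ω * s) * (ω * 1)) s :=
      ((hasDerivAt_id s).const_mul ω).exp
    refine (h1.smul (hvd s)).congr_deriv ?_
    simp only [hv, Complex.real_smul]
    push_cast
    ring
  have hbound : ∀ s ∈ Ico (0 : ℝ) 1, ‖(ω * Real.exp (ω * s)) •
      (((f (ω * (n + 1 + s)) : ℝ) : ℂ) - IccExtend zero_le_one φ s)‖
      ≤ ω * (Real.exp (2 * ω) * Real.exp (-(ω * (n + 1)))) := by
    intro s hs
    have hs' := Ico_subset_Icc_self hs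
    have ht : 0 ≤ ω * (n + 1 + s) := mul_nonneg hω.le (by linarith [hs.1, Nat.cast_nonneg (α := ℝ) n])
    have h1 := h.renewal _ ht
    have e : ω * (n + 1 + s) - ω = ω * (n + s) := by ring
    rw [e, max_eq_left (mul_nonneg hω.le (by linarith [hs.1, Nat.cast_nonneg (α := ℝ) n]))] at h1
    rw [IccExtend_of_mem _ _ hs', hφ, delayState_apply, ← Complex.ofReal_sub, norm_smul,
      Complex.norm_real, Real.norm_eq_abs, Real.norm_eq_abs, abs_of_pos (by positivity), mul_assoc]
    refine mul_le_mul_of_nonneg_left ?_ hω.le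
    calc Real.exp (ω * s) * |f (ω * (n + 1 + s)) - expConv f (ω * (n + s))|
        ≤ Real.exp (ω * s) * (Real.exp (2 * ω) * Real.exp (-(ω * (n + 1 + s)))) := by gcongr
      _ = _ := by
        rw [← Real.exp_add, ← Real.exp_add, ← Real.exp_add]
        congr 1
        ring
  have hv0 : v 0 = 0 := by
    simp only [hv, add_zero, delayFlow_zero, hφ, delayState_apply, Icc.coe_one, sub_self]
  have h1 := norm_image_sub_le_of_norm_deriv_le_segment' (a := (0 : ℝ)) (b := 1)
    (fun s _ => (hwd s).hasDerivWithinAt) hbound s s.2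
  rw [hv0, smul_zero, sub_zero, sub_zero, norm_smul, Real.norm_eq_abs,
    abs_of_pos (Real.exp_pos _)] at h1
  have h2 : ‖v s‖ ≤ Real.exp (ω * s) * ‖v s‖ :=
    le_mul_of_one_le_left (norm_nonneg _) (Real.one_le_exp (mul_nonneg hω.le s.2.1))
  have h3 : (delayState ω hJ (n + 1) - delayStep ω hω.le φ) s = v s := by
    rw [ContinuousMap.sub_apply, delayStep_apply, delayState_apply]
    push_cast
    rfl
  rw [h3]
  refine h2.trans (h1.trans ?_)
  have hX : Real.exp (-(ω * (n + 1))) ≤ Real.exp (-(ω * n)) := by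
    gcongr
    linarith
  calc ω * (Real.exp (2 * ω) * Real.exp (-(ω * (n + 1)))) * s
      ≤ ω * (Real.exp (2 * ω) * Real.exp (-(ω * (n + 1)))) * 1 := by
        gcongr
        exact s.2.2
    _ ≤ ω * (Real.exp (2 * ω) * Real.exp (-(ω * n))) * 1 := by gcongr
    _ = _ := by ring

theorem norm_delayState_zero_le {ω : ℝ} (hω : 0 < ω) {f : ℝ → ℝ} (h : RenewalSystem ω f) :
    ‖delayState ω (continuous_expConv h.continuous) 0‖ ≤ ω * Real.exp (2 * ω) := by
  refine (ContinuousMap.norm_le _ (by positivity)).2 fun s => ?_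
  rw [delayState_apply, Complex.norm_real, expConv, Nat.cast_zero, zero_add]
  have hs0 : 0 ≤ ω * (s : ℝ) := mul_nonneg hω.le s.2.1
  have hs1 : ω * (s : ℝ) ≤ ω := mul_le_of_le_one_right hω.le s.2.2
  refine (intervalIntegral.norm_integral_le_of_norm_le_const (C := Real.exp (2 * ω))
    fun r hr => ?_).trans ?_
  · rw [uIoc_of_le hs0] at hr
    have h1 := h.renewal r hr.1.le
    have e0 : expConv f 0 = 0 := by simp [expConv]
    rw [max_eq_right (by linarith [hr.2]), e0, sub_zero] at h1
    rw [norm_mul, Real.norm_eq_abs, Real.norm_eq_abs, abs_of_pos (Real.exp_pos _)]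
    have h2 : Real.exp (-(ω * s - r)) ≤ 1 := Real.exp_le_one_iff.2 (by linarith [hr.2])
    have h3 : Real.exp (-r) ≤ 1 := Real.exp_le_one_iff.2 (by linarith [hr.1])
    calc Real.exp (-(ω * s - r)) * |f r| ≤ 1 * (Real.exp (2 * ω) * 1) := by
          gcongr
          exact h1.trans (by gcongr)
      _ = _ := by ring
  · rw [sub_zero, abs_of_nonneg hs0, mul_comm]
    gcongr

/-- Exponential convergence of the solutions of the renewal system, with constants that are
uniform for delays close to `ω₀`. -/
theorem eventually_renewal_estimate {ω₀ β b : ℝ} (hω₀ : 0 < ω₀)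
    (hroot : ∀ z : ℂ, z ≠ 0 → delaySymbol ω₀ z = 0 → z.re < -β) (hb0 : 0 < b) (hb : b < β)
    (hb1 : b ≤ 1) :
    ∃ C > 0, ∀ᶠ ω in nhds ω₀, 0 < ω ∧ ∀ f, RenewalSystem ω f →
      ∀ t ≥ 0, |f t - 1 / (1 + ω)| ≤ C * Real.exp (-b * t) := by
  obtain ⟨K, hK, hev⟩ := eventually_delay_recurrence_bound hω₀ hroot hb
  -- An explicit constant for each `ω`. It is continuous, so `B ω₀ + 1` serves for all nearby
  -- delays.
  set B : ℝ → ℝ := fun ω => Real.exp (2 * ω) * ((1 + Real.exp ω) +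
    K * Real.exp (2 * ω) * (2 * ω + 2)) + Real.exp ω with hB
  have hBc : Continuous B := by fun_prop
  refine ⟨B ω₀ + 1, by positivity, ?_⟩
  filter_upwards [hev, lt_mem_nhds hω₀,
    hBc.continuousAt.eventually_lt continuousAt_const (lt_add_one (B ω₀))] with ω H hω hBω
  refine ⟨hω, fun f h t ht => ?_⟩
  refine le_trans ?_ (mul_le_mul_of_nonneg_right hBω.le (Real.exp_pos _).le)
  have hf := h.continuous
  have hJ := continuous_expConv hf
  set c : ℝ := 1 / (1 + ω) with hc
  have hω1 : (1 : ℝ) + ω ≠ 0 := by positivity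
  have hc1 : c ≤ 1 := by rw [hc, div_le_one (by positivity)]; linarith
  have hc0 : 0 ≤ c := by positivity
  have hE1 : 1 ≤ Real.exp (2 * ω) := Real.one_le_exp (by positivity)
  have hE0 : 1 ≤ Real.exp ω := Real.one_le_exp hω.le
  have hbt : Real.exp (-t) ≤ Real.exp (-b * t) := Real.exp_le_exp.2 (by nlinarith)
  set z : ℕ → C(Icc (0 : ℝ) 1, ℂ) := fun n => delayState ω hJ n - (c : ℂ) • 1 with hz
  have hpow : ∀ n : ℕ, Real.exp (-b * ω) ^ n = Real.exp (-b * (ω * n)) := fun n => by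
    rw [← Real.exp_nat_mul]
    congr 1
    ring
  have hn1 : ‖(c : ℂ) • (1 : C(Icc (0 : ℝ) 1, ℂ))‖ ≤ 1 := by
    refine (ContinuousMap.norm_le _ zero_le_one).2 fun s => ?_
    simpa [abs_of_nonneg hc0] using hc1
  have hz0 : ‖z 0‖ ≤ ω * Real.exp (2 * ω) + 1 :=
    (norm_sub_le _ _).trans (add_le_add (norm_delayState_zero_le hω h) hn1)
  have hz_err : ∀ n, ‖z (n + 1) - reducedStep ω hω.le (z n)‖ ≤
      (1 + ω) * Real.exp (2 * ω) * Real.exp (-b * ω) ^ n := by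
    intro n
    have hQ := norm_delayMass_delayState_sub_one_le hω h n
    have hS := norm_delayState_succ_sub_le hω h n
    set Q := delayMass ω hω.le (delayState ω hJ n) with hQd
    -- The deviations from the constant `1 / (1 + ω)` obey the reduced recurrence. The error is the
    -- step error plus a constant proportional to the mass defect `Q - 1`.
    have e1 : z (n + 1) - reducedStep ω hω.le (z n)
        = (delayState ω hJ (n + 1) - delayStep ω hω.le (delayState ω hJ n)) +
          ((c : ℂ) * (Q - 1)) • 1 := by
      have hcc : (c : ℂ) * (1 + ω) = 1 := by
        rw [hc]
        push_cast
        field_simp [one_add_ofReal_ne_zero hω.le]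
      have hci : (1 + ω : ℂ)⁻¹ = c := inv_eq_of_mul_eq_one_left hcc
      rw [reducedStep_apply]
      simp only [hz]
      rw [map_sub, map_sub, map_smul, map_smul, delayStep_one, delayMass_one, ← hQd, hci,
        smul_eq_mul, hcc]
      abel
    have e2 : ‖((c : ℂ) * (Q - 1)) • (1 : C(Icc (0 : ℝ) 1, ℂ))‖ ≤ ‖Q - 1‖ := by
      refine (ContinuousMap.norm_le _ (norm_nonneg _)).2 fun s => ?_
      rw [ContinuousMap.smul_apply, ContinuousMap.one_apply, smul_eq_mul, mul_one, norm_mul,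
        Complex.norm_real, Real.norm_eq_abs, abs_of_nonneg hc0]
      exact mul_le_of_le_one_left (norm_nonneg _) hc1
    rw [e1]
    refine (norm_add_le _ _).trans ((add_le_add hS (e2.trans hQ)).trans ?_)
    have e3 : Real.exp (-(ω * n)) ≤ Real.exp (-b * ω) ^ n := by
      rw [hpow]
      refine Real.exp_le_exp.2 ?_
      have : 0 ≤ ω * n := by positivity
      nlinarith
    calc ω * Real.exp (2 * ω) * Real.exp (-(ω * n)) + Real.exp (2 * ω) * Real.exp (-(ω * n))
        = (1 + ω) * Real.exp (2 * ω) * Real.exp (-(ω * n)) := by ring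
      _ ≤ _ := by gcongr
  have hzn := H hω.le z (fun n => z (n + 1) - reducedStep ω hω.le (z n))
    ((1 + ω) * Real.exp (2 * ω)) (by positivity) (fun n => by abel) hz_err
  have hzn' : ∀ n, ‖z n‖ ≤ K * Real.exp (-b * (ω * n)) * (Real.exp (2 * ω) * (2 * ω + 2)) := by
    intro n
    refine (hzn n).trans ?_
    rw [hpow]
    gcongr
    linarith
  have hg := h.renewal t ht
  -- For `t < ω` the bound is crude, since `exp (-b t) ≥ exp (-ω)`. For `t ≥ ω`, `f(t)` is close to
  -- `J(t - ω)`, a value of the state number `⌊(t - ω) / ω⌋`; since `ω n > t - 2 ω` and `b ≤ 1`, the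
  -- loss is at most `exp (2 ω)`.
  rcases lt_or_ge t ω with htω | htω
  · have e0 : expConv f 0 = 0 := by simp [expConv]
    rw [max_eq_right (by linarith), e0, sub_zero] at hg
    have h1 : 1 ≤ Real.exp ω * Real.exp (-b * t) := by
      rw [← Real.exp_add]
      exact Real.one_le_exp (by nlinarith)
    calc |f t - c| ≤ |f t| + |c| := abs_sub _ _
      _ ≤ Real.exp (2 * ω) * Real.exp (-b * t) + Real.exp ω * Real.exp (-b * t) := by
        refine add_le_add (hg.trans (by gcongr)) ?_
        rw [abs_of_nonneg hc0]
        exact hc1.trans h1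
      _ ≤ B ω * Real.exp (-b * t) := by
        rw [← add_mul]
        gcongr
        simp only [hB]
        have : 0 ≤ Real.exp (2 * ω) * (Real.exp ω + K * Real.exp (2 * ω) * (2 * ω + 2)) := by
          positivity
        linarith
  · have ht' : 0 ≤ (t - ω) / ω := div_nonneg (by linarith) hω.le
    set n := ⌊(t - ω) / ω⌋₊ with hn
    have hn1 := Nat.floor_le ht'
    have hn2 := Nat.lt_floor_add_one ((t - ω) / ω)
    rw [← hn] at hn1 hn2
    have hs : (t - ω) / ω - n ∈ Icc (0 : ℝ) 1 := ⟨by linarith, by linarith⟩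
    have hval : z n ⟨_, hs⟩ = ((expConv f (t - ω) - c : ℝ) : ℂ) := by
      simp only [hz, ContinuousMap.sub_apply, delayState_apply, ContinuousMap.smul_apply,
        ContinuousMap.one_apply, smul_eq_mul, mul_one, add_sub_cancel]
      rw [mul_div_cancel₀ _ hω.ne']
      push_cast
      rfl
    have hJc : |expConv f (t - ω) - c| ≤ ‖z n‖ := by
      have := (z n).norm_coe_le_norm ⟨_, hs⟩
      rwa [hval, Complex.norm_real] at this
    rw [max_eq_left (by linarith)] at hg
    have hnt : Real.exp (-b * (ω * n)) ≤ Real.exp (2 * ω) * Real.exp (-b * t) := by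
      rw [← Real.exp_add]
      refine Real.exp_le_exp.2 ?_
      rw [div_lt_iff₀ hω] at hn2
      nlinarith
    calc |f t - c| = |(f t - expConv f (t - ω)) + (expConv f (t - ω) - c)| := by
          congr 1; ring
      _ ≤ |f t - expConv f (t - ω)| + |expConv f (t - ω) - c| := abs_add_le _ _
      _ ≤ Real.exp (2 * ω) * Real.exp (-b * t) +
          K * (Real.exp (2 * ω) * Real.exp (-b * t)) * (Real.exp (2 * ω) * (2 * ω + 2)) :=
        add_le_add (hg.trans (by gcongr)) (hJc.trans ((hzn' n).trans (by gcongr)))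
      _ = (Real.exp (2 * ω) * (1 + K * Real.exp (2 * ω) * (2 * ω + 2))) * Real.exp (-b * t) := by
        ring
      _ ≤ B ω * Real.exp (-b * t) := by
        gcongr
        simp only [hB]
        have : 0 ≤ Real.exp (2 * ω) * Real.exp ω + Real.exp ω := by positivity
        linarith

/-! ### From weak to integrated time derivatives -/

theorem integral_sub_primitive_mul_deriv_eq_zero {A B : ℝ → ℝ} (hA : Continuous A) (hB : Continuous B)
    (h : ∀ θ : ℝ → ℝ, ContDiff ℝ (⊤ : ℕ∞) θ → HasCompactSupport θ → tsupport θ ⊆ Ioi 0 →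
      ∫ t in Ioi (0 : ℝ), A t * deriv θ t = -∫ t in Ioi (0 : ℝ), B t * θ t)
    {θ : ℝ → ℝ} (hθ : ContDiff ℝ (⊤ : ℕ∞) θ) (hc : HasCompactSupport θ)
    (hs : tsupport θ ⊆ Ioi 0) :
    ∫ t, (A t - ∫ s in (0 : ℝ)..t, B s) * deriv θ t = 0 := by
  have hθ' : Continuous (deriv θ) := hθ.continuous_deriv (by simp)
  set I : ℝ → ℝ := fun t => ∫ s in (0 : ℝ)..t, B s with hI
  have hId : ∀ t, HasDerivAt I (B t) t := fun t =>
    intervalIntegral.integral_hasDerivAt_right (hB.intervalIntegrable 0 t)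
      (hB.stronglyMeasurableAtFilter _ _) hB.continuousAt
  have hIc : Continuous I := continuous_iff_continuousAt.2 fun t => (hId t).continuousAt
  have i1 : Integrable fun t => I t * deriv θ t :=
    (hIc.mul hθ').integrable_of_hasCompactSupport hc.deriv.mul_left
  have i2 : Integrable fun t => B t * θ t :=
    (hB.mul hθ.continuous).integrable_of_hasCompactSupport hc.mul_left
  have i3 : Integrable fun t => A t * deriv θ t :=
    (hA.mul hθ').integrable_of_hasCompactSupport hc.deriv.mul_left
  have i4 : Integrable fun t => I t * θ t :=
    (hIc.mul hθ.continuous).integrable_of_hasCompactSupport hc.mul_left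
  have h1 : ∫ t, (B t * θ t + I t * deriv θ t) = 0 :=
    integral_eq_zero_of_hasDerivAt_of_integrable (f := fun t => I t * θ t)
      (fun t => (hId t).mul ((hθ.differentiable (by simp)).differentiableAt.hasDerivAt))
      (i2.add i1) i4
  have e1 : ∫ t in Ioi (0 : ℝ), A t * deriv θ t = ∫ t, A t * deriv θ t :=
    setIntegral_eq_integral_of_forall_compl_eq_zero fun t ht => by
      rw [image_eq_zero_of_notMem_tsupport fun h' => ht (hs (tsupport_deriv_subset h')), mul_zero]
  have e2 : ∫ t in Ioi (0 : ℝ), B t * θ t = ∫ t, B t * θ t :=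
    setIntegral_eq_integral_of_forall_compl_eq_zero fun t ht => by
      rw [image_eq_zero_of_notMem_tsupport fun h' => ht (hs h'), mul_zero]
  have h2 := h θ hθ hc hs
  rw [e1, e2] at h2
  rw [integral_add i2 i1] at h1
  simp only [sub_mul]
  rw [integral_sub i3 i1, h2]
  linarith

/-- A continuous function with zero weak derivative on `(0, ∞)` is constant there. Its
mollifications have zero derivative on `[x, ∞)`, because the mollifier radii stay below `x` and the
test functions `ρ (z - ·)` are then supported in `(0, ∞)`. -/
theorem eq_of_forall_integral_mul_deriv_eq_zero {H : ℝ → ℝ} (hH : Continuous H)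
    (h : ∀ θ : ℝ → ℝ, ContDiff ℝ (⊤ : ℕ∞) θ → HasCompactSupport θ → tsupport θ ⊆ Ioi 0 →
      ∫ t, H t * deriv θ t = 0) {x y : ℝ} (hx : 0 < x) (hxy : x ≤ y) : H y = H x := by
  let φ : ℕ → ContDiffBump (0 : ℝ) := fun n =>
    ⟨x / (n + 3), x / (n + 2), by positivity, by
      have : (0 : ℝ) < n + 2 := by positivity
      gcongr
      linarith⟩
  have hφ : Tendsto (fun n => (φ n).rOut) atTop (nhds 0) :=
    Tendsto.div_atTop (l := atTop) tendsto_const_nhds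
      (tendsto_atTop_add_const_right _ _ tendsto_natCast_atTop_atTop)
  have hφx : ∀ n, (φ n).rOut < x := fun n => by
    have : (1 : ℝ) < n + 2 := by linarith [Nat.cast_nonneg (α := ℝ) n]
    exact div_lt_self hx this
  have hz : ∀ n, ∀ z, x ≤ z → HasDerivAt
      (convolution ((φ n).normed volume) H (ContinuousLinearMap.lsmul ℝ ℝ) volume) 0 z := by
    intro n z hz
    have h1 := HasCompactSupport.hasDerivAt_convolution_left (ContinuousLinearMap.lsmul ℝ ℝ)
      (μ := volume) ((φ n).hasCompactSupport_normed (μ := volume)) (φ n).contDiff_normed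
      hH.locallyIntegrable z
    refine h1.congr_deriv ?_
    rw [convolution_def]
    set ρ : ℝ → ℝ := (φ n).normed volume with hρ
    have h2 := integral_sub_left_eq_self
      (fun s => ContinuousLinearMap.lsmul ℝ ℝ (deriv ρ s) (H (z - s))) volume z
    rw [← h2]
    have h3 := h (fun s => ρ (z - s)) ((φ n).contDiff_normed.comp (contDiff_const.sub contDiff_id))
      (by
        refine HasCompactSupport.of_support_subset_isCompact
          (isCompact_closedBall z (φ n).rOut) fun s hs => ?_
        have hs' := (φ n).support_normed_eq (μ := volume) ▸ (show z - s ∈ Function.support ρ from hs)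
        rw [mem_ball_zero_iff] at hs'
        rw [Metric.mem_closedBall, dist_comm, dist_eq_norm]
        exact hs'.le)
      (by
        have : tsupport (fun s => ρ (z - s)) ⊆ Metric.closedBall z (φ n).rOut := by
          refine closure_minimal (fun s hs => ?_) Metric.isClosed_closedBall
          have hs' := (φ n).support_normed_eq (μ := volume) ▸
            (show z - s ∈ Function.support ρ from hs)
          rw [mem_ball_zero_iff] at hs'
          rw [Metric.mem_closedBall, dist_comm, dist_eq_norm]
          exact hs'.le
        refine this.trans fun s hs => ?_
        rw [Metric.mem_closedBall, Real.dist_eq, abs_le] at hs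
        have := hφx n
        rw [mem_Ioi]
        linarith [hs.1])
    simp only [deriv_comp_const_sub, mul_neg] at h3
    rw [integral_neg, neg_eq_zero] at h3
    rw [← h3]
    congr 1
    funext s
    simp [mul_comm]
  have hconst : ∀ n, convolution ((φ n).normed volume) H (ContinuousLinearMap.lsmul ℝ ℝ) volume y
      = convolution ((φ n).normed volume) H (ContinuousLinearMap.lsmul ℝ ℝ) volume x := fun n =>
    constant_of_has_deriv_right_zero
      (fun s hs => (hz n s hs.1).continuousAt.continuousWithinAt)
      (fun s hs => (hz n s hs.1).hasDerivWithinAt) y ⟨hxy, le_rfl⟩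
  have hy := ContDiffBump.convolution_tendsto_right_of_continuous (μ := volume) hφ hH y
  have hx' := ContDiffBump.convolution_tendsto_right_of_continuous (μ := volume) hφ hH x
  simp only [hconst] at hy
  exact tendsto_nhds_unique hy hx'

/-- A continuous function whose weak derivative on `(0, ∞)` is continuous up to `0` is a
primitive of it. -/
theorem sub_eq_integral_of_weak_deriv {A B : ℝ → ℝ} (hA : ContinuousOn A (Ici 0))
    (hB : ContinuousOn B (Ici 0))
    (h : ∀ θ : ℝ → ℝ, ContDiff ℝ (⊤ : ℕ∞) θ → HasCompactSupport θ → tsupport θ ⊆ Ioi 0 →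
      ∫ t in Ioi (0 : ℝ), A t * deriv θ t = -∫ t in Ioi (0 : ℝ), B t * θ t)
    {T : ℝ} (hT : 0 ≤ T) : A T - A 0 = ∫ t in (0 : ℝ)..T, B t := by
  have hmax : Continuous fun t : ℝ => max t 0 := by fun_prop
  have hA' : Continuous fun t => A (max t 0) :=
    hA.comp_continuous hmax fun t => le_max_right t 0
  have hB' : Continuous fun t => B (max t 0) :=
    hB.comp_continuous hmax fun t => le_max_right t 0
  set H : ℝ → ℝ := fun t => A (max t 0) - ∫ s in (0 : ℝ)..t, B (max s 0) with hH
  have hHc : Continuous H := hA'.sub (intervalIntegral.continuous_primitive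
    (fun a b => hB'.intervalIntegrable a b) 0)
  have key : ∀ θ : ℝ → ℝ, ContDiff ℝ (⊤ : ℕ∞) θ → HasCompactSupport θ → tsupport θ ⊆ Ioi 0 →
      ∫ t, H t * deriv θ t = 0 := fun θ h1 h2 h3 =>
    integral_sub_primitive_mul_deriv_eq_zero hA' hB' (fun θ h1 h2 h3 => by
      have e1 : ∫ t in Ioi (0 : ℝ), A (max t 0) * deriv θ t
          = ∫ t in Ioi (0 : ℝ), A t * deriv θ t :=
        setIntegral_congr_fun measurableSet_Ioi fun t ht => by
          simp only [max_eq_left (le_of_lt (mem_Ioi.1 ht))]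
      have e2 : ∫ t in Ioi (0 : ℝ), B (max t 0) * θ t = ∫ t in Ioi (0 : ℝ), B t * θ t :=
        setIntegral_congr_fun measurableSet_Ioi fun t ht => by
          simp only [max_eq_left (le_of_lt (mem_Ioi.1 ht))]
      rw [e1, e2]
      exact h θ h1 h2 h3) h1 h2 h3
  have hT0 : H T = H 0 := by
    rcases hT.eq_or_lt with rfl | hT'
    · rfl
    have h1 : Tendsto H (nhdsWithin 0 (Ioi 0)) (nhds (H 0)) :=
      hHc.continuousAt.tendsto.mono_left nhdsWithin_le_nhds
    -- Constancy is known only on `(0, ∞)`; continuity at `0` carries it to the initial time.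
    have h2 : Tendsto H (nhdsWithin 0 (Ioi 0)) (nhds (H T)) := by
      refine tendsto_const_nhds.congr' ?_
      filter_upwards [Ioo_mem_nhdsGT hT'] with x hx
      exact eq_of_forall_integral_mul_deriv_eq_zero hHc key hx.1 hx.2.le
    exact tendsto_nhds_unique h2 h1
  have e3 : ∫ s in (0 : ℝ)..T, B (max s 0) = ∫ s in (0 : ℝ)..T, B s :=
    intervalIntegral.integral_congr fun s hs => by
      rw [uIcc_of_le hT] at hs
      simp only [max_eq_left hs.1]
  simp only [hH, max_eq_left hT, e3, max_self, intervalIntegral.integral_same, sub_zero] at hT0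
  linarith

/-! ### Testing the equation along characteristics -/

theorem integrableOn_mul_of_continuousOn {u θ : ℝ → ℝ} (hu : ContinuousOn u (Ici 0))
    (hθ : Continuous θ) (hc : HasCompactSupport θ) :
    IntegrableOn (fun t => u t * θ t) (Ioi 0) := by
  have hu' : Continuous fun t => u (max t 0) :=
    hu.comp_continuous (by fun_prop) fun t => le_max_right t 0
  have h1 : Integrable fun t => u (max t 0) * θ t :=
    (hu'.mul hθ).integrable_of_hasCompactSupport hc.mul_left
  refine h1.integrableOn.congr_fun (fun t ht => ?_) measurableSet_Ioi
  simp only [max_eq_left (le_of_lt (mem_Ioi.1 ht))]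

theorem integrable_mul_of_abs_le {f g : ℝ → ℝ} (hf : Integrable f) (hg : AEStronglyMeasurable g)
    {C : ℝ} (hC : ∀ σ, |g σ| ≤ C) : Integrable fun σ => f σ * g σ :=
  hf.mul_bdd (c := C) hg (ae_of_all _ hC)

/-- Split the increment into `(p t - p t₀) Ψ t`, small because `p` is continuous into `L¹` and `Ψ`
is bounded, and `p t₀ (Ψ t - Ψ t₀)`, small by dominated convergence. -/
theorem continuousOn_integral_mul {p : ℝ → (ℝ →₁[volume] ℝ)} (hp : ContinuousOn p (Ici 0))
    {Ψ : ℝ → ℝ → ℝ} (hm : ∀ t, AEStronglyMeasurable (Ψ t))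
    (hb : ∀ T, ∃ C, ∀ t ∈ Icc 0 T, ∀ σ, |Ψ t σ| ≤ C) (hc : ∀ σ, Continuous fun t => Ψ t σ) :
    ContinuousOn (fun t => ∫ σ, p t σ * Ψ t σ) (Ici 0) := by
  intro t₀ ht₀
  obtain ⟨C, hC⟩ := hb (t₀ + 1)
  have hev : ∀ᶠ t in nhdsWithin t₀ (Ici 0), t ∈ Icc 0 (t₀ + 1) := by
    filter_upwards [self_mem_nhdsWithin, mem_nhdsWithin_of_mem_nhds (Iio_mem_nhds (lt_add_one t₀))]
      with t h1 h2
    exact ⟨h1, (mem_Iio.1 h2).le⟩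
  have hC0 : 0 ≤ C := (abs_nonneg _).trans (hC t₀ ⟨ht₀, by linarith⟩ 0)
  have hint : ∀ s, ∀ t ∈ Icc 0 (t₀ + 1), Integrable fun σ => p s σ * Ψ t σ := fun s t ht =>
    integrable_mul_of_abs_le (L1.integrable_coeFn (p s)) (hm t) (hC t ht)
  have h1 : Tendsto (fun t => ∫ σ, p t₀ σ * Ψ t σ) (nhdsWithin t₀ (Ici 0))
      (nhds (∫ σ, p t₀ σ * Ψ t₀ σ)) := by
    refine tendsto_integral_filter_of_dominated_convergence (fun σ => |p t₀ σ| * C) ?_ ?_ ?_ ?_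
    · filter_upwards [hev] with t ht using (hint t₀ t ht).aestronglyMeasurable
    · filter_upwards [hev] with t ht
      refine ae_of_all _ fun σ => ?_
      rw [Real.norm_eq_abs, abs_mul]
      gcongr
      exact hC t ht σ
    · exact (L1.integrable_coeFn (p t₀)).abs.mul_const C
    · exact ae_of_all _ fun σ =>
        (((hc σ).tendsto t₀).mono_left nhdsWithin_le_nhds).const_mul (p t₀ σ)
  have h2 : Tendsto (fun t => ∫ σ, (p t σ - p t₀ σ) * Ψ t σ) (nhdsWithin t₀ (Ici 0))
      (nhds 0) := by
    have h3 : Tendsto (fun t => ‖p t - p t₀‖ * C) (nhdsWithin t₀ (Ici 0)) (nhds (0 * C)) :=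
      (tendsto_iff_norm_sub_tendsto_zero.1 (hp t₀ ht₀)).mul_const C
    rw [zero_mul] at h3
    refine squeeze_zero_norm' ?_ h3
    filter_upwards [hev] with t ht
    rw [L1.norm_eq_integral_norm, ← integral_mul_const]
    refine norm_integral_le_of_norm_le ((L1.integrable_coeFn (p t - p t₀)).norm.mul_const C) ?_
    filter_upwards [Lp.coeFn_sub (p t) (p t₀)] with σ hσ
    rw [hσ, norm_mul, Pi.sub_apply]
    gcongr
    exact hC t ht σ
  have h3 := h2.add h1
  rw [zero_add] at h3
  refine h3.congr' ?_
  filter_upwards [hev] with t ht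
  have : ∀ σ, (p t σ - p t₀ σ) * Ψ t σ = p t σ * Ψ t σ - p t₀ σ * Ψ t σ := fun σ => by ring
  simp only [this]
  rw [integral_sub (hint t t ht) (hint t₀ t ht)]
  ring

theorem chi_nonneg (σc σ : ℝ) : 0 ≤ chi σc σ := indicator_nonneg (fun _ _ => zero_le_one) σ

theorem chi_le_one (σc σ : ℝ) : chi σc σ ≤ 1 :=
  indicator_le' (f := (1 : ℝ → ℝ)) (g := fun _ => 1) (fun _ _ => le_rfl) (fun _ _ => zero_le_one) σ

theorem abs_chi_le_one (σc σ : ℝ) : |chi σc σ| ≤ 1 := by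
  rw [abs_of_nonneg (chi_nonneg σc σ)]
  exact chi_le_one σc σ

theorem measurable_chi (σc : ℝ) : Measurable (chi σc) :=
  measurable_one.indicator measurableSet_Icc.compl

theorem chi_of_abs_le {σc σ : ℝ} (h : |σ| ≤ σc) : chi σc σ = 0 :=
  indicator_of_notMem (not_not.2 (abs_le.1 h) : σ ∉ (Icc (-σc) σc)ᶜ) _

theorem chi_of_lt_abs {σc σ : ℝ} (h : σc < |σ|) : chi σc σ = 1 :=
  indicator_of_mem (show σ ∈ (Icc (-σc) σc)ᶜ from fun h' => absurd (abs_le.2 h') (not_le.2 h)) _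

theorem continuousOn_fluidity {p : ℝ → (ℝ →₁[volume] ℝ)} (hp : ContinuousOn p (Ici 0)) (σc : ℝ) :
    ContinuousOn (fun t => fluidity σc (p t)) (Ici 0) := by
  have := continuousOn_integral_mul hp (Ψ := fun _ => chi σc)
    (fun _ => (measurable_chi σc).aestronglyMeasurable)
    (fun _ => ⟨1, fun _ _ σ => abs_chi_le_one σc σ⟩) fun _ => continuous_const
  simpa only [fluidity, mul_comm] using this

theorem exists_bound_transport_mul {h G : ℝ → ℝ} (hh : Continuous h) (hc : HasCompactSupport h)
    (hG : ∀ R, ∃ C, ∀ σ, |σ| ≤ R → |G σ| ≤ C) {γ : ℝ} (hγ : 0 ≤ γ) (T : ℝ) :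
    ∃ C, ∀ t ∈ Icc 0 T, ∀ σ, |h (σ - γ * t) * G σ| ≤ C := by
  obtain ⟨R, hR⟩ := hc.isCompact.isBounded.subset_closedBall 0
  obtain ⟨M, hM⟩ := hh.bounded_above_of_compact_support hc
  obtain ⟨C, hC⟩ := hG (R + γ * T)
  refine ⟨M * max C 0, fun t ht σ => ?_⟩
  have hM0 : 0 ≤ M := (norm_nonneg _).trans (hM 0)
  by_cases hσ : σ - γ * t ∈ tsupport h
  · have h1 := hR hσ
    rw [mem_closedBall_zero_iff, Real.norm_eq_abs, abs_le] at h1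
    have h2 : γ * t ≤ γ * T := by gcongr; exact ht.2
    have h3 : 0 ≤ γ * t := mul_nonneg hγ ht.1
    rw [abs_mul]
    gcongr
    · exact hM _
    · exact (hC σ (abs_le.2 ⟨by linarith, by linarith⟩)).trans (le_max_left _ _)
  · rw [image_eq_zero_of_notMem_tsupport hσ, zero_mul, abs_zero]
    positivity

theorem exists_bound_of_continuous {G : ℝ → ℝ} (hG : Continuous G) (R : ℝ) :
    ∃ C, ∀ σ, |σ| ≤ R → |G σ| ≤ C := by
  obtain ⟨C, hC⟩ := (isCompact_Icc (a := -R) (b := R)).exists_bound_of_continuousOn hG.continuousOn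
  exact ⟨C, fun σ hσ => hC σ (abs_le.1 hσ)⟩

theorem continuousOn_integral_transport {p : ℝ → (ℝ →₁[volume] ℝ)} (hp : ContinuousOn p (Ici 0))
    {h G : ℝ → ℝ} (hh : Continuous h) (hc : HasCompactSupport h) (hGm : Measurable G)
    (hG : ∀ R, ∃ C, ∀ σ, |σ| ≤ R → |G σ| ≤ C) {γ : ℝ} (hγ : 0 ≤ γ) :
    ContinuousOn (fun t => ∫ σ, p t σ * (h (σ - γ * t) * G σ)) (Ici 0) :=
  continuousOn_integral_mul hp
    (fun t => ((hh.comp (by fun_prop)).measurable.mul hGm).aestronglyMeasurable)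
    (exists_bound_transport_mul hh hc hG hγ) fun σ => by fun_prop

theorem integrable_mul_transport {f : ℝ → ℝ} (hf : Integrable f) {h G : ℝ → ℝ} (hh : Continuous h)
    (hc : HasCompactSupport h) (hGm : Measurable G)
    (hG : ∀ R, ∃ C, ∀ σ, |σ| ≤ R → |G σ| ≤ C) {γ : ℝ} (hγ : 0 ≤ γ) {t : ℝ} (ht : 0 ≤ t) :
    Integrable fun σ => f σ * (h (σ - γ * t) * G σ) := by
  obtain ⟨C, hC⟩ := exists_bound_transport_mul hh hc hG hγ t
  exact integrable_mul_of_abs_le hf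
    ((hh.comp (by fun_prop)).measurable.mul hGm).aestronglyMeasurable (hC t ⟨ht, le_rfl⟩)

/-- Time evolution of `∫ p(t, σ) h(σ - γ t) E(σ) dσ` along a solution. -/
theorem transport_identity {σc γ : ℝ} (hγ : 0 ≤ γ) {p : ℝ → (ℝ →₁[volume] ℝ)}
    (hp : ContinuousOn p (Ici 0)) (heq : SolvesFokkerPlanck σc (fun _ => γ) p) {h E : ℝ → ℝ}
    (hh : ContDiff ℝ (⊤ : ℕ∞) h) (hc : HasCompactSupport h) (hE : ContDiff ℝ (⊤ : ℕ∞) E)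
    {T : ℝ} (hT : 0 ≤ T) :
    (∫ σ, p T σ * (h (σ - γ * T) * E σ)) - ∫ σ, p 0 σ * (h σ * E σ)
      = ∫ t in (0 : ℝ)..T, ((∫ σ, p t σ * (h (σ - γ * t) * (γ * deriv E σ - chi σc σ * E σ)))
        + fluidity σc (p t) * (h (-(γ * t)) * E 0)) := by
  have hE' : Continuous (deriv E) := hE.continuous_deriv (by simp)
  have hGm : Measurable fun σ => γ * deriv E σ - chi σc σ * E σ :=
    (hE'.measurable.const_mul γ).sub ((measurable_chi σc).mul hE.continuous.measurable)
  have hχE : ∀ R, ∃ C, ∀ σ, |σ| ≤ R → |chi σc σ * E σ| ≤ C := by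
    intro R
    obtain ⟨C, hC⟩ := exists_bound_of_continuous hE.continuous R
    refine ⟨C, fun σ hσ => ?_⟩
    rw [abs_mul]
    exact (mul_le_of_le_one_left (abs_nonneg _) (abs_chi_le_one σc σ)).trans (hC σ hσ)
  have hG : ∀ R, ∃ C, ∀ σ, |σ| ≤ R → |γ * deriv E σ - chi σc σ * E σ| ≤ C := by
    intro R
    obtain ⟨C₁, hC₁⟩ := hχE R
    obtain ⟨C₂, hC₂⟩ := exists_bound_of_continuous (hE'.const_mul γ) R
    exact ⟨C₂ + C₁, fun σ hσ => (abs_sub _ _).trans (add_le_add (hC₂ σ hσ) (hC₁ σ hσ))⟩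
  have hfl := continuousOn_fluidity hp σc
  set A : ℝ → ℝ := fun t => ∫ σ, p t σ * (h (σ - γ * t) * E σ) with hA
  set B₁ : ℝ → ℝ := fun t => ∫ σ, p t σ * (h (σ - γ * t) * (γ * deriv E σ - chi σc σ * E σ))
    with hB₁
  set B₂ : ℝ → ℝ := fun t => fluidity σc (p t) * (h (-(γ * t)) * E 0) with hB₂
  set D₁ : ℝ → ℝ := fun t => ∫ σ, p t σ * (h (σ - γ * t) * (γ * deriv E σ)) with hD₁
  set D₂ : ℝ → ℝ := fun t => ∫ σ, p t σ * (h (σ - γ * t) * (chi σc σ * E σ)) with hD₂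
  have hAc : ContinuousOn A (Ici 0) := continuousOn_integral_transport hp hh.continuous hc
    hE.continuous.measurable (exists_bound_of_continuous hE.continuous) hγ
  have hB₁c : ContinuousOn B₁ (Ici 0) :=
    continuousOn_integral_transport hp hh.continuous hc hGm hG hγ
  have hD₁c : ContinuousOn D₁ (Ici 0) := continuousOn_integral_transport hp hh.continuous hc
    (hE'.const_mul γ).measurable (exists_bound_of_continuous (hE'.const_mul γ)) hγ
  have hD₂c : ContinuousOn D₂ (Ici 0) := continuousOn_integral_transport hp hh.continuous hc
    ((measurable_chi σc).mul hE.continuous.measurable) hχE hγ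
  have hB₂c : ContinuousOn B₂ (Ici 0) := hfl.mul (by
    have := hh.continuous
    exact Continuous.continuousOn (by fun_prop))
  have key := sub_eq_integral_of_weak_deriv hAc (hB₁c.add hB₂c) (fun θ hθ hθc hθs => ?_) hT
  · simpa only [hA, hB₁, hB₂, Pi.add_apply, mul_zero, sub_zero] using key
  have hθ' : Continuous (deriv θ) := hθ.continuous_deriv (by simp)
  -- The factor `h (σ - γ t)` is annihilated by the transport operator, so derivatives fall only on
  -- `θ` and `E`. The support is compact because it lies in a shear of a product of compact sets.
  set ψ : ℝ × ℝ → ℝ := fun q => θ q.1 * (h (q.2 - γ * q.1) * E q.2) with hψ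
  have hψd : ContDiff ℝ (⊤ : ℕ∞) ψ :=
    (hθ.comp contDiff_fst).mul ((hh.comp (contDiff_snd.sub (contDiff_const.mul contDiff_fst))).mul
      (hE.comp contDiff_snd))
  set S : Set (ℝ × ℝ) := (fun q : ℝ × ℝ => (q.1, q.2 + γ * q.1)) '' (tsupport θ ×ˢ tsupport h)
    with hS
  have hScomp : IsCompact S := (hθc.isCompact.prod hc.isCompact).image (by fun_prop)
  have hψS : Function.support ψ ⊆ S := by
    intro q hq
    rw [Function.mem_support] at hq
    refine ⟨(q.1, q.2 - γ * q.1), ⟨subset_tsupport _ (left_ne_zero_of_mul hq),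
      subset_tsupport _ (left_ne_zero_of_mul (right_ne_zero_of_mul hq))⟩, ?_⟩
    simp
  have hψc : HasCompactSupport ψ := HasCompactSupport.of_support_subset_isCompact hScomp hψS
  have hψs : tsupport ψ ⊆ Ioi (0 : ℝ) ×ˢ (univ : Set ℝ) := by
    refine (closure_minimal hψS hScomp.isClosed).trans ?_
    rintro _ ⟨q, hq, rfl⟩
    exact ⟨hθs hq.1, mem_univ _⟩
  have hw := heq ψ hψd hψc hψs
  have hdθ : ∀ t, HasDerivAt θ (deriv θ t) t := fun t =>
    (hθ.differentiable (by simp)).differentiableAt.hasDerivAt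
  have hdh : ∀ t, HasDerivAt h (deriv h t) t := fun t =>
    (hh.differentiable (by simp)).differentiableAt.hasDerivAt
  have hdE : ∀ t, HasDerivAt E (deriv E t) t := fun t =>
    (hE.differentiable (by simp)).differentiableAt.hasDerivAt
  have hdψ : ∀ t σ, deriv (fun s => ψ (s, σ)) t + γ * deriv (fun s => ψ (t, s)) σ
      = deriv θ t * (h (σ - γ * t) * E σ) + θ t * (h (σ - γ * t) * (γ * deriv E σ)) := by
    intro t σ
    have h1 : HasDerivAt (fun s : ℝ => σ - γ * s) (-γ) t := by
      simpa using ((hasDerivAt_id t).const_mul γ).const_sub σ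
    have h2 : HasDerivAt (fun s : ℝ => s - γ * t) 1 σ := (hasDerivAt_id σ).sub_const _
    have h3 : HasDerivAt (fun s => ψ (s, σ)) _ t :=
      (hdθ t).mul (((hdh (σ - γ * t)).comp t h1).mul_const (E σ))
    have h4 : HasDerivAt (fun s => ψ (t, s)) _ σ :=
      (((hdh (σ - γ * t)).comp σ h2).mul (hdE σ)).const_mul (θ t)
    rw [h3.deriv, h4.deriv]
    simp only [Function.comp_apply]
    ring
  simp only [hdψ] at hw
  have e1 : ∫ t in Ioi (0 : ℝ), ∫ σ, p t σ * (deriv θ t * (h (σ - γ * t) * E σ)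
        + θ t * (h (σ - γ * t) * (γ * deriv E σ)))
      = ∫ t in Ioi (0 : ℝ), (A t * deriv θ t + D₁ t * θ t) := by
    refine setIntegral_congr_fun measurableSet_Ioi fun t ht => ?_
    have ht0 : 0 ≤ t := le_of_lt ht
    have e : ∀ σ, p t σ * (deriv θ t * (h (σ - γ * t) * E σ)
        + θ t * (h (σ - γ * t) * (γ * deriv E σ)))
        = deriv θ t * (p t σ * (h (σ - γ * t) * E σ))
          + θ t * (p t σ * (h (σ - γ * t) * (γ * deriv E σ))) := fun σ => by ring
    simp only [e]
    rw [integral_add, integral_const_mul, integral_const_mul, mul_comm (A t), mul_comm (D₁ t)]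
    · exact (integrable_mul_transport (L1.integrable_coeFn (p t)) hh.continuous hc
        hE.continuous.measurable (exists_bound_of_continuous hE.continuous) hγ ht0).const_mul _
    · exact (integrable_mul_transport (L1.integrable_coeFn (p t)) hh.continuous hc
        (hE'.const_mul γ).measurable (exists_bound_of_continuous (hE'.const_mul γ)) hγ
        ht0).const_mul _
  have e2 : ∫ t in Ioi (0 : ℝ), ∫ σ, chi σc σ * p t σ * ψ (t, σ)
      = ∫ t in Ioi (0 : ℝ), D₂ t * θ t := by
    refine setIntegral_congr_fun measurableSet_Ioi fun t _ => ?_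
    simp only [hD₂]
    rw [← integral_mul_const]
    congr 1
    funext σ
    simp only [hψ]
    ring
  have e3 : ∫ t in Ioi (0 : ℝ), fluidity σc (p t) * ψ (t, 0) = ∫ t in Ioi (0 : ℝ), B₂ t * θ t := by
    refine setIntegral_congr_fun measurableSet_Ioi fun t _ => ?_
    simp only [hB₂, hψ, zero_sub]
    ring
  have i1 := integrableOn_mul_of_continuousOn hAc hθ' hθc.deriv
  have i2 := integrableOn_mul_of_continuousOn hD₁c hθ.continuous hθc
  have i3 := integrableOn_mul_of_continuousOn hD₂c hθ.continuous hθc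
  have i4 := integrableOn_mul_of_continuousOn hB₂c hθ.continuous hθc
  have e4 : ∫ t in Ioi (0 : ℝ), (B₁ t + B₂ t) * θ t
      = (∫ t in Ioi (0 : ℝ), D₁ t * θ t) - (∫ t in Ioi (0 : ℝ), D₂ t * θ t)
        + ∫ t in Ioi (0 : ℝ), B₂ t * θ t := by
    have i23 : IntegrableOn (fun t => D₁ t * θ t - D₂ t * θ t) (Ioi 0) := i2.sub i3
    rw [← integral_sub i2 i3, ← integral_add i23 i4]
    refine setIntegral_congr_fun measurableSet_Ioi fun t ht => ?_
    have ht0 : 0 ≤ t := le_of_lt ht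
    have : B₁ t = D₁ t - D₂ t := by
      simp only [hB₁, hD₁, hD₂]
      rw [← integral_sub]
      · congr 1
        funext σ
        ring
      · exact integrable_mul_transport (L1.integrable_coeFn (p t)) hh.continuous hc
          (hE'.const_mul γ).measurable (exists_bound_of_continuous (hE'.const_mul γ)) hγ ht0
      · exact integrable_mul_transport (L1.integrable_coeFn (p t)) hh.continuous hc
          ((measurable_chi σc).mul hE.continuous.measurable) hχE hγ ht0
    simp only [this]
    ring
  rw [e1, e2, e3, integral_add i1 i2] at hw
  simp only [Pi.add_apply]
  rw [e4]
  linarith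

/-! ### The integrating factor and the representation formula -/

/-- The weight `exp (γ⁻¹ ∫₀ˢ χ)`, in closed form. -/
noncomputable def expWeight (σc γ σ : ℝ) : ℝ := Real.exp ((σ - max (-σc) (min σc σ)) / γ)

theorem expWeight_pos (σc γ σ : ℝ) : 0 < expWeight σc γ σ := Real.exp_pos _

theorem continuous_expWeight (σc γ : ℝ) : Continuous (expWeight σc γ) := by
  unfold expWeight
  fun_prop

/-- The integrand vanishes on `[-σc, σc]` and is `1` outside, so the integral is `σ` minus its
truncation to that interval. The truncation is not differentiable at `±σc`, hence the countable
exceptional set. -/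
theorem integral_chi {σc : ℝ} (hσc : 0 < σc) (σ : ℝ) :
    ∫ s in (0 : ℝ)..σ, chi σc s = σ - max (-σc) (min σc σ) := by
  have h := integral_eq_of_hasDerivAt_off_countable (fun s => s - max (-σc) (min σc s)) (chi σc)
    (a := 0) (b := σ) (s := {σc, -σc}) (Set.toFinite _).countable
    (Continuous.continuousOn (by fun_prop)) (fun s hs => by
      have hs1 : s ≠ σc := fun h => hs.2 (by simp [h])
      have hs2 : s ≠ -σc := fun h => hs.2 (by simp [h])
      rcases lt_or_gt_of_ne hs1 with h1 | h1
      · rcases lt_or_gt_of_ne hs2 with h2 | h2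
        · rw [chi_of_lt_abs (lt_abs.2 (Or.inr (by linarith)))]
          refine ((hasDerivAt_id s).sub_const (-σc)).congr_of_eventuallyEq ?_
          filter_upwards [Iio_mem_nhds h2] with x hx
          rw [max_eq_left ((min_le_right _ _).trans (le_of_lt hx)), id]
        · rw [chi_of_abs_le (abs_le.2 ⟨h2.le, h1.le⟩)]
          refine (hasDerivAt_const s (0 : ℝ)).congr_of_eventuallyEq ?_
          filter_upwards [Ioo_mem_nhds h2 h1] with x hx
          rw [min_eq_right hx.2.le, max_eq_right hx.1.le, sub_self]
      · rw [chi_of_lt_abs (lt_abs.2 (Or.inl h1))]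
        refine ((hasDerivAt_id s).sub_const σc).congr_of_eventuallyEq ?_
        filter_upwards [Ioi_mem_nhds h1] with x hx
        rw [min_eq_left (le_of_lt hx), max_eq_right (by linarith), id])
    ((intervalIntegrable_const (c := (1 : ℝ))).mono_fun (measurable_chi σc).aestronglyMeasurable
      (ae_of_all _ fun s => by simpa using abs_chi_le_one σc s))
  have h0 : max (-σc) (min σc 0) = 0 := by
    rw [min_eq_right hσc.le, max_eq_right (by linarith)]
  rw [h, h0]
  ring

/-- Smooth approximations of `χ`. -/
noncomputable def smoothChi (σc : ℝ) (n : ℕ) (s : ℝ) : ℝ :=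
  Real.smoothTransition (n * (s ^ 2 - σc ^ 2))

theorem contDiff_smoothChi (σc : ℝ) (n : ℕ) : ContDiff ℝ (⊤ : ℕ∞) (smoothChi σc n) :=
  Real.smoothTransition.contDiff.comp (by fun_prop)

theorem abs_smoothChi_le_one (σc : ℝ) (n : ℕ) (s : ℝ) : |smoothChi σc n s| ≤ 1 := by
  rw [smoothChi, abs_of_nonneg (Real.smoothTransition.nonneg _)]
  exact Real.smoothTransition.le_one _

theorem tendsto_smoothChi {σc : ℝ} (hσc : 0 < σc) (s : ℝ) :
    Tendsto (fun n => smoothChi σc n s) atTop (nhds (chi σc s)) := by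
  rcases le_or_gt |s| σc with h | h
  · rw [chi_of_abs_le h]
    refine tendsto_const_nhds.congr fun n => ?_
    rw [smoothChi, Real.smoothTransition.zero_of_nonpos]
    refine mul_nonpos_of_nonneg_of_nonpos (Nat.cast_nonneg n) ?_
    rw [sub_nonpos, sq_le_sq, abs_of_pos hσc]
    exact h
  · rw [chi_of_lt_abs h]
    have hpos : 0 < s ^ 2 - σc ^ 2 := by
      rw [sub_pos, sq_lt_sq, abs_of_pos hσc]
      exact h
    have ht : Tendsto (fun n : ℕ => (n : ℝ) * (s ^ 2 - σc ^ 2)) atTop atTop :=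
      tendsto_natCast_atTop_atTop.atTop_mul_const hpos
    refine tendsto_const_nhds.congr' ?_
    filter_upwards [ht.eventually_ge_atTop 1] with n hn
    rw [smoothChi, Real.smoothTransition.one_of_one_le hn]

/-- Smooth approximations of `expWeight`. -/
noncomputable def smoothWeight (σc γ : ℝ) (n : ℕ) (σ : ℝ) : ℝ :=
  Real.exp ((∫ s in (0 : ℝ)..σ, smoothChi σc n s) / γ)

theorem hasDerivAt_smoothWeight (σc γ : ℝ) (n : ℕ) (σ : ℝ) :
    HasDerivAt (smoothWeight σc γ n) (smoothWeight σc γ n σ * (smoothChi σc n σ / γ)) σ := by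
  have hc := (contDiff_smoothChi σc n).continuous
  exact ((intervalIntegral.integral_hasDerivAt_right (hc.intervalIntegrable 0 σ)
    (hc.stronglyMeasurableAtFilter _ _) hc.continuousAt).div_const γ).exp

theorem contDiff_smoothWeight (σc γ : ℝ) (n : ℕ) : ContDiff ℝ (⊤ : ℕ∞) (smoothWeight σc γ n) := by
  have hc := (contDiff_smoothChi σc n).continuous
  have h : ContDiff ℝ (⊤ : ℕ∞) fun σ => ∫ s in (0 : ℝ)..σ, smoothChi σc n s := by
    have hd : ∀ σ, HasDerivAt (fun σ => ∫ s in (0 : ℝ)..σ, smoothChi σc n s) (smoothChi σc n σ) σ :=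
      fun σ => intervalIntegral.integral_hasDerivAt_right (hc.intervalIntegrable 0 σ)
        (hc.stronglyMeasurableAtFilter _ _) hc.continuousAt
    rw [contDiff_infty_iff_deriv]
    refine ⟨fun σ => (hd σ).differentiableAt, ?_⟩
    rw [funext fun σ => (hd σ).deriv]
    exact contDiff_smoothChi σc n
  exact (h.div_const γ).exp

theorem smoothWeight_zero (σc γ : ℝ) (n : ℕ) : smoothWeight σc γ n 0 = 1 := by
  simp [smoothWeight]

theorem abs_smoothWeight_le (σc : ℝ) {γ : ℝ} (hγ : 0 < γ) (n : ℕ) (σ : ℝ) :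
    |smoothWeight σc γ n σ| ≤ |Real.exp (|σ| / γ)| := by
  rw [smoothWeight, abs_of_pos (Real.exp_pos _), abs_of_pos (Real.exp_pos _)]
  gcongr
  refine (le_abs_self _).trans ?_
  have := intervalIntegral.norm_integral_le_of_norm_le_const (a := 0) (b := σ)
    (f := smoothChi σc n) (C := 1) fun s _ => abs_smoothChi_le_one σc n s
  simpa using this

theorem tendsto_smoothWeight {σc : ℝ} (hσc : 0 < σc) (γ σ : ℝ) :
    Tendsto (fun n => smoothWeight σc γ n σ) atTop (nhds (expWeight σc γ σ)) := by
  have h : Tendsto (fun n => ∫ s in (0 : ℝ)..σ, smoothChi σc n s) atTop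
      (nhds (∫ s in (0 : ℝ)..σ, chi σc s)) :=
    intervalIntegral.tendsto_integral_filter_of_dominated_convergence (fun _ => 1)
      (Eventually.of_forall fun n => (contDiff_smoothChi σc n).continuous.aestronglyMeasurable)
      (Eventually.of_forall fun n => ae_of_all _ fun s _ => abs_smoothChi_le_one σc n s)
      intervalIntegrable_const (ae_of_all _ fun s _ => tendsto_smoothChi hσc s)
  rw [integral_chi hσc] at h
  exact (Real.continuous_exp.tendsto _).comp (h.div_const γ)

theorem L1_norm_eq (f : ℝ →₁[volume] ℝ) : ‖f‖ = ∫ σ, |f σ| := L1.norm_eq_integral_norm f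

/-- Transport along the characteristics: `p(t, σ) w(σ)` with `w = expWeight σc γ` solves a free
transport equation with source `f(t) δ₀`. -/
theorem transport_expWeight {σc γ : ℝ} (hσc : 0 < σc) (hγ : 0 < γ) {p : ℝ → (ℝ →₁[volume] ℝ)}
    (hp : ContinuousOn p (Ici 0)) (heq : SolvesFokkerPlanck σc (fun _ => γ) p) {h : ℝ → ℝ}
    (hh : ContDiff ℝ (⊤ : ℕ∞) h) (hc : HasCompactSupport h) {T : ℝ} (hT : 0 ≤ T) :
    (∫ σ, p T σ * (h (σ - γ * T) * expWeight σc γ σ)) - ∫ σ, p 0 σ * (h σ * expWeight σc γ σ)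
      = ∫ t in (0 : ℝ)..T, fluidity σc (p t) * h (-(γ * t)) := by
  have hfl := continuousOn_fluidity hp σc
  have hhc := hh.continuous
  obtain ⟨C, hC⟩ := exists_bound_transport_mul hhc hc
    (exists_bound_of_continuous (G := fun σ => Real.exp (|σ| / γ)) (by fun_prop)) hγ.le T
  have hCn : ∀ n, ∀ t ∈ Icc 0 T, ∀ σ, |h (σ - γ * t) * smoothWeight σc γ n σ| ≤ C := by
    intro n t ht σ
    refine le_trans ?_ (hC t ht σ)
    rw [abs_mul, abs_mul]
    exact mul_le_mul_of_nonneg_left (abs_smoothWeight_le σc hγ n σ) (abs_nonneg _)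
  have hmeas : ∀ n t, Measurable fun σ => h (σ - γ * t) * smoothWeight σc γ n σ := fun n t =>
    (hhc.comp (by fun_prop)).measurable.mul (contDiff_smoothWeight σc γ n).continuous.measurable
  have hlim : ∀ t ∈ Icc 0 T, Tendsto (fun n => ∫ σ, p t σ * (h (σ - γ * t) * smoothWeight σc γ n σ))
      atTop (nhds (∫ σ, p t σ * (h (σ - γ * t) * expWeight σc γ σ))) := by
    intro t ht
    refine tendsto_integral_filter_of_dominated_convergence (fun σ => |p t σ| * C)
      (Eventually.of_forall fun n => (L1.integrable_coeFn (p t)).aestronglyMeasurable.mul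
        (hmeas n t).aestronglyMeasurable) (Eventually.of_forall fun n => ae_of_all _ fun σ => ?_)
      ((L1.integrable_coeFn (p t)).abs.mul_const C) (ae_of_all _ fun σ => ?_)
    · rw [Real.norm_eq_abs, abs_mul]
      gcongr
      exact hCn n t ht σ
    · exact ((tendsto_smoothWeight hσc γ σ).const_mul _).const_mul _
  set R : ℕ → ℝ → ℝ := fun n t => ∫ σ, p t σ * (h (σ - γ * t) *
    (γ * deriv (smoothWeight σc γ n) σ - chi σc σ * smoothWeight σc γ n σ)) with hR
  -- The weight has corners at `±σc` and is not an admissible multiplier. Its smooth approximations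
  -- satisfy `γ wₙ' = χₙ wₙ`, so the failure of exact cancellation is `(χₙ - χ) wₙ`, which tends to
  -- `0` dominatedly.
  have hRe : ∀ n t, R n t = ∫ σ, p t σ * (h (σ - γ * t) *
      ((smoothChi σc n σ - chi σc σ) * smoothWeight σc γ n σ)) := by
    intro n t
    simp only [hR]
    congr 1
    funext σ
    rw [(hasDerivAt_smoothWeight σc γ n σ).deriv]
    field_simp
  have hdiff : ∀ n σ, |smoothChi σc n σ - chi σc σ| ≤ 1 := fun n σ => by
    rw [abs_le]
    have h1 := chi_nonneg σc σ
    have h2 := chi_le_one σc σ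
    have h3 := Real.smoothTransition.nonneg (n * (σ ^ 2 - σc ^ 2))
    have h4 := Real.smoothTransition.le_one (n * (σ ^ 2 - σc ^ 2))
    constructor <;> unfold smoothChi <;> linarith
  have hptw : ∀ n, ∀ t ∈ Icc 0 T, ∀ σ, ‖p t σ * (h (σ - γ * t) *
      ((smoothChi σc n σ - chi σc σ) * smoothWeight σc γ n σ))‖ ≤ |p t σ| * C := by
    intro n t ht σ
    rw [Real.norm_eq_abs, abs_mul]
    gcongr
    calc |h (σ - γ * t) * ((smoothChi σc n σ - chi σc σ) * smoothWeight σc γ n σ)|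
        = |smoothChi σc n σ - chi σc σ| * |h (σ - γ * t) * smoothWeight σc γ n σ| := by
          rw [← abs_mul]; congr 1; ring
      _ ≤ 1 * C := mul_le_mul (hdiff n σ) (hCn n t ht σ) (abs_nonneg _) zero_le_one
      _ = C := one_mul C
  have hmeas' : ∀ n t, AEStronglyMeasurable fun σ => p t σ * (h (σ - γ * t) *
      ((smoothChi σc n σ - chi σc σ) * smoothWeight σc γ n σ)) := fun n t =>
    (L1.integrable_coeFn (p t)).aestronglyMeasurable.mul
      ((hhc.comp (by fun_prop)).measurable.mul
        (((contDiff_smoothChi σc n).continuous.measurable.sub (measurable_chi σc)).mul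
        (contDiff_smoothWeight σc γ n).continuous.measurable)).aestronglyMeasurable
  have hRlim : ∀ t ∈ Icc 0 T, Tendsto (fun n => R n t) atTop (nhds 0) := by
    intro t ht
    have h0 : (0 : ℝ) = ∫ σ, p t σ * (h (σ - γ * t) *
        ((chi σc σ - chi σc σ) * expWeight σc γ σ)) := by simp
    simp only [hRe]
    rw [h0]
    exact tendsto_integral_filter_of_dominated_convergence (fun σ => |p t σ| * C)
      (Eventually.of_forall fun n => hmeas' n t)
      (Eventually.of_forall fun n => ae_of_all _ fun σ => hptw n t ht σ)
      ((L1.integrable_coeFn (p t)).abs.mul_const C) (ae_of_all _ fun σ =>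
        ((((tendsto_smoothChi hσc σ).sub_const _).mul
          (tendsto_smoothWeight hσc γ σ)).const_mul _).const_mul _)
  obtain ⟨P, hP⟩ := (isCompact_Icc (a := 0) (b := T)).exists_bound_of_continuousOn
    (hp.mono Icc_subset_Ici_self)
  have hC0 : 0 ≤ C := (abs_nonneg _).trans (hC 0 ⟨le_rfl, hT⟩ 0)
  have hRb : ∀ n, ∀ t ∈ Icc 0 T, |R n t| ≤ P * C := by
    intro n t ht
    rw [hRe]
    refine (norm_integral_le_of_norm_le ((L1.integrable_coeFn (p t)).abs.mul_const C)
      (ae_of_all _ fun σ => hptw n t ht σ)).trans ?_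
    rw [integral_mul_const, ← L1_norm_eq]
    gcongr
    exact hP t ht
  have hS : ContinuousOn (fun t => fluidity σc (p t) * h (-(γ * t))) (Ici 0) :=
    hfl.mul (Continuous.continuousOn (by fun_prop))
  obtain ⟨Q, hQ⟩ := (isCompact_Icc (a := 0) (b := T)).exists_bound_of_continuousOn
    (hS.mono Icc_subset_Ici_self)
  have hid : ∀ n, (∫ σ, p T σ * (h (σ - γ * T) * smoothWeight σc γ n σ))
      - ∫ σ, p 0 σ * (h σ * smoothWeight σc γ n σ)
      = ∫ t in (0 : ℝ)..T, (R n t + fluidity σc (p t) * h (-(γ * t))) := fun n => by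
    rw [transport_identity hγ.le hp heq hh hc (contDiff_smoothWeight σc γ n) hT]
    simp only [smoothWeight_zero, mul_one, hR]
  have hsub : uIoc 0 T ⊆ Icc 0 T := by
    rw [uIoc_of_le hT]
    exact Ioc_subset_Icc_self
  have hRc : ∀ n, ContinuousOn (R n) (Ici 0) := fun n => by
    have hm : Measurable fun σ => (smoothChi σc n σ - chi σc σ) * smoothWeight σc γ n σ :=
      ((contDiff_smoothChi σc n).continuous.measurable.sub (measurable_chi σc)).mul
        (contDiff_smoothWeight σc γ n).continuous.measurable
    have := continuousOn_integral_transport hp hhc hc hm (fun R => by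
      obtain ⟨C', hC'⟩ := exists_bound_of_continuous (contDiff_smoothWeight σc γ n).continuous R
      refine ⟨C', fun σ hσ => ?_⟩
      rw [abs_mul]
      exact (mul_le_of_le_one_left (abs_nonneg _) (hdiff n σ)).trans (hC' σ hσ)) hγ.le
    rwa [← funext (hRe n)] at this
  have hlimR : Tendsto (fun n => ∫ t in (0 : ℝ)..T, (R n t + fluidity σc (p t) * h (-(γ * t))))
      atTop (nhds (∫ t in (0 : ℝ)..T, (0 + fluidity σc (p t) * h (-(γ * t))))) := by
    refine intervalIntegral.tendsto_integral_filter_of_dominated_convergence (fun _ => P * C + Q)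
      (Eventually.of_forall fun n => ?_)
      (Eventually.of_forall fun n => ae_of_all _ fun t ht => ?_)
      intervalIntegrable_const (ae_of_all _ fun t ht => (hRlim t (hsub ht)).add_const _)
    · exact ((((hRc n).add hS).mono Icc_subset_Ici_self).aestronglyMeasurable
        measurableSet_Icc).mono_set hsub
    · exact (norm_add_le _ _).trans (add_le_add (hRb n t (hsub ht)) (hQ t (hsub ht)))
  have hlimL := (hlim T ⟨hT, le_rfl⟩).sub (hlim 0 ⟨le_rfl, hT⟩)
  simp only [mul_zero, sub_zero, hid] at hlimL
  simpa only [zero_add] using tendsto_nhds_unique hlimL hlimR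

/-- The representation formula of the solution, multiplied by the weight. -/
theorem ae_mul_expWeight_eq {σc γ : ℝ} (hσc : 0 < σc) (hγ : 0 < γ) {p : ℝ → (ℝ →₁[volume] ℝ)}
    (hp : ContinuousOn p (Ici 0)) (heq : SolvesFokkerPlanck σc (fun _ => γ) p) {T : ℝ}
    (hT : 0 ≤ T) :
    ∀ᵐ σ, p T σ * expWeight σc γ σ = p 0 (σ - γ * T) * expWeight σc γ (σ - γ * T) +
      (Ioo 0 (γ * T)).indicator (fun s => γ⁻¹ * fluidity σc (p (T - s / γ))) σ := by
  have hw := continuous_expWeight σc γ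
  have hγT : 0 ≤ γ * T := by positivity
  have hfl := continuousOn_fluidity hp σc
  have i1 : LocallyIntegrable fun σ => p T σ * expWeight σc γ σ :=
    (L1.integrable_coeFn (p T)).locallyIntegrable.smul_continuous hw
  have hw' : Continuous fun σ => expWeight σc γ (σ - γ * T) := by fun_prop
  have i2 : LocallyIntegrable fun σ => p 0 (σ - γ * T) * expWeight σc γ (σ - γ * T) :=
    ((L1.integrable_coeFn (p 0)).comp_sub_right (γ * T)).locallyIntegrable.smul_continuous hw'
  have hcI : ContinuousOn (fun s => γ⁻¹ * fluidity σc (p (T - s / γ))) (Icc 0 (γ * T)) := by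
    refine continuousOn_const.mul (hfl.comp (Continuous.continuousOn (by fun_prop)) fun s hs => ?_)
    rw [mem_Ici, sub_nonneg, div_le_iff₀ hγ, mul_comm T]
    exact hs.2
  have i3' : IntegrableOn (fun s => γ⁻¹ * fluidity σc (p (T - s / γ))) (Ioo 0 (γ * T)) :=
    hcI.integrableOn_Icc.mono_set Ioo_subset_Icc_self
  have i3 : LocallyIntegrable ((Ioo 0 (γ * T)).indicator
      fun s => γ⁻¹ * fluidity σc (p (T - s / γ))) :=
    (i3'.integrable_indicator measurableSet_Ioo).locallyIntegrable
  refine ae_eq_of_integral_contDiff_smul_eq i1 (i2.add i3) fun φ hφ hφc => ?_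
  have hφ' := hφ.continuous
  -- Shifting the test function by `γ T` makes the profile at the final time equal to `φ`.
  have hsh : ContDiff ℝ (⊤ : ℕ∞) fun x => φ (x + γ * T) :=
    hφ.comp (contDiff_id.add contDiff_const)
  have hshc : HasCompactSupport fun x => φ (x + γ * T) :=
    hφc.comp_homeomorph (Homeomorph.addRight (γ * T))
  have key := transport_expWeight hσc hγ hp heq hsh hshc hT
  simp only [sub_add_cancel] at key
  have e1 : ∫ σ, φ σ • (p T σ * expWeight σc γ σ) = ∫ σ, p T σ * (φ σ * expWeight σc γ σ) := by
    congr 1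
    funext σ
    rw [smul_eq_mul]
    ring
  have e2 : ∫ σ, p 0 σ * (φ (σ + γ * T) * expWeight σc γ σ)
      = ∫ σ, φ σ * (p 0 (σ - γ * T) * expWeight σc γ (σ - γ * T)) := by
    rw [← integral_sub_right_eq_self _ (γ * T)]
    congr 1
    funext σ
    rw [sub_add_cancel]
    ring
  have e3 : ∫ t in (0 : ℝ)..T, fluidity σc (p t) * φ (-(γ * t) + γ * T)
      = ∫ σ, φ σ * (Ioo 0 (γ * T)).indicator
        (fun s => γ⁻¹ * fluidity σc (p (T - s / γ))) σ := by
    have h1 := intervalIntegral.integral_comp_sub_div (a := 0) (b := γ * T)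
      (fun t => fluidity σc (p t) * φ (-(γ * t) + γ * T)) hγ.ne' T
    rw [mul_div_cancel_left₀ _ hγ.ne', sub_self, zero_div, sub_zero] at h1
    have h2 : ∀ σ, φ σ * (Ioo 0 (γ * T)).indicator
        (fun s => γ⁻¹ * fluidity σc (p (T - s / γ))) σ
        = (Ioo 0 (γ * T)).indicator
          (fun s => γ⁻¹ * (fluidity σc (p (T - s / γ)) * φ (-(γ * (T - s / γ)) + γ * T))) σ := by
      intro σ
      by_cases hσ : σ ∈ Ioo 0 (γ * T)
      · rw [indicator_of_mem hσ, indicator_of_mem hσ]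
        have : -(γ * (T - σ / γ)) + γ * T = σ := by
          field_simp
          ring
        rw [this]
        ring
      · rw [indicator_of_notMem hσ, indicator_of_notMem hσ, mul_zero]
    simp only [h2]
    rw [integral_indicator measurableSet_Ioo, integral_const_mul, ← integral_Ioc_eq_integral_Ioo,
      ← intervalIntegral.integral_of_le hγT, h1, smul_eq_mul, inv_mul_cancel_left₀ hγ.ne']
  have j2 : Integrable fun σ => φ σ * (p 0 (σ - γ * T) * expWeight σc γ (σ - γ * T)) :=
    i2.integrable_smul_left_of_hasCompactSupport hφ' hφc
  have j3 : Integrable fun σ => φ σ * (Ioo 0 (γ * T)).indicator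
      (fun s => γ⁻¹ * fluidity σc (p (T - s / γ))) σ :=
    i3.integrable_smul_left_of_hasCompactSupport hφ' hφc
  have e4 : ∫ σ, φ σ • (p 0 (σ - γ * T) * expWeight σc γ (σ - γ * T) +
      (Ioo 0 (γ * T)).indicator (fun s => γ⁻¹ * fluidity σc (p (T - s / γ))) σ)
      = (∫ σ, φ σ * (p 0 (σ - γ * T) * expWeight σc γ (σ - γ * T))) +
        ∫ σ, φ σ * (Ioo 0 (γ * T)).indicator
          (fun s => γ⁻¹ * fluidity σc (p (T - s / γ))) σ := by
    rw [← integral_add j2 j3]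
    congr 1
    funext σ
    rw [smul_eq_mul, mul_add]
  rw [e1]
  refine Eq.trans ?_ e4.symm
  rw [← e2, ← e3]
  linarith

/-! ### Conservation of mass -/

/-- Conservation of mass. -/
theorem integral_eq_integral_zero {σc γ : ℝ} (hγ : 0 < γ) {p : ℝ → (ℝ →₁[volume] ℝ)}
    (hp : ContinuousOn p (Ici 0)) (heq : SolvesFokkerPlanck σc (fun _ => γ) p) {T : ℝ}
    (hT : 0 ≤ T) : ∫ σ, p T σ = ∫ σ, p 0 σ := by
  let h : ℕ → ContDiffBump (0 : ℝ) := fun n => ⟨n + 1, n + 2, by positivity, by linarith⟩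
  have hle : ∀ n x, |h n x| ≤ 1 := fun n x => by
    rw [abs_of_nonneg (h n).nonneg]
    exact (h n).le_one
  have hlim1 : ∀ x, Tendsto (fun n => h n x) atTop (nhds 1) := by
    intro x
    refine tendsto_const_nhds.congr' ?_
    filter_upwards [tendsto_natCast_atTop_atTop.eventually_ge_atTop |x|] with n hn
    refine ((h n).one_of_mem_closedBall ?_).symm
    rw [mem_closedBall_zero_iff, Real.norm_eq_abs]
    exact hn.trans (by simp [h])
  have hlim : ∀ (g : ℝ → ℝ), Integrable g → ∀ c,
      Tendsto (fun n => ∫ σ, g σ * h n (σ - c)) atTop (nhds (∫ σ, g σ)) := by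
    intro g hg c
    refine tendsto_integral_filter_of_dominated_convergence (fun σ => |g σ|)
      (Eventually.of_forall fun n => hg.aestronglyMeasurable.mul
        ((h n).continuous.comp (by fun_prop)).aestronglyMeasurable)
      (Eventually.of_forall fun n => ae_of_all _ fun σ => ?_) hg.abs (ae_of_all _ fun σ => ?_)
    · rw [Real.norm_eq_abs, abs_mul]
      exact mul_le_of_le_one_right (abs_nonneg _) (hle n _)
    · simpa using (hlim1 (σ - c)).const_mul (g σ)
  have hχp : ∀ t, Integrable fun σ => chi σc σ * p t σ := fun t => by
    simpa only [mul_comm] using integrable_mul_of_abs_le (L1.integrable_coeFn (p t))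
      (measurable_chi σc).aestronglyMeasurable (abs_chi_le_one σc)
  set S : ℕ → ℝ → ℝ := fun n t => -(∫ σ, chi σc σ * p t σ * h n (σ - γ * t)) +
    fluidity σc (p t) * h n (-(γ * t)) with hS
  have hid : ∀ n, (∫ σ, p T σ * h n (σ - γ * T)) - ∫ σ, p 0 σ * h n (σ - 0)
      = ∫ t in (0 : ℝ)..T, S n t := by
    intro n
    -- With the multiplier `1` only the sink and the source remain. Once the cutoffs tend to `1`,
    -- they cancel.
    have := transport_identity (E := fun _ => 1) hγ.le hp heq (h n).contDiff (h n).hasCompactSupport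
      contDiff_const hT
    simp only [mul_one, deriv_const, mul_zero, zero_sub] at this
    simp only [sub_zero]
    rw [this]
    congr 1
    funext t
    simp only [hS]
    rw [← integral_neg]
    congr 2
    funext σ
    ring
  obtain ⟨P, hP⟩ := (isCompact_Icc (a := 0) (b := T)).exists_bound_of_continuousOn
    (hp.mono Icc_subset_Ici_self)
  have hsub : uIoc 0 T ⊆ Icc 0 T := by
    rw [uIoc_of_le hT]
    exact Ioc_subset_Icc_self
  have hχn : ∀ t ∈ Icc 0 T, ∫ σ, |chi σc σ * p t σ| ≤ P := by
    intro t ht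
    refine le_trans ?_ (hP t ht)
    rw [L1_norm_eq]
    refine integral_mono (hχp t).abs (L1.integrable_coeFn (p t)).abs fun σ => ?_
    simp only [abs_mul]
    exact mul_le_of_le_one_left (abs_nonneg _) (abs_chi_le_one σc σ)
  have hlimS : Tendsto (fun n => ∫ t in (0 : ℝ)..T, S n t) atTop
      (nhds (∫ t in (0 : ℝ)..T, (-(fluidity σc (p t)) + fluidity σc (p t) * 1))) := by
    refine intervalIntegral.tendsto_integral_filter_of_dominated_convergence (fun _ => P + P)
      (Eventually.of_forall fun n => ?_)
      (Eventually.of_forall fun n => ae_of_all _ fun t ht => ?_)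
      intervalIntegrable_const (ae_of_all _ fun t ht => ?_)
    · have c1 : ContinuousOn (fun t => ∫ σ, p t σ * (h n (σ - γ * t) * chi σc σ)) (Ici 0) :=
        continuousOn_integral_transport hp (h n).continuous (h n).hasCompactSupport
          (measurable_chi σc) (fun R => ⟨1, fun σ _ => abs_chi_le_one σc σ⟩) hγ.le
      have c2 : ContinuousOn (S n) (Ici 0) := by
        refine ContinuousOn.add ?_ ((continuousOn_fluidity hp σc).mul
          (Continuous.continuousOn ((h n).continuous.comp (by fun_prop))))
        refine (c1.congr fun t _ => ?_).neg
        congr 1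
        funext σ
        ring
      exact ((c2.mono Icc_subset_Ici_self).aestronglyMeasurable measurableSet_Icc).mono_set hsub
    · refine (norm_add_le _ _).trans (add_le_add ?_ ?_)
      · rw [norm_neg]
        refine (norm_integral_le_of_norm_le (hχp t).abs (ae_of_all _ fun σ => ?_)).trans
          (hχn t (hsub ht))
        rw [Real.norm_eq_abs, abs_mul]
        exact mul_le_of_le_one_right (abs_nonneg _) (hle n _)
      · rw [norm_mul]
        refine (mul_le_of_le_one_right (norm_nonneg _) (hle n _)).trans ?_
        exact (norm_integral_le_integral_norm _).trans (hχn t (hsub ht))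
    · exact (hlim _ (hχp t) _).neg.add ((hlim1 _).const_mul _)
  have hL := (hlim _ (L1.integrable_coeFn (p T)) (γ * T)).sub
    (hlim _ (L1.integrable_coeFn (p 0)) 0)
  simp only [hid] at hL
  have := tendsto_nhds_unique hL hlimS
  simp only [mul_one, neg_add_cancel, intervalIntegral.integral_zero] at this
  linarith

/-! ### Initial and emitted parts; the renewal system of the fluidity -/

/-- The exponent of the weight differs from `σ / γ` by at most `σc / γ`. Hence the factor `exp (2
ω)` in all remainders. -/
theorem expWeight_div_le {σc γ : ℝ} (hσc : 0 < σc) (hγ : 0 < γ) (T σ : ℝ) :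
    expWeight σc γ (σ - γ * T) / expWeight σc γ σ ≤ Real.exp (2 * (σc / γ)) * Real.exp (-T) := by
  unfold expWeight
  rw [← Real.exp_sub, ← Real.exp_add]
  refine Real.exp_le_exp.2 ?_
  have h1 : -σc ≤ max (-σc) (min σc (σ - γ * T)) := le_max_left _ _
  have h2 : max (-σc) (min σc σ) ≤ σc := max_le (by linarith) (min_le_left _ _)
  rw [← sub_div, div_le_iff₀ hγ]
  have : (2 * (σc / γ) + -T) * γ = 2 * σc - γ * T := by
    field_simp
    ring
  rw [this]
  linarith

theorem expWeight_of_le {σc γ σ : ℝ} (h0 : 0 ≤ σ) (h : σ ≤ σc) : expWeight σc γ σ = 1 := by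
  rw [expWeight, min_eq_right h, max_eq_right (by linarith), sub_self, zero_div, Real.exp_zero]

theorem expWeight_of_ge {σc γ σ : ℝ} (h0 : 0 ≤ σc) (h : σc ≤ σ) :
    expWeight σc γ σ = Real.exp ((σ - σc) / γ) := by
  rw [expWeight, min_eq_left h, max_eq_right (by linarith)]

/-- The contribution of the initial datum to the solution. -/
noncomputable def transported (σc γ : ℝ) (p₀ : ℝ → ℝ) (T σ : ℝ) : ℝ :=
  p₀ (σ - γ * T) * (expWeight σc γ (σ - γ * T) / expWeight σc γ σ)

/-- The contribution of the source to the solution. -/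
noncomputable def emitted (σc γ : ℝ) (f : ℝ → ℝ) (T σ : ℝ) : ℝ :=
  (Ioo 0 (γ * T)).indicator (fun s => γ⁻¹ * f (T - s / γ) / expWeight σc γ s) σ

theorem ae_eq_transported_add_emitted {σc γ : ℝ} (hσc : 0 < σc) (hγ : 0 < γ)
    {p : ℝ → (ℝ →₁[volume] ℝ)} (hp : ContinuousOn p (Ici 0))
    (heq : SolvesFokkerPlanck σc (fun _ => γ) p) {T : ℝ} (hT : 0 ≤ T) :
    ∀ᵐ σ, p T σ = transported σc γ (p 0) T σ + emitted σc γ (fun t => fluidity σc (p t)) T σ := by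
  filter_upwards [ae_mul_expWeight_eq hσc hγ hp heq hT] with σ hσ
  have hw := (expWeight_pos σc γ σ).ne'
  rw [← mul_div_cancel_right₀ (p T σ) hw, hσ, add_div, transported, emitted, mul_div_assoc]
  congr 1
  by_cases h : σ ∈ Ioo 0 (γ * T)
  · rw [indicator_of_mem h, indicator_of_mem h]
  · rw [indicator_of_notMem h, indicator_of_notMem h, zero_div]

theorem abs_transported_le {σc γ : ℝ} (hσc : 0 < σc) (hγ : 0 < γ) (p₀ : ℝ → ℝ) (T σ : ℝ) :
    |transported σc γ p₀ T σ| ≤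
      Real.exp (2 * (σc / γ)) * Real.exp (-T) * |p₀ (σ - γ * T)| := by
  have h := expWeight_div_le hσc hγ T σ
  have h0 : 0 < expWeight σc γ (σ - γ * T) / expWeight σc γ σ :=
    div_pos (expWeight_pos _ _ _) (expWeight_pos _ _ _)
  rw [transported, abs_mul, abs_of_pos h0, mul_comm]
  gcongr

theorem integrable_transported {σc γ : ℝ} (hσc : 0 < σc) (hγ : 0 < γ) {p₀ : ℝ → ℝ}
    (hp₀ : Integrable p₀) (T : ℝ) : Integrable (transported σc γ p₀ T) := by
  have hw := continuous_expWeight σc γ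
  refine integrable_mul_of_abs_le (C := Real.exp (2 * (σc / γ)) * Real.exp (-T))
    (hp₀.comp_sub_right (γ * T)) (Continuous.aestronglyMeasurable ?_) fun σ => ?_
  · exact (hw.comp (by fun_prop)).div hw fun σ => (expWeight_pos σc γ σ).ne'
  · rw [abs_of_pos (div_pos (expWeight_pos _ _ _) (expWeight_pos _ _ _))]
    exact expWeight_div_le hσc hγ T σ

theorem integral_abs_transported_le {σc γ : ℝ} (hσc : 0 < σc) (hγ : 0 < γ) {p₀ : ℝ → ℝ}
    (hp₀ : Integrable p₀) (T : ℝ) : ∫ σ, |transported σc γ p₀ T σ| ≤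
      Real.exp (2 * (σc / γ)) * Real.exp (-T) * ∫ σ, |p₀ σ| := by
  have h : Integrable fun σ => |p₀ (σ - γ * T)| := (hp₀.comp_sub_right (γ * T)).abs
  rw [← integral_sub_right_eq_self (fun σ => |p₀ σ|) (γ * T), ← integral_const_mul]
  exact integral_mono (integrable_transported hσc hγ hp₀ T).abs (h.const_mul _)
    fun σ => abs_transported_le hσc hγ p₀ T σ

theorem emitted_congr {σc γ : ℝ} (hγ : 0 < γ) {f g : ℝ → ℝ} (h : ∀ t ≥ 0, f t = g t) (T : ℝ) :
    emitted σc γ f T = emitted σc γ g T := by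
  funext σ
  unfold emitted
  by_cases hσ : σ ∈ Ioo 0 (γ * T)
  · rw [indicator_of_mem hσ, indicator_of_mem hσ, h]
    rw [ge_iff_le, sub_nonneg, div_le_iff₀ hγ, mul_comm T]
    exact hσ.2.le
  · rw [indicator_of_notMem hσ, indicator_of_notMem hσ]

theorem integrable_emitted (σc γ : ℝ) {f : ℝ → ℝ} (hf : Continuous f) (T : ℝ) :
    Integrable (emitted σc γ f T) := by
  have hw := continuous_expWeight σc γ
  have hc : Continuous fun s => γ⁻¹ * f (T - s / γ) / expWeight σc γ s :=
    (continuous_const.mul (hf.comp (by fun_prop))).div hw fun σ => (expWeight_pos σc γ σ).ne'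
  exact (hc.continuousOn.integrableOn_Icc.mono_set Ioo_subset_Icc_self).integrable_indicator
    measurableSet_Ioo

/-- Substitute the emission time `s = T - σ / γ`. Mass emitted within the last `ω` units of time has
weight `1`; older mass has decayed by `exp (-(T - ω - s))`. Taking `c = 0` gives the fluidity, `c =
1` the total mass. -/
theorem integral_mul_emitted {σc γ : ℝ} (hσc : 0 < σc) (hγ : 0 < γ) {f : ℝ → ℝ}
    (hf : Continuous f) {T : ℝ} (hT : 0 ≤ T) {G : ℝ → ℝ} {c : ℝ} (h1 : ∀ σ, σc < σ → G σ = 1)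
    (hc : ∀ σ, 0 < σ → σ < σc → G σ = c) :
    ∫ σ, G σ * emitted σc γ f T σ = expConv f (max (T - σc / γ) 0) +
      c * ∫ s in (max (T - σc / γ) 0)..T, f s := by
  have hγT : 0 ≤ γ * T := by positivity
  set m := max (T - σc / γ) 0 with hm
  have hm0 : 0 ≤ m := le_max_right _ _
  have hmT : m ≤ T := max_le (by linarith [div_pos hσc hγ]) hT
  set u : ℝ → ℝ := fun s => G (γ * (T - s)) * (f s / expWeight σc γ (γ * (T - s))) with hu
  have e1 : ∫ σ, G σ * emitted σc γ f T σ = ∫ s in (0 : ℝ)..T, u s := by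
    have h2 := intervalIntegral.integral_comp_sub_div (a := 0) (b := γ * T) u hγ.ne' T
    rw [mul_div_cancel_left₀ _ hγ.ne', sub_self, zero_div, sub_zero] at h2
    have h3 : ∀ σ, G σ * emitted σc γ f T σ
        = (Ioo 0 (γ * T)).indicator (fun s => γ⁻¹ * u (T - s / γ)) σ := by
      intro σ
      unfold emitted
      by_cases hσ : σ ∈ Ioo 0 (γ * T)
      · rw [indicator_of_mem hσ, indicator_of_mem hσ]
        have : γ * (T - (T - σ / γ)) = σ := by
          field_simp
          ring
        simp only [hu]
        rw [this]
        ring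
      · rw [indicator_of_notMem hσ, indicator_of_notMem hσ, mul_zero]
    simp only [h3]
    rw [integral_indicator measurableSet_Ioo, integral_const_mul, ← integral_Ioc_eq_integral_Ioo,
      ← intervalIntegral.integral_of_le hγT, h2, smul_eq_mul, inv_mul_cancel_left₀ hγ.ne']
  have hu1 : EqOn (fun s => Real.exp (-(m - s)) * f s) u (uIoo 0 m) := by
    intro s hs
    rw [uIoo_of_le hm0] at hs
    -- When `T ≤ ω` the interval `(0, m)` is empty, so in its presence the maximum is `T - ω`.
    have hmT' : m = T - σc / γ := by
      rcases max_choice (T - σc / γ) 0 with h | h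
      · rw [hm, h]
      · rw [← hm] at h
        rw [h] at hs
        exact absurd (hs.1.trans hs.2) (lt_irrefl _)
    have h4 : σc < γ * (T - s) := by
      have := hs.2
      rw [hmT', lt_sub_comm, div_lt_iff₀ hγ] at this
      linarith
    simp only [hu]
    rw [h1 _ h4, expWeight_of_ge hσc.le h4.le, one_mul, div_eq_mul_inv, ← Real.exp_neg, mul_comm]
    congr 2
    rw [hmT']
    field_simp
    ring
  have hu2 : EqOn (fun s => c * f s) u (uIoo m T) := by
    intro s hs
    rw [uIoo_of_le hmT] at hs
    have h4 : γ * (T - s) < σc := by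
      have : T - σc / γ < s := (le_max_left _ _).trans_lt hs.1
      rw [sub_lt_comm, lt_div_iff₀ hγ] at this
      linarith
    have h5 : 0 < γ * (T - s) := mul_pos hγ (by linarith [hs.2])
    simp only [hu]
    rw [hc _ h5 h4, expWeight_of_le h5.le h4.le, div_one]
  have c1 : Continuous fun s => Real.exp (-(m - s)) * f s := by fun_prop
  have c2 : Continuous fun s => c * f s := by fun_prop
  rw [e1, ← intervalIntegral.integral_add_adjacent_intervals
    ((c1.intervalIntegrable 0 m).congr_uIoo hu1) ((c2.intervalIntegrable m T).congr_uIoo hu2),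
    ← intervalIntegral.integral_congr_uIoo hu1, ← intervalIntegral.integral_congr_uIoo hu2,
    intervalIntegral.integral_const_mul]
  rfl

theorem chi_of_gt {σc σ : ℝ} (h : σc < σ) : chi σc σ = 1 := chi_of_lt_abs (h.trans_le (le_abs_self σ))

/-- The fluidity of a solution, extended by a constant to negative times, solves the renewal
system. -/
theorem renewalSystem_fluidity {σc γ : ℝ} (hσc : 0 < σc) (hγ : 0 < γ)
    {p : ℝ → (ℝ →₁[volume] ℝ)} (hp : ContinuousOn p (Ici 0))
    (heq : SolvesFokkerPlanck σc (fun _ => γ) p) (h1 : ∫ σ, p 0 σ = 1) (habs : ∫ σ, |p 0 σ| ≤ 1) :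
    RenewalSystem (σc / γ) fun t => fluidity σc (p (max t 0)) := by
  have hf : Continuous fun t => fluidity σc (p (max t 0)) :=
    (continuousOn_fluidity hp σc).comp_continuous (by fun_prop) fun t => le_max_right t 0
  have hq : ∀ T, ∫ σ, |transported σc γ (p 0) T σ| ≤ Real.exp (2 * (σc / γ)) * Real.exp (-T) :=
    fun T => (integral_abs_transported_le hσc hγ (L1.integrable_coeFn (p 0)) T).trans
      (mul_le_of_le_one_right (by positivity) habs)
  have hform : ∀ T ≥ 0, ∀ᵐ σ, p T σ = transported σc γ (p 0) T σ +
      emitted σc γ (fun t => fluidity σc (p (max t 0))) T σ := by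
    intro T hT
    have := ae_eq_transported_add_emitted hσc hγ hp heq hT
    rwa [emitted_congr hγ (g := fun t => fluidity σc (p (max t 0))) fun t ht => by
      simp only [max_eq_left ht]] at this
  have hqi := fun T => integrable_transported (σc := σc) (T := T) hσc hγ (L1.integrable_coeFn (p 0))
  have hri := fun T => integrable_emitted σc γ hf T
  have hχq := fun T => integrable_mul_of_abs_le (hqi T) (measurable_chi σc).aestronglyMeasurable
    (abs_chi_le_one σc)
  have hχr := fun T => integrable_mul_of_abs_le (hri T) (measurable_chi σc).aestronglyMeasurable
    (abs_chi_le_one σc)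
  refine ⟨hf, fun T hT => ?_, fun T hT => ?_⟩
  · have e1 : fluidity σc (p T) = (∫ σ, transported σc γ (p 0) T σ * chi σc σ) +
        ∫ σ, emitted σc γ (fun t => fluidity σc (p (max t 0))) T σ * chi σc σ := by
      rw [← integral_add (hχq T) (hχr T)]
      refine integral_congr_ae ?_
      filter_upwards [hform T hT] with σ hσ
      rw [hσ]
      ring
    have e2 := integral_mul_emitted hσc hγ hf hT (G := chi σc) (c := 0) (fun σ => chi_of_gt)
      fun σ h0 h => chi_of_abs_le (by rw [abs_of_pos h0]; exact h.le)
    rw [zero_mul, add_zero] at e2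
    simp only [mul_comm (chi σc _)] at e2
    rw [max_eq_left hT, e1, e2, add_sub_cancel_right]
    refine abs_integral_le_integral_abs.trans
      ((integral_mono (hχq T).abs (hqi T).abs fun σ => ?_).trans (hq T))
    simp only [abs_mul]
    exact mul_le_of_le_one_right (abs_nonneg _) (abs_chi_le_one σc σ)
  · have e1 : (1 : ℝ) = (∫ σ, transported σc γ (p 0) T σ) +
        ∫ σ, emitted σc γ (fun t => fluidity σc (p (max t 0))) T σ := by
      rw [← integral_add (hqi T) (hri T), ← h1, ← integral_eq_integral_zero hγ hp heq hT]
      exact integral_congr_ae (hform T hT)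
    have e2 := integral_mul_emitted hσc hγ hf hT (G := fun _ => 1) (c := 1) (fun _ _ => rfl)
      fun _ _ _ => rfl
    simp only [one_mul] at e2
    have e3 : 1 - expConv (fun t => fluidity σc (p (max t 0))) (max (T - σc / γ) 0)
        - ∫ s in (max (T - σc / γ) 0)..T, fluidity σc (p (max s 0))
        = ∫ σ, transported σc γ (p 0) T σ := by linarith
    rw [e3]
    exact abs_integral_le_integral_abs.trans (hq T)

/-! ### The stationary state -/

theorem integrable_prod_mul {g : ℝ → ℝ} (hg : Integrable g) {ψ : ℝ × ℝ → ℝ} (hψ : Continuous ψ)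
    (hc : HasCompactSupport ψ) :
    Integrable (Function.uncurry fun t σ => g σ * ψ (t, σ)) (volume.prod volume) := by
  obtain ⟨R, hR⟩ := hc.isCompact.isBounded.subset_closedBall 0
  obtain ⟨M, hM⟩ := hψ.bounded_above_of_compact_support hc
  have h1 : Integrable ((Icc (-R) R).indicator fun _ => M) :=
    (integrableOn_const (by simp)).integrable_indicator measurableSet_Icc
  refine (h1.mul_prod hg.abs).mono' ?_ (ae_of_all _ fun q => ?_)
  · exact (hg.aestronglyMeasurable.comp_snd).mul hψ.aestronglyMeasurable
  · rw [Function.uncurry_apply_pair, norm_mul, mul_comm, Real.norm_eq_abs (g q.2)]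
    gcongr
    by_cases hq : q ∈ tsupport ψ
    · have h2 := hR hq
      rw [mem_closedBall_zero_iff] at h2
      have h3 := (norm_fst_le q).trans h2
      rw [Real.norm_eq_abs, abs_le] at h3
      rw [indicator_of_mem (show q.1 ∈ Icc (-R) R from h3)]
      exact hM q
    · have : ψ (q.1, q.2) = 0 := image_eq_zero_of_notMem_tsupport hq
      rw [this, norm_zero]
      exact indicator_nonneg (fun _ _ => (norm_nonneg _).trans (hM 0)) _

/-- A stationary state is a solution that is constant in time. -/
theorem solvesFokkerPlanck_const {σc γ : ℝ} {g : ℝ →₁[volume] ℝ}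
    (hst : ∀ φ : ℝ → ℝ, ContDiff ℝ (⊤ : ℕ∞) φ → HasCompactSupport φ →
      -(γ * ∫ σ, g σ * deriv φ σ) = -(∫ σ, chi σc σ * g σ * φ σ) + fluidity σc g * φ 0) :
    SolvesFokkerPlanck σc (fun _ => γ) fun _ => g := by
  intro ψ hψ hc hs
  have hψc := hψ.continuous
  have hg := L1.integrable_coeFn g
  have hχg : Integrable fun σ => chi σc σ * g σ := by
    simpa only [mul_comm] using integrable_mul_of_abs_le hg
      (measurable_chi σc).aestronglyMeasurable (abs_chi_le_one σc)
  have hdiff : ∀ q, HasFDerivAt ψ (fderiv ℝ ψ q) q := fun q =>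
    (hψ.differentiable (by simp)).differentiableAt.hasFDerivAt
  have hcf : Continuous (fderiv ℝ ψ) := hψ.continuous_fderiv (by simp)
  have hd1 : ∀ t σ, HasDerivAt (fun s => ψ (s, σ)) (fderiv ℝ ψ (t, σ) (1, 0)) t := fun t σ =>
    (hdiff (t, σ)).comp_hasDerivAt t ((hasDerivAt_id t).prodMk (hasDerivAt_const t σ))
  have hd2 : ∀ t σ, HasDerivAt (fun s => ψ (t, s)) (fderiv ℝ ψ (t, σ) (0, 1)) σ := fun t σ =>
    (hdiff (t, σ)).comp_hasDerivAt σ ((hasDerivAt_const σ t).prodMk (hasDerivAt_id σ))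
  have hc1 : Continuous fun q => fderiv ℝ ψ q (1, 0) := by fun_prop
  have hc2 : Continuous fun q => fderiv ℝ ψ q (0, 1) := by fun_prop
  have hs1 : HasCompactSupport fun q => fderiv ℝ ψ q (1, 0) := hc.fderiv_apply ℝ (1, 0)
  have hs2 : HasCompactSupport fun q => fderiv ℝ ψ q (0, 1) := hc.fderiv_apply ℝ (0, 1)
  obtain ⟨R, hR⟩ := hc.isCompact.isBounded.subset_closedBall 0
  have hsupp : ∀ t σ, ψ (t, σ) ≠ 0 → |t| ≤ R ∧ |σ| ≤ R := fun t σ h => by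
    have h2 := hR (subset_tsupport _ h)
    rw [mem_closedBall_zero_iff] at h2
    exact ⟨(norm_fst_le (t, σ)).trans h2, (norm_snd_le (t, σ)).trans h2⟩
  have hslice1 : ∀ σ, HasCompactSupport fun t => ψ (t, σ) := fun σ =>
    HasCompactSupport.of_support_subset_isCompact (isCompact_closedBall (0 : ℝ) R) fun t ht => by
      rw [mem_closedBall_zero_iff]
      exact (hsupp t σ ht).1
  have hslice2 : ∀ t, HasCompactSupport fun σ => ψ (t, σ) := fun t =>
    HasCompactSupport.of_support_subset_isCompact (isCompact_closedBall (0 : ℝ) R) fun σ hσ => by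
      rw [mem_closedBall_zero_iff]
      exact (hsupp t σ hσ).2
  have hpos : ∀ t, t ∉ Ioi (0 : ℝ) → ∀ σ, (t, σ) ∉ tsupport ψ := fun t ht σ h => ht (hs h).1
  have hz : ∀ t, t ∉ Ioi (0 : ℝ) → ∀ σ, ψ (t, σ) = 0 := fun t ht σ =>
    image_eq_zero_of_notMem_tsupport (hpos t ht σ)
  have hfz : ∀ t, t ∉ Ioi (0 : ℝ) → ∀ σ, fderiv ℝ ψ (t, σ) = 0 := fun t ht σ =>
    image_eq_zero_of_notMem_tsupport fun h => hpos t ht σ (tsupport_fderiv_subset ℝ h)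
  simp only [fun t σ => (hd1 t σ).deriv, fun t σ => (hd2 t σ).deriv]
  have j1 := integrable_prod_mul hg hc1 hs1
  have j2 := integrable_prod_mul hg hc2 hs2
  have j3 := integrable_prod_mul hχg hψc hc
  have i1 : ∀ t, Integrable fun σ => g σ * fderiv ℝ ψ (t, σ) (1, 0) := fun t => by
    obtain ⟨C, hC⟩ := hc1.bounded_above_of_compact_support hs1
    exact integrable_mul_of_abs_le hg (hc1.comp (by fun_prop)).aestronglyMeasurable
      fun σ => hC (t, σ)
  have i2 : ∀ t, Integrable fun σ => g σ * fderiv ℝ ψ (t, σ) (0, 1) := fun t => by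
    obtain ⟨C, hC⟩ := hc2.bounded_above_of_compact_support hs2
    exact integrable_mul_of_abs_le hg (hc2.comp (by fun_prop)).aestronglyMeasurable
      fun σ => hC (t, σ)
  rw [setIntegral_eq_integral_of_forall_compl_eq_zero (fun t ht => by simp [hfz t ht]),
    setIntegral_eq_integral_of_forall_compl_eq_zero (fun t ht => by simp [hz t ht]),
    setIntegral_eq_integral_of_forall_compl_eq_zero (fun t ht => by simp [hz t ht])]
  have e1 : ∀ t, ∫ σ, g σ * (fderiv ℝ ψ (t, σ) (1, 0) + γ * fderiv ℝ ψ (t, σ) (0, 1))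
      = (∫ σ, g σ * fderiv ℝ ψ (t, σ) (1, 0)) +
        ((∫ σ, chi σc σ * g σ * ψ (t, σ)) - fluidity σc g * ψ (t, 0)) := by
    intro t
    have h1 := hst (fun σ => ψ (t, σ)) (hψ.comp (contDiff_const.prodMk contDiff_id)) (hslice2 t)
    simp only [fun σ => (hd2 t σ).deriv] at h1
    have h2 : (∫ σ, chi σc σ * g σ * ψ (t, σ)) - fluidity σc g * ψ (t, 0)
        = ∫ σ, γ * (g σ * fderiv ℝ ψ (t, σ) (0, 1)) := by
      rw [integral_const_mul]
      linarith
    rw [h2, ← integral_add (i1 t) ((i2 t).const_mul γ)]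
    congr 1
    funext σ
    ring
  -- For a density independent of time, Fubini turns the time derivative term into integrals of
  -- derivatives of compactly supported functions.
  have e2 : ∫ t, ∫ σ, g σ * fderiv ℝ ψ (t, σ) (1, 0) = 0 := by
    rw [integral_integral_swap j1]
    have : ∀ σ, ∫ t, g σ * fderiv ℝ ψ (t, σ) (1, 0) = 0 := by
      intro σ
      rw [integral_const_mul]
      have hci : Continuous fun t => fderiv ℝ ψ (t, σ) (1, 0) := hc1.comp (by fun_prop)
      have hcs : HasCompactSupport fun t => fderiv ℝ ψ (t, σ) (1, 0) := by
        have := (hslice1 σ).deriv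
        rwa [funext fun t => (hd1 t σ).deriv] at this
      rw [integral_eq_zero_of_hasDerivAt_of_integrable (fun t => hd1 t σ)
        (hci.integrable_of_hasCompactSupport hcs)
        ((hψc.comp (by fun_prop)).integrable_of_hasCompactSupport (hslice1 σ)), mul_zero]
    simp only [this, integral_zero]
  have k1 : Integrable fun t => ∫ σ, g σ * fderiv ℝ ψ (t, σ) (1, 0) := j1.integral_prod_left
  have k2 : Integrable fun t => ∫ σ, chi σc σ * g σ * ψ (t, σ) := j3.integral_prod_left
  have k3 : Integrable fun t => fluidity σc g * ψ (t, 0) :=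
    ((hψc.comp (by fun_prop)).integrable_of_hasCompactSupport (hslice1 0)).const_mul _
  have k23 : Integrable fun t => (∫ σ, chi σc σ * g σ * ψ (t, σ)) - fluidity σc g * ψ (t, 0) :=
    k2.sub k3
  simp only [e1]
  rw [integral_add k1 k23, e2, integral_sub k2 k3]
  ring

theorem expConv_const (c m : ℝ) : expConv (fun _ => c) m = c * (1 - Real.exp (-m)) := by
  have hd : ∀ s ∈ uIcc 0 m, HasDerivAt (fun s => c * Real.exp (-(m - s)))
      (Real.exp (-(m - s)) * c) s := fun s _ => by
    have h1 : HasDerivAt (fun s : ℝ => -(m - s)) 1 s :=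
      ((hasDerivAt_id s).const_sub m).neg.congr_deriv (neg_neg 1)
    refine (h1.exp.const_mul c).congr_deriv ?_
    ring
  rw [expConv, intervalIntegral.integral_eq_sub_of_hasDerivAt hd
    (Continuous.intervalIntegrable (by fun_prop) _ _)]
  simp
  ring

/-- For constant `f = c` the mass identity reads `1 - c (1 + ω) = O(exp (-t))`, and the left side
does not depend on `t`. -/
theorem eq_of_renewalSystem_const {ω c : ℝ} (hω : 0 < ω) (h : RenewalSystem ω fun _ => c) :
    c = 1 / (1 + ω) := by
  have hb : ∀ t ≥ ω, |1 - c * (1 + ω)| ≤ (Real.exp (2 * ω) + |c| * Real.exp ω) * Real.exp (-t) := by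
    intro t ht
    have h1 := h.mass t (hω.le.trans ht)
    rw [max_eq_left (sub_nonneg.2 ht), expConv_const, intervalIntegral.integral_const,
      smul_eq_mul] at h1
    have e : 1 - c * (1 + ω) = (1 - c * (1 - Real.exp (-(t - ω))) - (t - (t - ω)) * c) +
        -(c * (Real.exp ω * Real.exp (-t))) := by
      rw [← Real.exp_add]
      ring_nf
    rw [e]
    refine (abs_add_le _ _).trans ?_
    rw [abs_neg, abs_mul c, abs_of_pos (mul_pos (Real.exp_pos ω) (Real.exp_pos (-t)))]
    linarith
  have hlim : Tendsto (fun t => (Real.exp (2 * ω) + |c| * Real.exp ω) * Real.exp (-t)) atTop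
      (nhds 0) := by
    simpa using (Real.tendsto_exp_neg_atTop_nhds_zero.const_mul
      (Real.exp (2 * ω) + |c| * Real.exp ω))
  have h0 : |1 - c * (1 + ω)| ≤ 0 :=
    ge_of_tendsto hlim (by filter_upwards [eventually_ge_atTop ω] with t ht using hb t ht)
  have h1 := abs_nonpos_iff.1 h0
  rw [eq_div_iff (by positivity)]
  linarith

/-- The stationary density with fluidity `F`. -/
noncomputable def stationaryDensity (σc γ F σ : ℝ) : ℝ :=
  (Ioi 0).indicator (fun s => γ⁻¹ * F / expWeight σc γ s) σ

theorem exp_div_le_expWeight {σc γ : ℝ} (hσc : 0 < σc) (hγ : 0 < γ) (σ : ℝ) :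
    Real.exp ((σ - σc) / γ) ≤ expWeight σc γ σ := by
  unfold expWeight
  gcongr
  exact max_le (by linarith) (min_le_left _ _)

theorem one_le_expWeight {σc γ σ : ℝ} (hσc : 0 < σc) (hγ : 0 < γ) (hσ : 0 ≤ σ) :
    1 ≤ expWeight σc γ σ := by
  refine Real.one_le_exp (div_nonneg ?_ hγ.le)
  rw [sub_nonneg]
  exact max_le (by linarith) (min_le_right _ _)

theorem stationaryState_toL1 {σc γ : ℝ} (hσc : 0 < σc) (hγ : 0 < γ) {pinf : ℝ → ℝ}
    (h : IsStationaryState σc γ pinf) :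
    fluidity σc pinf = 1 / (1 + σc / γ) ∧
      ∀ T ≥ 0, ∀ᵐ σ, pinf σ = transported σc γ pinf T σ +
        emitted σc γ (fun _ => fluidity σc pinf) T σ := by
  set g : ℝ →₁[volume] ℝ := h.integrable.toL1 pinf with hg
  have hae : g =ᵐ[volume] pinf := h.integrable.coeFn_toL1
  have hfl : fluidity σc g = fluidity σc pinf := by
    refine integral_congr_ae ?_
    filter_upwards [hae] with σ hσ
    rw [hσ]
  have hsol : SolvesFokkerPlanck σc (fun _ => γ) fun _ => g := by
    refine solvesFokkerPlanck_const fun φ hφ hc => ?_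
    have e1 : ∫ σ, g σ * deriv φ σ = ∫ σ, pinf σ * deriv φ σ := by
      refine integral_congr_ae ?_
      filter_upwards [hae] with σ hσ
      rw [hσ]
    have e2 : ∫ σ, chi σc σ * g σ * φ σ = ∫ σ, chi σc σ * pinf σ * φ σ := by
      refine integral_congr_ae ?_
      filter_upwards [hae] with σ hσ
      rw [hσ]
    rw [e1, e2, hfl]
    exact h.equation φ hφ hc
  have hint : ∫ σ, g σ = 1 := (integral_congr_ae hae).trans h.integral_eq_one
  have habs : ∫ σ, |g σ| ≤ 1 := by
    rw [← hint]
    refine (integral_congr_ae ?_).le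
    filter_upwards [hae, h.nonneg] with σ h1 h2
    rw [abs_of_nonneg]
    rw [h1]
    exact h2
  have hren := renewalSystem_fluidity hσc hγ (p := fun _ => g) continuousOn_const hsol hint habs
  refine ⟨hfl ▸ eq_of_renewalSystem_const (div_pos hσc hγ) hren, fun T hT => ?_⟩
  have hf := ae_eq_transported_add_emitted hσc hγ (p := fun _ => g) continuousOn_const hsol hT
  have hshift : ∀ᵐ σ, g (σ - γ * T) = pinf (σ - γ * T) :=
    (measurePreserving_sub_right volume (γ * T)).quasiMeasurePreserving.ae hae
  filter_upwards [hf, hae, hshift] with σ h1 h2 h3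
  rw [← h2, h1, hfl, transported, transported, h3]

/-- In the representation formula the damped initial part tends to `0` in `L¹` as `T → ∞`, while on
each half-line `σ < γ k` the emitted part no longer depends on `T` once `T ≥ k`. -/
theorem stationaryState_eq {σc γ : ℝ} (hσc : 0 < σc) (hγ : 0 < γ) {pinf : ℝ → ℝ}
    (h : IsStationaryState σc γ pinf) :
    ∀ᵐ σ, pinf σ = stationaryDensity σc γ (fluidity σc pinf) σ := by
  obtain ⟨-, hform⟩ := stationaryState_toL1 hσc hγ h
  set F := fluidity σc pinf with hF
  have hm : Measurable fun s => γ⁻¹ * F / expWeight σc γ s :=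
    (continuous_expWeight σc γ).measurable.const_div _
  have hS : Measurable (stationaryDensity σc γ F) := hm.indicator measurableSet_Ioi
  have key : ∀ k : ℕ, ∀ᵐ σ, σ < γ * k → pinf σ = stationaryDensity σc γ F σ := by
    intro k
    set D : ℝ → ℝ := (Iio (γ * k)).indicator fun σ => |pinf σ - stationaryDensity σc γ F σ| with hD
    have hDm : AEStronglyMeasurable D :=
      ((h.integrable.aestronglyMeasurable.sub hS.aestronglyMeasurable).norm).indicator
        measurableSet_Iio
    have hD0 : ∀ σ, 0 ≤ D σ := fun σ => indicator_nonneg (fun _ _ => abs_nonneg _) σ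
    have hle : ∀ n : ℕ, k ≤ n → ∀ᵐ σ, D σ ≤ |transported σc γ pinf n σ| := by
      intro n hn
      filter_upwards [hform n (Nat.cast_nonneg n)] with σ hσ
      by_cases hσk : σ ∈ Iio (γ * k)
      · rw [hD, indicator_of_mem hσk]
        have hσn : σ < γ * n := lt_of_lt_of_le hσk (by gcongr)
        have : emitted σc γ (fun _ => F) n σ = stationaryDensity σc γ F σ := by
          unfold emitted stationaryDensity
          by_cases h0 : σ ∈ Ioi (0 : ℝ)
          · rw [indicator_of_mem h0, indicator_of_mem (show σ ∈ Ioo 0 (γ * (n : ℝ)) from ⟨h0, hσn⟩)]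
          · rw [indicator_of_notMem h0, indicator_of_notMem fun h' => h0 h'.1]
        rw [hσ, this, add_sub_cancel_right]
      · rw [hD, indicator_of_notMem hσk]
        exact abs_nonneg _
    have hDi : Integrable D := (integrable_transported hσc hγ h.integrable k).abs.mono' hDm (by
      filter_upwards [hle k le_rfl] with σ hσ
      rwa [Real.norm_eq_abs, abs_of_nonneg (hD0 σ)])
    have hDn : ∀ n : ℕ, k ≤ n → ∫ σ, D σ ≤
        Real.exp (2 * (σc / γ)) * Real.exp (-(n : ℝ)) * ∫ σ, |pinf σ| := fun n hn =>
      (integral_mono_ae hDi (integrable_transported hσc hγ h.integrable n).abs (hle n hn)).trans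
        (integral_abs_transported_le hσc hγ h.integrable n)
    have hlim : Tendsto (fun n : ℕ => Real.exp (2 * (σc / γ)) * Real.exp (-(n : ℝ)) *
        ∫ σ, |pinf σ|) atTop (nhds 0) := by
      have := ((Real.tendsto_exp_neg_atTop_nhds_zero.comp
        tendsto_natCast_atTop_atTop).const_mul (Real.exp (2 * (σc / γ)))).mul_const
        (∫ σ, |pinf σ|)
      simpa using this
    have hz : ∫ σ, D σ = 0 := le_antisymm (ge_of_tendsto hlim (by
      filter_upwards [eventually_ge_atTop k] with n hn using hDn n hn)) (integral_nonneg hD0)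
    filter_upwards [(integral_eq_zero_iff_of_nonneg hD0 hDi).1 hz] with σ hσ hσk
    rw [hD, indicator_of_mem (show σ ∈ Iio (γ * (k : ℝ)) from hσk)] at hσ
    exact sub_eq_zero.1 (abs_eq_zero.1 hσ)
  filter_upwards [ae_all_iff.2 key] with σ hσ
  obtain ⟨k, hk⟩ := exists_nat_gt (σ / γ)
  rw [div_lt_iff₀ hγ, mul_comm] at hk
  exact hσ k hk

/-! ### From the fluidity to the density -/

theorem exp_neg_le_densityBound (γ b t σ : ℝ) : Real.exp (-t) ≤ densityBound γ b t σ := by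
  have : 0 ≤ (Ioo 0 (γ * t)).indicator (fun s => Real.exp (-b * t) * Real.exp (b * (s / γ)) +
      Real.exp (-t) * Real.exp (s / γ)) σ := indicator_nonneg (fun _ _ => by positivity) σ
  unfold densityBound
  linarith

/-- Pointwise estimate of the representation formula, given an estimate of the fluidity. -/
theorem abs_transported_add_emitted_sub_le {σc γ : ℝ} (hσc : 0 < σc) (hγ : 0 < γ)
    {q f : ℝ → ℝ} {F b C M : ℝ} (hC : 0 ≤ C)
    (hf : ∀ t ≥ 0, |f t - F| ≤ C * (Real.exp (-b * t) + Real.exp (-t))) {t σ : ℝ}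
    (hq : |q (σ - γ * t)| ≤ M) :
    |transported σc γ q t σ + emitted σc γ f t σ - stationaryDensity σc γ F σ| ≤
      (Real.exp (2 * (σc / γ)) * M + γ⁻¹ * C + γ⁻¹ * |F| * Real.exp (σc / γ)) *
        densityBound γ b t σ := by
  have hB := exp_neg_le_densityBound γ b t σ
  have hB0 : 0 ≤ densityBound γ b t σ := (Real.exp_pos _).le.trans hB
  have h1 : |transported σc γ q t σ| ≤ Real.exp (2 * (σc / γ)) * M * densityBound γ b t σ := by
    refine (abs_transported_le hσc hγ q t σ).trans ?_
    calc Real.exp (2 * (σc / γ)) * Real.exp (-t) * |q (σ - γ * t)|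
        ≤ Real.exp (2 * (σc / γ)) * densityBound γ b t σ * M := by gcongr
      _ = _ := by ring
  have h2 : |emitted σc γ f t σ - stationaryDensity σc γ F σ| ≤
      (γ⁻¹ * C + γ⁻¹ * |F| * Real.exp (σc / γ)) * densityBound γ b t σ := by
    have hp1 : 0 ≤ γ⁻¹ * C * densityBound γ b t σ := by positivity
    have hp2 : 0 ≤ γ⁻¹ * |F| * Real.exp (σc / γ) * densityBound γ b t σ := by positivity
    rw [add_mul]
    unfold emitted stationaryDensity
    -- Three regions: for `σ ≤ 0` both terms vanish, for `0 < σ < γ t` the fluidity estimate enters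
    -- at time `t - σ / γ`, and for `σ ≥ γ t` only the stationary tail remains, of order `exp (-t)`.
    by_cases h0 : σ ∈ Ioi (0 : ℝ)
    · have h0' : 0 < σ := h0
      rw [indicator_of_mem h0]
      by_cases h3 : σ ∈ Ioo 0 (γ * t)
      · rw [indicator_of_mem h3]
        have hs : 0 ≤ t - σ / γ := by
          rw [sub_nonneg, div_le_iff₀ hγ, mul_comm t]
          exact h3.2.le
        have hw := one_le_expWeight hσc hγ h0'.le
        have e : γ⁻¹ * f (t - σ / γ) / expWeight σc γ σ - γ⁻¹ * F / expWeight σc γ σ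
            = γ⁻¹ * (f (t - σ / γ) - F) / expWeight σc γ σ := by ring
        have hb1 : C * (Real.exp (-b * (t - σ / γ)) + Real.exp (-(t - σ / γ)))
            ≤ C * densityBound γ b t σ := by
          gcongr
          unfold densityBound
          rw [indicator_of_mem h3, ← Real.exp_add, ← Real.exp_add]
          have e1 : -b * (t - σ / γ) = -b * t + b * (σ / γ) := by ring
          have e2 : -(t - σ / γ) = -t + σ / γ := by ring
          rw [e1, e2]
          linarith [Real.exp_pos (-t)]
        rw [e, abs_div, abs_mul, abs_of_pos (inv_pos.2 hγ), abs_of_pos (expWeight_pos _ _ _)]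
        refine (div_le_self (by positivity) hw).trans ?_
        calc γ⁻¹ * |f (t - σ / γ) - F| ≤ γ⁻¹ * (C * densityBound γ b t σ) := by
              gcongr
              exact (hf _ hs).trans hb1
          _ ≤ _ := by linarith
      · rw [indicator_of_notMem h3, zero_sub, abs_neg, abs_div, abs_mul,
          abs_of_pos (inv_pos.2 hγ), abs_of_pos (expWeight_pos _ _ _)]
        have h4 : γ * t ≤ σ := by
          by_contra! hlt
          exact h3 ⟨h0, hlt⟩
        have h5 : (expWeight σc γ σ)⁻¹ ≤ Real.exp (σc / γ) * densityBound γ b t σ := by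
          calc (expWeight σc γ σ)⁻¹ ≤ (Real.exp ((σ - σc) / γ))⁻¹ :=
                inv_anti₀ (Real.exp_pos _) (exp_div_le_expWeight hσc hγ σ)
            _ = Real.exp (σc / γ) * Real.exp (-(σ / γ)) := by
                rw [← Real.exp_neg, ← Real.exp_add]
                congr 1
                ring
            _ ≤ Real.exp (σc / γ) * Real.exp (-t) := by
                gcongr
                rw [le_div_iff₀ hγ]
                linarith
            _ ≤ _ := by gcongr
        calc γ⁻¹ * |F| / expWeight σc γ σ = γ⁻¹ * |F| * (expWeight σc γ σ)⁻¹ := div_eq_mul_inv _ _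
          _ ≤ γ⁻¹ * |F| * (Real.exp (σc / γ) * densityBound γ b t σ) := by gcongr
          _ ≤ _ := by linarith
    · rw [indicator_of_notMem h0, indicator_of_notMem fun h' => h0 h'.1, sub_zero, abs_zero]
      positivity
  rw [add_sub_assoc]
  refine (abs_add_le _ _).trans ((add_le_add h1 h2).trans (le_of_eq ?_))
  ring

theorem IsInitialDatum.exists_ae_bound {p₀ : ℝ → ℝ} (h : IsInitialDatum p₀) :
    ∃ M, 0 ≤ M ∧ ∀ᵐ σ, |p₀ σ| ≤ M := by
  refine ⟨(eLpNorm p₀ ⊤ volume).toReal, ENNReal.toReal_nonneg, ?_⟩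
  have hfin : eLpNorm p₀ ⊤ volume ≠ ⊤ := h.bounded.2.ne
  filter_upwards [ae_le_eLpNormEssSup (f := p₀) (μ := volume)] with σ hσ
  rw [← eLpNorm_exponent_top] at hσ
  have := ENNReal.toReal_mono hfin hσ
  simpa using this

/-- The estimate of the fluidity implies the estimate of the density. -/
theorem densityEstimate_of_fluidityEstimate {σc γ : ℝ} (hσc : 0 < σc) (hγ : 0 < γ)
    {p₀ : ℝ → ℝ} {p : ℝ → (ℝ →₁[volume] ℝ)} {pinf : ℝ → ℝ} (h₀ : IsInitialDatum p₀)
    (hp : IsSolution σc (fun _ => γ) p₀ p) (hinf : IsStationaryState σc γ pinf) {b C : ℝ}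
    (hC : 0 < C) (h : FluidityEstimate σc b C p pinf) : DensityEstimate γ b p pinf := by
  obtain ⟨M, hM0, hM⟩ := h₀.exists_ae_bound
  refine ⟨Real.exp (2 * (σc / γ)) * M + γ⁻¹ * C +
    γ⁻¹ * |fluidity σc pinf| * Real.exp (σc / γ), by positivity, fun t ht => ?_⟩
  have hM' : ∀ᵐ σ, |p 0 σ| ≤ M := by
    filter_upwards [hM, hp.initial] with σ h1 h2
    rwa [h2]
  have hshift : ∀ᵐ σ, |p 0 (σ - γ * t)| ≤ M :=
    (measurePreserving_sub_right volume (γ * t)).quasiMeasurePreserving.ae hM'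
  filter_upwards [ae_eq_transported_add_emitted hσc hγ hp.continuousOn hp.equation ht,
    stationaryState_eq hσc hγ hinf, hshift] with σ h1 h2 h3
  rw [h1, h2]
  exact abs_transported_add_emitted_sub_le hσc hγ hC.le h h3

/-- The representation formula itself, with a measurable and everywhere bounded version of the
initial datum, is jointly measurable. The exceptional null set then comes only from the stationary
density and does not depend on `t`. -/
theorem pointwiseExpConvergence_of_fluidityEstimate {σc γ : ℝ} (hσc : 0 < σc) (hγ : 0 < γ)
    {p₀ : ℝ → ℝ} {p : ℝ → (ℝ →₁[volume] ℝ)} {pinf : ℝ → ℝ} (h₀ : IsInitialDatum p₀)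
    (hp : IsSolution σc (fun _ => γ) p₀ p) (hinf : IsStationaryState σc γ pinf) {b C : ℝ}
    (hb : 0 < b) (hC : 0 < C) (h : FluidityEstimate σc b C p pinf) :
    PointwiseExpConvergence p pinf := by
  obtain ⟨M, hM0, hM⟩ := h₀.exists_ae_bound
  set q₁ := h₀.integrable.aestronglyMeasurable.mk p₀ with hq₁
  have hq₁m : Measurable q₁ := h₀.integrable.aestronglyMeasurable.stronglyMeasurable_mk.measurable
  set q : ℝ → ℝ := {σ | |q₁ σ| ≤ M}.indicator q₁ with hq
  have hqm : Measurable q := hq₁m.indicator (measurableSet_le hq₁m.abs measurable_const)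
  have hqM : ∀ σ, |q σ| ≤ M := fun σ => by
    by_cases hσ : σ ∈ {σ | |q₁ σ| ≤ M}
    · rw [hq, indicator_of_mem hσ]
      exact hσ
    · rw [hq, indicator_of_notMem hσ, abs_zero]
      exact hM0
  have hqae : ∀ᵐ σ, p 0 σ = q σ := by
    filter_upwards [hM, hp.initial, h₀.integrable.aestronglyMeasurable.ae_eq_mk] with σ h1 h2 h3
    rw [h2, hq, indicator_of_mem (show σ ∈ {σ | |q₁ σ| ≤ M} by rw [mem_ofPred_eq, hq₁, ← h3]; exact h1),
      hq₁, ← h3]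
  set f : ℝ → ℝ := fun t => fluidity σc (p (max t 0)) with hf
  have hfc : Continuous f :=
    (continuousOn_fluidity hp.continuousOn σc).comp_continuous (by fun_prop)
      fun t => le_max_right t 0
  have hfe : ∀ t ≥ 0, |f t - fluidity σc pinf| ≤ C * (Real.exp (-b * t) + Real.exp (-t)) := by
    intro t ht
    simp only [hf, max_eq_left ht]
    exact h t ht
  refine ⟨fun t σ => transported σc γ q t σ + emitted σc γ f t σ, ?_, fun t ht => ?_,
    min b 1, lt_min hb one_pos, ?_⟩
  · have hw := continuous_expWeight σc γ
    have m1 : Measurable fun x : ℝ × ℝ => q (x.2 - γ * x.1) *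
        (expWeight σc γ (x.2 - γ * x.1) / expWeight σc γ x.2) :=
      (hqm.comp (by fun_prop)).mul ((hw.measurable.comp (by fun_prop)).div
        (hw.measurable.comp measurable_snd))
    have m2 : Measurable fun x : ℝ × ℝ => γ⁻¹ * f (x.1 - x.2 / γ) / expWeight σc γ x.2 :=
      ((hfc.measurable.comp (by fun_prop)).const_mul _).div (hw.measurable.comp measurable_snd)
    have m3 : MeasurableSet {x : ℝ × ℝ | 0 < x.2 ∧ x.2 < γ * x.1} :=
      (measurableSet_lt measurable_const measurable_snd).inter
        (measurableSet_lt measurable_snd (measurable_fst.const_mul γ))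
    have e : (Function.uncurry fun t σ => transported σc γ q t σ + emitted σc γ f t σ)
        = fun x => q (x.2 - γ * x.1) *
          (expWeight σc γ (x.2 - γ * x.1) / expWeight σc γ x.2) +
          {x : ℝ × ℝ | 0 < x.2 ∧ x.2 < γ * x.1}.indicator
            (fun x => γ⁻¹ * f (x.1 - x.2 / γ) / expWeight σc γ x.2) x := by
      funext x
      rfl
    rw [e]
    exact m1.add (m2.indicator m3)
  · have hshift : ∀ᵐ σ, p 0 (σ - γ * t) = q (σ - γ * t) :=
      (measurePreserving_sub_right volume (γ * t)).quasiMeasurePreserving.ae hqae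
    filter_upwards [ae_eq_transported_add_emitted hσc hγ hp.continuousOn hp.equation ht,
      hshift] with σ h1 h2
    rw [h1, transported, transported, h2, emitted_congr (f := f)
      (g := fun t => fluidity σc (p t)) hγ fun s hs => by simp only [hf, max_eq_left hs]]
  · filter_upwards [stationaryState_eq hσc hγ hinf] with σ hσ
    set K := Real.exp (2 * (σc / γ)) * M + γ⁻¹ * C +
      γ⁻¹ * |fluidity σc pinf| * Real.exp (σc / γ) with hK
    have hK0 : 0 ≤ K := by positivity
    refine ⟨K * (1 + (Real.exp (b * (σ / γ)) + Real.exp (σ / γ))), fun t ht => ?_⟩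
    rw [hσ]
    refine (abs_transported_add_emitted_sub_le hσc hγ hC.le hfe (hqM _)).trans ?_
    rw [← hK, mul_assoc]
    gcongr
    have e1 : Real.exp (-t) ≤ Real.exp (-(min b 1) * t) :=
      Real.exp_le_exp.2 (by nlinarith [min_le_right b 1])
    have e2 : Real.exp (-b * t) ≤ Real.exp (-(min b 1) * t) :=
      Real.exp_le_exp.2 (by nlinarith [min_le_left b 1])
    have e3 : (Ioo 0 (γ * t)).indicator (fun s => Real.exp (-b * t) * Real.exp (b * (s / γ)) +
        Real.exp (-t) * Real.exp (s / γ)) σ ≤ Real.exp (-b * t) * Real.exp (b * (σ / γ)) +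
        Real.exp (-t) * Real.exp (σ / γ) := indicator_le_self' (fun _ _ => by positivity) σ
    unfold densityBound
    calc _ ≤ Real.exp (-t) + (Real.exp (-b * t) * Real.exp (b * (σ / γ)) +
          Real.exp (-t) * Real.exp (σ / γ)) := by gcongr
      _ ≤ Real.exp (-(min b 1) * t) + (Real.exp (-(min b 1) * t) * Real.exp (b * (σ / γ)) +
          Real.exp (-(min b 1) * t) * Real.exp (σ / γ)) := by gcongr
      _ = _ := by ring

theorem fluidityEstimate_of_renewal {σc γ : ℝ} (hσc : 0 < σc) (hγ : 0 < γ)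
    {p₀ : ℝ → ℝ} {p : ℝ → (ℝ →₁[volume] ℝ)} {pinf : ℝ → ℝ} (h₀ : IsInitialDatum p₀)
    (hp : IsSolution σc (fun _ => γ) p₀ p) (hinf : IsStationaryState σc γ pinf) {b C : ℝ}
    (h : ∀ f, RenewalSystem (σc / γ) f → ∀ t ≥ 0,
      |f t - 1 / (1 + σc / γ)| ≤ C * (Real.exp (-b * t) + Real.exp (-t))) :
    FluidityEstimate σc b C p pinf := by
  have h1 : ∫ σ, p 0 σ = 1 := (integral_congr_ae hp.initial).trans h₀.integral_eq_one
  have habs : ∫ σ, |p 0 σ| ≤ 1 := by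
    rw [← h1]
    refine (integral_congr_ae ?_).le
    filter_upwards [hp.initial, h₀.nonneg] with σ e1 e2
    rw [abs_of_nonneg]
    rw [e1]
    exact e2
  intro t ht
  have := h _ (renewalSystem_fluidity hσc hγ hp.continuousOn hp.equation h1 habs) t ht
  rwa [← (stationaryState_toL1 hσc hγ hinf).1, max_eq_left ht] at this

/-! ### Constants depending continuously on the delay -/

/-- A partition of unity averages locally admissible constants, and convexity keeps the average
admissible. -/
theorem exists_continuousOn_forall_mem_convex {S : ℝ → Set ℝ} (hS : ∀ ω > 0, Convex ℝ (S ω))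
    (hloc : ∀ ω₀ > 0, ∃ c, ∀ᶠ ω in nhds ω₀, c ∈ S ω) :
    ∃ g : ℝ → ℝ, ContinuousOn g (Ioi 0) ∧ ∀ ω > 0, g ω ∈ S ω := by
  obtain ⟨g, hg⟩ := exists_continuous_forall_mem_convex_of_local_const
    (X := Ioi (0 : ℝ)) (t := fun ω => S ω) (fun ω => hS ω ω.2) fun ω₀ => by
      obtain ⟨c, hc⟩ := hloc ω₀ ω₀.2
      exact ⟨c, continuous_subtype_val.continuousAt.eventually hc⟩
  classical
  refine ⟨fun ω => if h : 0 < ω then g ⟨ω, h⟩ else 0, ?_, fun ω hω => ?_⟩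
  · rw [continuousOn_iff_continuous_domRestrict]
    refine g.continuous.congr fun ω => ?_
    have : 0 < (ω : ℝ) := ω.2
    simp [this]
  · simp only [hω.lt, dif_pos]
    exact hg ⟨ω, hω⟩

/-- Rate and prefactor are tied together as `c` and `1 / c`: lowering `c` weakens both, so the
admissible `c` form an interval. One continuous selection then supplies the rate and the continuous
prefactor. -/
theorem exists_rate : ∃ b : ℝ → ℝ, ContinuousOn b (Ioi 0) ∧ ∀ ω > 0, 0 < b ω ∧
    ∀ f, RenewalSystem ω f → ∀ t ≥ 0, |f t - 1 / (1 + ω)| ≤ 1 / b ω * Real.exp (-b ω * t) := by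
  refine exists_continuousOn_forall_mem_convex (S := fun ω => {c | 0 < c ∧
    ∀ f, RenewalSystem ω f → ∀ t ≥ 0, |f t - 1 / (1 + ω)| ≤ 1 / c * Real.exp (-c * t)})
    (fun ω _ => Set.OrdConnected.convex ⟨fun x hx y hy z hz => ?_⟩) fun ω₀ hω₀ => ?_
  · have hz0 : 0 < z := hx.1.trans_le hz.1
    refine ⟨hz0, fun f hf t ht => (hy.2 f hf t ht).trans ?_⟩
    have h1 := hz.2
    gcongr
  · obtain ⟨m, hm, hgr⟩ := exists_isGreatest_rootReals hω₀
    have hroot : ∀ z : ℂ, z ≠ 0 → delaySymbol ω₀ z = 0 → z.re < -(-m / 2) := fun z h1 h2 => by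
      have := hgr.2 ⟨z, h1, h2, rfl⟩
      linarith
    have hb0 : 0 < min (-m / 4) 1 := lt_min (by linarith) one_pos
    obtain ⟨C, hC, hev⟩ := eventually_renewal_estimate hω₀ hroot hb0
      ((min_le_left _ _).trans_lt (by linarith)) (min_le_right _ _)
    set b := min (-m / 4) 1 with hb
    have hc0 : 0 < min b (1 / C) := lt_min hb0 (by positivity)
    -- Small enough that the rate does not exceed `b` and the prefactor `1 / c` is at least `C`.
    refine ⟨min b (1 / C), ?_⟩
    filter_upwards [hev] with ω hω
    refine ⟨hc0, fun f hf t ht => (hω.2 f hf t ht).trans ?_⟩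
    have h1 : C ≤ 1 / min b (1 / C) := by
      rw [le_div_iff₀ hc0]
      calc C * min b (1 / C) ≤ C * (1 / C) := by
            gcongr
            exact min_le_right _ _
        _ = 1 := mul_one_div_cancel hC.ne'
    have h2 := min_le_left b (1 / C)
    gcongr

theorem exists_prefactor {η : ℝ} (hη : 0 < η) : ∃ C : ℝ → ℝ, ContinuousOn C (Ioi 0) ∧
    ∀ ω > 0, 0 < C ω ∧ ∀ m, IsGreatest (rootReals ω) m → 0 < -m - η →
      ∀ f, RenewalSystem ω f → ∀ t ≥ 0,
        |f t - 1 / (1 + ω)| ≤ C ω * (Real.exp (-(-m - η) * t) + Real.exp (-t)) := by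
  refine exists_continuousOn_forall_mem_convex (S := fun ω => {C | 0 < C ∧
    ∀ m, IsGreatest (rootReals ω) m → 0 < -m - η → ∀ f, RenewalSystem ω f → ∀ t ≥ 0,
      |f t - 1 / (1 + ω)| ≤ C * (Real.exp (-(-m - η) * t) + Real.exp (-t))})
    (fun ω _ => Set.OrdConnected.convex ⟨fun x hx y hy z hz => ?_⟩) fun ω₀ hω₀ => ?_
  · refine ⟨hx.1.trans_le hz.1, fun m hm h0 f hf t ht => (hx.2 m hm h0 f hf t ht).trans ?_⟩
    have h1 := hz.1
    gcongr
  · obtain ⟨m₀, hm₀, hgr⟩ := exists_isGreatest_rootReals hω₀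
    obtain ⟨z₀, hz₀, hr₀, hre₀⟩ := mem_rootReals.1 hgr.1
    -- Persistence gives `m ≥ m₀ - η / 4` for nearby delays, so the rate asked for, `-m - η`, is at
    -- most `-m₀ - 3 η / 4`. This leaves room below `-m₀ - η / 2`. If that bound is not positive, no
    -- admissible rate exists nearby and any prefactor will do.
    have hpers := eventually_exists_delaySymbol_root hω₀ hz₀ hr₀ (ε := η / 4) (by positivity)
    rw [hre₀] at hpers
    rcases le_or_gt (-m₀ - 3 * η / 4) 0 with hneg | hpos
    · refine ⟨1, ?_⟩
      filter_upwards [hpers] with ω hω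
      refine ⟨one_pos, fun m hm h0 => ?_⟩
      obtain ⟨z, hz, hr, hre⟩ := hω
      have := hm.2 ⟨z, hz, hr, rfl⟩
      linarith
    · have hroot : ∀ z : ℂ, z ≠ 0 → delaySymbol ω₀ z = 0 → z.re < -(-m₀ - η / 2) :=
        fun z h1 h2 => by
          have := hgr.2 ⟨z, h1, h2, rfl⟩
          linarith
      have hb0 : 0 < min (-m₀ - 3 * η / 4) 1 := lt_min hpos one_pos
      obtain ⟨C, hC, hev⟩ := eventually_renewal_estimate hω₀ hroot hb0
        ((min_le_left _ _).trans_lt (by linarith)) (min_le_right _ _)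
      refine ⟨C, ?_⟩
      filter_upwards [hpers, hev] with ω hω hω'
      refine ⟨hC, fun m hm h0 f hf t ht => (hω'.2 f hf t ht).trans ?_⟩
      obtain ⟨z, hz, hr, hre⟩ := hω
      have hmz := hm.2 ⟨z, hz, hr, rfl⟩
      gcongr
      -- The renewal estimate is limited to rates at most `1`; when this cap is active, the term
      -- `exp (-t)` of the bound takes over.
      rcases min_choice (-m₀ - 3 * η / 4) 1 with h | h
      · rw [h]
        have : Real.exp (-(-m₀ - 3 * η / 4) * t) ≤ Real.exp (-(-m - η) * t) :=
          Real.exp_le_exp.2 (mul_le_mul_of_nonneg_right (by linarith) ht)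
        linarith [Real.exp_pos (-t)]
      · rw [h, neg_one_mul]
        linarith [Real.exp_pos (-(-m - η) * t)]

/-! ### Conclusion -/

theorem theorem5p1 :
    -- convergence, with some rate `b > 0`
    (∃ b C₂ : ℝ → ℝ, (∀ ω > 0, 0 < b ω) ∧ ContinuousOn C₂ (Ioi 0) ∧ (∀ ω > 0, 0 < C₂ ω) ∧
      ∀ σc > 0, ∀ γ > 0, ∀ (p₀ : ℝ → ℝ) (p : ℝ → (ℝ →₁[volume] ℝ)) (pinf : ℝ → ℝ),
        IsInitialDatum p₀ → IsSolution σc (fun _ => γ) p₀ p → IsStationaryState σc γ pinf →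
        PointwiseExpConvergence p pinf ∧
        DensityEstimate γ (b (σc / γ)) p pinf ∧
        FluidityEstimate σc (b (σc / γ)) (C₂ (σc / γ)) p pinf) ∧
    -- the two maxima that describe the rate exist and are negative
    (∀ ω > 0, (∃ m < 0, IsGreatest (rootReals ω) m) ∧ ∃ m < 0, IsGreatest (rateReals ω) m) ∧
    -- the rate can be chosen as `-m - η`
    (∀ η > 0, ∃ C₂ : ℝ → ℝ, ContinuousOn C₂ (Ioi 0) ∧ (∀ ω > 0, 0 < C₂ ω) ∧
      ∀ σc > 0, ∀ γ > 0, ∀ (p₀ : ℝ → ℝ) (p : ℝ → (ℝ →₁[volume] ℝ)) (pinf : ℝ → ℝ),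
        IsInitialDatum p₀ → IsSolution σc (fun _ => γ) p₀ p → IsStationaryState σc γ pinf →
        ∀ m, (IsGreatest (rootReals (σc / γ)) m ∨ IsGreatest (rateReals (σc / γ)) m) →
          0 < -m - η →
          DensityEstimate γ (-m - η) p pinf ∧
          FluidityEstimate σc (-m - η) (C₂ (σc / γ)) p pinf) := by
  refine ⟨?_, fun ω hω => ⟨exists_isGreatest_rootReals hω, exists_isGreatest_rateReals hω⟩,
    fun η hη => ?_⟩
  · obtain ⟨b, hbc, hb⟩ := exists_rate
    refine ⟨b, fun ω => 1 / b ω, fun ω hω => (hb ω hω).1,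
      continuousOn_const.div hbc fun ω hω => (hb ω hω).1.ne',
      fun ω hω => one_div_pos.2 (hb ω hω).1, fun σc hσc γ hγ p₀ p pinf h₀ hp hinf => ?_⟩
    have hω : 0 < σc / γ := div_pos hσc hγ
    have hb0 := (hb _ hω).1
    have hfl : FluidityEstimate σc (b (σc / γ)) (1 / b (σc / γ)) p pinf :=
      fluidityEstimate_of_renewal hσc hγ h₀ hp hinf fun f hf t ht =>
        ((hb _ hω).2 f hf t ht).trans (by
          gcongr
          linarith [Real.exp_pos (-t)])
    exact ⟨pointwiseExpConvergence_of_fluidityEstimate hσc hγ h₀ hp hinf hb0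
      (one_div_pos.2 hb0) hfl, densityEstimate_of_fluidityEstimate hσc hγ h₀ hp hinf
      (one_div_pos.2 hb0) hfl, hfl⟩
  · obtain ⟨C, hCc, hC⟩ := exists_prefactor hη
    refine ⟨C, hCc, fun ω hω => (hC ω hω).1,
      fun σc hσc γ hγ p₀ p pinf h₀ hp hinf m hm hpos => ?_⟩
    have hω : 0 < σc / γ := div_pos hσc hγ
    obtain ⟨m', -, hm'⟩ := exists_isGreatest_rootReals hω
    -- Whichever maximum `m` is, it is at least the root maximum, so the rate `-m - η` does not
    -- exceed the one already established.
    have hle : m' ≤ m := by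
      rcases hm with hm | hm
      · exact (hm'.unique hm).le
      · exact hm.2 (rootReals_subset_rateReals hω hm'.1)
    have hfl : FluidityEstimate σc (-m - η) (C (σc / γ)) p pinf :=
      fluidityEstimate_of_renewal hσc hγ h₀ hp hinf fun f hf t ht =>
        ((hC _ hω).2 m' hm' (by linarith) f hf t ht).trans (by
          have := (hC _ hω).1
          gcongr)
    exact ⟨densityEstimate_of_fluidityEstimate hσc hγ h₀ hp hinf (hC _ hω).1 hfl, hfl⟩
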